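/- A virtual knot diagram is a planar diagram of a single closed curve whose crossings are either classical (with over/under information) or virtual. Welded knots are the equivalence classes of (unoriented) virtual knot diagrams under planar isotopy, the classical Reidemeister moves, the virtual Reidemeister moves (including the mixed move in which a strand with two virtual crossings passes a classical crossing), and the over-crossings-commute (OCC) relation, which allows a strand that crosses over two other strands to be moved across a virtual crossing of these two strands. For an oriented virtual knot diagram $D$, an unrestricted $n$-dance configuration consists of $n$ initial points on $D$ such that the following is possible: one dancer starts at each initial point, travels along $D$ in the direction of the orientation, and stops at the next initial point; the varying speeds of the $n$ dancers can be chosen so that every classical crossing is passed on its over-strand before it is passed on its under-strand. Dancers pass freely through virtual crossings. The unrestricted danceability index $da^{(u)}(K)$ of a welded knot $K$ is the minimum $n$ such that some diagram of $K$, with some orientation, admits an unrestricted $n$-dance configuration. An over-bridge of a virtual knot diagram is a maximal arc of the diagram that passes through no classical undercrossing and through at least one classical overcrossing (it may pass through virtual crossings); a diagram without classical crossings is counted as having one over-bridge. The over-bridge index $b_1(K)$ of a welded knot $K$ is the minimum number of over-bridges over all diagrams of $K$. **Theorem.** For every welded knot $K$, $da^{(u)}(K)=b_1(K)$. -/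

import Mathlib

/-!
Unoriented planar diagrams with classical and virtual crossings are written as words: a diagram in
general position with respect to the height function of the plane is cut by horizontal lines into
slices, each of which contains one local minimum, one local maximum, or one crossing, besides
vertical strands. Words are read from bottom to top.
-/

namespace Welded

/-- The crossings of a planar diagram. `slash`: classical, the strand from bottom left to top right
is the over-strand. `backslash`: classical, the strand from bottom right to top left is the
over-strand. `virt`: virtual. -/
inductive Crossing
  | slash
  | backslash
  | virt
  deriving DecidableEq

/-- Exchange of the over-strand and the under-strand. -/
def Crossing.flip : Crossing → Crossing
  | slash => backslash
  | backslash => slash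
  | virt => virt

/-- What a slice contains: a local minimum `∪`, a local maximum `∩`, or a crossing. -/
inductive Piece
  | cup
  | cap
  | cross (t : Crossing)
  deriving DecidableEq

/-- The number of strands that enter a piece from below. -/
def Piece.ins : Piece → ℕ
  | cup => 0
  | cap => 2
  | cross _ => 2

/-- The number of strands that leave a piece at the top. -/
def Piece.outs : Piece → ℕ
  | cup => 2
  | cap => 0
  | cross _ => 2

/-- The slice with `pos` vertical strands on the left of its piece (and any number on the right). -/
structure Slice where
  pos : ℕ
  piece : Piece
  deriving DecidableEq

/-- The slice with `p` further vertical strands on the left. -/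
def Slice.shift (p : ℕ) (s : Slice) : Slice := ⟨p + s.pos, s.piece⟩

/-- Slices from bottom to top. -/
abbrev Word := List Slice

/-- `IsTangle m w n`: the slices of `w` fit together to a planar tangle diagram with `m` end points
at the bottom and `n` at the top; `r` is the number of strands on the right of the piece. -/
inductive IsTangle : ℕ → Word → ℕ → Prop
  | nil (n : ℕ) : IsTangle n [] n
  | cons (p r : ℕ) (g : Piece) (w : Word) (n : ℕ) :
      IsTangle (p + g.outs + r) w n → IsTangle (p + g.ins + r) (⟨p, g⟩ :: w) n

/-! ### Planar isotopy, generalized Reidemeister moves and the OCC relation -/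

/-- Three strands `a`, `b`, `c`, from left to right at the bottom, cross each other pairwise.
`Triangle ab ac bc` says for which types of the three crossings the triangle between them may be
passed.
* One strand is over both others (`over…`): the third crossing may be classical (this is the
  third Reidemeister move, a strand on top exists in each of its forms) or virtual (this is the OCC
  relation).
* One strand meets both others in virtual crossings (`virt…`): the third crossing may be virtual or
  classical (these are the third virtual Reidemeister move and the mixed move). -/
inductive Triangle : Crossing → Crossing → Crossing → Prop
  | overA (bc : Crossing) : Triangle .slash .slash bc
  | overB (ac : Crossing) : Triangle .backslash ac .slash
  | overC (ab : Crossing) : Triangle ab .backslash .backslash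
  | virtA (bc : Crossing) : Triangle .virt .virt bc
  | virtB (ac : Crossing) : Triangle .virt ac .virt
  | virtC (ab : Crossing) : Triangle ab .virt .virt

/-- The local moves of welded knot diagrams. -/
inductive LocalMove : Word → Word → Prop
  /-- Planar isotopy: pieces at different places exchange their heights. -/
  | exchange (g h : Piece) (r : ℕ) :
      LocalMove [⟨0, g⟩, ⟨g.outs + r, h⟩] [⟨g.ins + r, h⟩, ⟨0, g⟩]
  /-- Planar isotopy: a maximum and a minimum of one strand cancel. -/
  | zigzagLeft : LocalMove [⟨1, .cup⟩, ⟨0, .cap⟩] []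
  | zigzagRight : LocalMove [⟨0, .cup⟩, ⟨1, .cap⟩] []
  /-- Planar isotopy: a strand that crosses the strand of a maximum (minimum) on one side of this
  maximum (minimum) crosses it on the other side instead. -/
  | slideCap (t : Crossing) :
      LocalMove [⟨1, .cross t⟩, ⟨0, .cap⟩] [⟨0, .cross t.flip⟩, ⟨1, .cap⟩]
  | slideCup (t : Crossing) :
      LocalMove [⟨0, .cup⟩, ⟨1, .cross t⟩] [⟨1, .cup⟩, ⟨0, .cross t.flip⟩]
  /-- First Reidemeister moves, classical and virtual. -/
  | kinkCap (t : Crossing) : LocalMove [⟨0, .cross t⟩, ⟨0, .cap⟩] [⟨0, .cap⟩]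
  | kinkCup (t : Crossing) : LocalMove [⟨0, .cup⟩, ⟨0, .cross t⟩] [⟨0, .cup⟩]
  /-- Second Reidemeister moves, classical and virtual. -/
  | bigon (t : Crossing) : LocalMove [⟨0, .cross t⟩, ⟨0, .cross t.flip⟩] []
  /-- Third Reidemeister moves (classical, virtual and mixed), and the OCC relation. -/
  | triangle (ab ac bc : Crossing) (h : Triangle ab ac bc) :
      LocalMove [⟨0, .cross ab⟩, ⟨1, .cross ac⟩, ⟨0, .cross bc⟩]
        [⟨1, .cross bc⟩, ⟨0, .cross ac⟩, ⟨1, .cross ab⟩]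

/-- One local move, applied somewhere in a closed diagram. -/
def Step (w w' : Word) : Prop :=
  IsTangle 0 w 0 ∧ IsTangle 0 w' 0 ∧
    ∃ (p : ℕ) (l r u v : Word), LocalMove l r ∧
      w = u ++ l.map (Slice.shift p) ++ v ∧ w' = u ++ r.map (Slice.shift p) ++ v

/-- Welded equivalence of diagrams. -/
def Equivalent : Word → Word → Prop := Relation.EqvGen Step

/-! ### Travelling along a diagram

Level `k` of a word is the horizontal line just below its `k`-th slice (counted from `0`). -/

/-- A point where the diagram meets a level line, given by the level and by its position on the line
(counted from the left, from `0`), with a direction of travel, upwards or downwards. -/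
@[ext]
structure DirPoint where
  level : ℕ
  pos : ℕ
  up : Bool
  deriving DecidableEq

/-- The `j`-th point of level `k` exists. -/
def IsPoint (w : Word) (k j : ℕ) : Prop := ∃ n, IsTangle 0 (w.take k) n ∧ j < n

/-- Where a traveller leaves a slice that is entered from below at position `j`: the position, and
`true` for the top side, `false` for the bottom side. -/
def Slice.fromBelow (s : Slice) (j : ℕ) : ℕ × Bool :=
  if j < s.pos then (j, true) else
  match s.piece with
  | .cup => (j + 2, true)
  | .cap => if j = s.pos then (s.pos + 1, false)
      else if j = s.pos + 1 then (s.pos, false) else (j - 2, true)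
  | .cross _ => if j = s.pos then (s.pos + 1, true)
      else if j = s.pos + 1 then (s.pos, true) else (j, true)

/-- Where a traveller leaves a slice that is entered from above at position `j`. -/
def Slice.fromAbove (s : Slice) (j : ℕ) : ℕ × Bool :=
  if j < s.pos then (j, false) else
  match s.piece with
  | .cup => if j = s.pos then (s.pos + 1, true)
      else if j = s.pos + 1 then (s.pos, true) else (j - 2, false)
  | .cap => (j + 2, false)
  | .cross _ => if j = s.pos then (s.pos + 1, false)
      else if j = s.pos + 1 then (s.pos, false) else (j, false)

/-- The directed point that a traveller reaches when passing from slice number `k` through the side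
given by the Boolean. -/
def leave (k : ℕ) (e : ℕ × Bool) : DirPoint := ⟨if e.2 then k + 1 else k, e.1, e.2⟩

/-- The traveller at `x` goes on through the next slice along the diagram. (Outside of the diagram
the traveller stays, a case that does not occur in closed diagrams.) -/
def travel (w : Word) (x : DirPoint) : DirPoint :=
  match x with
  | ⟨k, j, true⟩ => match w[k]? with
    | some s => leave k (s.fromBelow j)
    | none => x
  | ⟨0, _, false⟩ => x
  | ⟨k + 1, j, false⟩ => match w[k]? with
    | some s => leave k (s.fromAbove j)
    | none => x

/-- `O` is an orientation of the diagram `w` of a knot: it chooses one direction at each point,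
these choices are compatible along the diagram, and the diagram is one closed curve. -/
structure IsOrientation (w : Word) (O : Set DirPoint) : Prop where
  isPoint : ∀ x ∈ O, IsPoint w x.level x.pos
  existsUnique : ∀ k j, IsPoint w k j → ∃! d : Bool, (⟨k, j, d⟩ : DirPoint) ∈ O
  travel_mem : ∀ x ∈ O, travel w x ∈ O
  nonempty : O.Nonempty
  connected : ∀ x ∈ O, ∀ y ∈ O, ∃ n : ℕ, (travel w)^[n] x = y

/-- Unoriented planar knot diagrams with classical and virtual crossings. -/
structure KnotDiagram where
  word : Word
  closed : IsTangle 0 word 0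
  isKnot : ∃ O, IsOrientation word O

/-- The knot diagrams up to the moves of welded knot theory. -/
instance weldedSetoid : Setoid KnotDiagram where
  r D E := Equivalent D.word E.word
  iseqv := ⟨fun D => .refl D.word, fun h => .symm _ _ h, fun h h' => .trans _ _ _ h h'⟩

/-- Welded knots. -/
abbrev WeldedKnot : Type := Quotient weldedSetoid

/-! ### Classical crossings -/

/-- Going on from `x`, a traveller passes the classical crossing in slice `k` on its over-strand. -/
def PassesOver (w : Word) (k : ℕ) (x : DirPoint) : Prop :=
  ∃ p, (w[k]? = some ⟨p, .cross .slash⟩ ∧ (x = ⟨k, p, true⟩ ∨ x = ⟨k + 1, p + 1, false⟩)) ∨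
    (w[k]? = some ⟨p, .cross .backslash⟩ ∧ (x = ⟨k, p + 1, true⟩ ∨ x = ⟨k + 1, p, false⟩))

/-- Going on from `x`, a traveller passes the classical crossing in slice `k` on its
under-strand. -/
def PassesUnder (w : Word) (k : ℕ) (x : DirPoint) : Prop :=
  ∃ p, (w[k]? = some ⟨p, .cross .slash⟩ ∧ (x = ⟨k, p + 1, true⟩ ∨ x = ⟨k + 1, p, false⟩)) ∨
    (w[k]? = some ⟨p, .cross .backslash⟩ ∧ (x = ⟨k, p, true⟩ ∨ x = ⟨k + 1, p + 1, false⟩))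

/-- The diagram has a classical crossing. -/
def HasClassicalCrossing (w : Word) : Prop :=
  ∃ s ∈ w, s.piece = .cross .slash ∨ s.piece = .cross .backslash

/-! ### The unrestricted danceability index -/

/-- `S` is the set of initial points of an unrestricted dance configuration of the diagram `w` with
orientation `O`. One dancer starts at each point of `S`, travels along the orientation, and stops
at the next point of `S`. The speeds of all dancers are recorded by the times `τ x` at which the
part of the diagram from `x` to the next level line is danced: along the path of each dancer these
times increase, and each classical crossing is passed on its over-strand first. Virtual crossings
impose no condition. -/
def IsDanceConfiguration (w : Word) (O : Set DirPoint) (S : Finset DirPoint) : Prop :=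
  (∀ x ∈ S, x ∈ O) ∧
    ∃ τ : DirPoint → ℝ,
      (∀ x ∈ O, travel w x ∉ S → τ x < τ (travel w x)) ∧
      ∀ k, ∀ x ∈ O, ∀ y ∈ O, PassesOver w k x → PassesUnder w k y → τ x < τ y

/-- The unrestricted number of an oriented diagram. -/
noncomputable def unrestrictedNumber (w : Word) (O : Set DirPoint) : ℕ :=
  sInf {n | ∃ S : Finset DirPoint, S.card = n ∧ IsDanceConfiguration w O S}

/-- The unrestricted danceability index: the minimum of the unrestricted number over all diagrams
of `K` and all their orientations. -/
noncomputable def WeldedKnot.unrestrictedIndex (K : WeldedKnot) : ℕ :=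
  sInf {n | ∃ (D : KnotDiagram) (O : Set DirPoint),
    Quotient.mk weldedSetoid D = K ∧ IsOrientation D.word O ∧ unrestrictedNumber D.word O = n}

/-! ### The over-bridge index -/

/-- The unbroken arc that starts behind the undercrossing passed from `x`, and ends before the next
undercrossing, contains a classical overcrossing, so that it is an over-bridge. -/
def StartsOverBridge (w : Word) (x : DirPoint) : Prop :=
  (∃ k, PassesUnder w k x) ∧
    ∃ m : ℕ, 0 < m ∧ (∃ k, PassesOver w k ((travel w)^[m] x)) ∧
      ∀ i, 0 < i → i < m → ¬ ∃ k, PassesUnder w k ((travel w)^[i] x)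

open Classical in
/-- The number of over-bridges of a diagram (it does not depend on the orientation `O`, which is
used to list each over-bridge once, by the undercrossing where it starts). By convention a diagram
without classical crossings, a single unbroken closed curve, counts as one over-bridge. -/
noncomputable def overBridgeNumber (w : Word) (O : Set DirPoint) : ℕ :=
  if HasClassicalCrossing w then {x | x ∈ O ∧ StartsOverBridge w x}.ncard else 1

/-- The over-bridge index `b₁`: the minimum number of over-bridges over all diagrams of `K`. -/
noncomputable def WeldedKnot.overBridgeIndex (K : WeldedKnot) : ℕ :=
  sInf {n | ∃ (D : KnotDiagram) (O : Set DirPoint),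
    Quotient.mk weldedSetoid D = K ∧ IsOrientation D.word O ∧ overBridgeNumber D.word O = n}

end Welded

namespace Welded

/-! ### Tangles -/

/-! From over-bridges to a dance: place an initial point behind each undercrossing where an
over-bridge starts. Before the next initial point, a dancer passes overcrossings first and
undercrossings afterwards, never an overcrossing behind an undercrossing. So the dance can be done
in two phases, in which all overcrossings are passed before any undercrossing
(`IsOrientation.isDanceConfiguration`, `IsOrientation.exists_isDanceConfiguration`).

From a dance to over-bridges: up to virtual detours, a diagram is determined by its classical
crossings and by the way in which their ends are joined, as in a Gauss diagram. `diagram` realizes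
such data: boxes with labelled ends, and virtual joins between equal labels. Neither the order of
the joins nor the order of the boxes matters (`joinIn_perm`, `diagram_perm`), and every oriented
diagram can be brought to this form (`IsOrientation.exists_diagram`). The central move is `TE.push`:
if a strand y passes under a and then over b, it may instead pass over b first and under a
afterwards, provided that b passes under a once more before and once more after its passage under y.
The aim is to push every over-passage back along its strand until no under-passage lies between it
and the preceding initial point.

Since pushing creates new crossings, termination needs an argument, and this is where the times of
the dance are used. Each label gets a number, which is 0 at initial points, does not change along an
over-passage, and grows by 1 + 2s along an under-passage below a strand whose number is s. The
summand 2s anticipates the two extra under-passages made by each push. The recursion is well founded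
because the preceding label and the strand above are both danced earlier
(`IsDanceConfiguration.exists_calibration`). The numbers outside the move are invariant under a push
(`Calibration.push`), while the sum of the numbers at over-passages drops. If some over-passage
still has a positive number, connectedness of the knot provides one to which a move applies
(`Calibration.exists_positive`), so the process ends with all these numbers equal to 0
(`Calibration.exists_sorted`).

In the sorted diagram the number is positive behind each under-passage and stays positive up to the
next initial point, so no over-passage can occur before that point. Hence each over-bridge contains
an initial point, different over-bridges contain different ones, and there are at most as many
over-bridges as dancers (`Labelling.overBridges_le`, `Calibration.exists_orientation`). -/

@[simp] theorem isTangle_nil {m n : ℕ} : IsTangle m [] n ↔ m = n := by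
  constructor
  · intro h; cases h; rfl
  · rintro rfl; exact .nil _

theorem isTangle_cons {m n : ℕ} {s : Slice} {w : Word} :
    IsTangle m (s :: w) n ↔
      s.pos + s.piece.ins ≤ m ∧ IsTangle (m - s.piece.ins + s.piece.outs) w n := by
  constructor
  · intro h
    cases h with
    | cons p r g w n h =>
      refine ⟨by simp, ?_⟩
      have : p + g.ins + r - g.ins + g.outs = p + g.outs + r := by omega
      simpa [this] using h
  · rintro ⟨h1, h2⟩
    obtain ⟨p, g⟩ := s
    obtain ⟨r, rfl⟩ := Nat.exists_eq_add_of_le h1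
    refine .cons p r g w n ?_
    have : p + g.ins + r - g.ins + g.outs = p + g.outs + r := by omega
    simpa [this] using h2

theorem isTangle_cons' {m k n : ℕ} {s : Slice} {w : Word} (hs : s.pos + s.piece.ins ≤ m)
    (hk : k + s.piece.ins = m + s.piece.outs) :
    IsTangle m (s :: w) n ↔ IsTangle k w n := by
  rw [isTangle_cons]
  have : m - s.piece.ins + s.piece.outs = k := by omega
  simp [hs, this]

theorem IsTangle.append {m k n : ℕ} {u v : Word} (hu : IsTangle m u k) (hv : IsTangle k v n) :
    IsTangle m (u ++ v) n := by
  induction hu with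
  | nil => exact hv
  | cons p r g w n _ ih => exact .cons p r g _ _ (ih hv)

theorem isTangle_append {m n : ℕ} {u v : Word} :
    IsTangle m (u ++ v) n ↔ ∃ k, IsTangle m u k ∧ IsTangle k v n := by
  constructor
  · induction u generalizing m with
    | nil => intro h; exact ⟨m, .nil m, h⟩
    | cons s u ih =>
      intro h
      rw [List.cons_append, isTangle_cons] at h
      obtain ⟨k, hk, hk'⟩ := ih h.2
      exact ⟨k, isTangle_cons.2 ⟨h.1, hk⟩, hk'⟩
  · rintro ⟨k, h, h'⟩; exact h.append h'

theorem IsTangle.unique {m n n' : ℕ} {w : Word} (h : IsTangle m w n) (h' : IsTangle m w n') :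
    n = n' := by
  induction w generalizing m with
  | nil => simp at h h'; omega
  | cons s w ih => rw [isTangle_cons] at h h'; exact ih h.2 h'.2

/-- The word moved to the right by `p` strands. -/
abbrev Word.shift (p : ℕ) (w : Word) : Word := List.map (Slice.shift p) w

@[simp] theorem Slice.shift_mk (p q : ℕ) (g : Piece) : Slice.shift p ⟨q, g⟩ = ⟨p + q, g⟩ := rfl

@[simp] theorem Word.shift_zero (w : Word) : Word.shift 0 w = w := by
  induction w with
  | nil => rfl
  | cons s w ih => simp_all [Slice.shift]

theorem IsTangle.shift {m n : ℕ} {w : Word} (h : IsTangle m w n) (p r : ℕ) :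
    IsTangle (p + m + r) (Word.shift p w) (p + n + r) := by
  induction h with
  | nil => exact .nil _
  | cons q t g w n _ ih =>
    have := IsTangle.cons (p + q) (t + r) g (Word.shift p w) _ (by convert ih using 1; omega)
    rw [show p + (q + g.ins + t) + r = p + q + g.ins + (t + r) by omega]
    exact this

theorem IsTangle.shift' {m n : ℕ} {w : Word} (h : IsTangle m w n) {p a b : ℕ} (ha : p + m ≤ a)
    (hb : a + n = b + m) : IsTangle a (Word.shift p w) b := by
  have := h.shift p (a - (p + m))
  convert this using 1 <;> omega

/-- The number of strands at the top of a word, if it is a tangle. -/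
def top : ℕ → Word → Option ℕ
  | m, [] => some m
  | m, s :: w => if s.pos + s.piece.ins ≤ m then top (m - s.piece.ins + s.piece.outs) w else none

theorem isTangle_iff_top {m n : ℕ} {w : Word} : IsTangle m w n ↔ top m w = some n := by
  induction w generalizing m with
  | nil => simp [top]
  | cons s w ih => rw [isTangle_cons, top, ih]; split_ifs with h <;> simp [h]

/-- The width is computed slice by slice from the bottom. This lets `decide` settle the side
conditions of moves between concrete words. -/
instance (m n : ℕ) (w : Word) : Decidable (IsTangle m w n) := decidable_of_iff' _ isTangle_iff_top

/-! ### Equivalence of tangles -/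

/-- One local move, applied somewhere in a tangle diagram with `m` end points at the bottom and `n`
at the top. -/
def TStep (m n : ℕ) (w w' : Word) : Prop :=
  IsTangle m w n ∧ IsTangle m w' n ∧
    ∃ (p : ℕ) (l r u v : Word), LocalMove l r ∧
      w = u ++ l.map (Slice.shift p) ++ v ∧ w' = u ++ r.map (Slice.shift p) ++ v

/-- Welded equivalence of tangle diagrams. -/
def TE (m n : ℕ) : Word → Word → Prop := Relation.EqvGen (TStep m n)

/-- Welded equivalence of tangle diagrams without end points at the top. -/
abbrev E (n : ℕ) : Word → Word → Prop := TE n 0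

theorem TE.refl {m n : ℕ} (w : Word) : TE m n w w := Relation.EqvGen.refl w
theorem TE.symm {m n : ℕ} {w w' : Word} (h : TE m n w w') : TE m n w' w := Relation.EqvGen.symm _ _ h
theorem TE.trans {m n : ℕ} {w w' w'' : Word} (h : TE m n w w') (h' : TE m n w' w'') :
    TE m n w w'' := Relation.EqvGen.trans _ _ _ h h'

/-- A move inside a tangle remains a move when strands are added at both sides and words below and
above; only its position grows by `p`. All later equivalences are proved for small tangles and
transported by this. -/
theorem TE.context {m n k k' p r : ℕ} {w w' u v : Word} (h : TE m n w w')
    (hu : IsTangle k u (p + m + r)) (hv : IsTangle (p + n + r) v k') :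
    TE k k' (u ++ Word.shift p w ++ v) (u ++ Word.shift p w' ++ v) := by
  induction h with
  | rel x y h =>
    obtain ⟨h1, h2, q, l, s, u', v', hm, rfl, rfl⟩ := h
    refine .rel _ _ ⟨(hu.append (h1.shift p r)).append hv, (hu.append (h2.shift p r)).append hv,
      p + q, l, s, u ++ Word.shift p u', Word.shift p v' ++ v, hm, ?_, ?_⟩ <;>
    simp [Word.shift, Slice.shift, Function.comp_def, Nat.add_assoc]
  | refl => exact .refl _
  | symm _ _ _ ih => exact ih.symm
  | trans _ _ _ _ _ ih ih' => exact ih.trans ih'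

theorem TE.move {m n : ℕ} (u : Word) {l r : Word} (p : ℕ) (v : Word) (h : LocalMove l r)
    (h1 : IsTangle m (u ++ Word.shift p l ++ v) n) (h2 : IsTangle m (u ++ Word.shift p r ++ v) n) :
    TE m n (u ++ Word.shift p l ++ v) (u ++ Word.shift p r ++ v) :=
  .rel _ _ ⟨h1, h2, p, l, r, u, v, h, rfl, rfl⟩

/-- An equivalence of tangles, applied at the bottom of a diagram. -/
theorem TE.front {a b n m p : ℕ} {L R v : Word} (h : TE a b L R) (hp : p + a ≤ n)
    (hm : m + a = n + b) (hv : IsTangle m v 0) :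
    E n (Word.shift p L ++ v) (Word.shift p R ++ v) := by
  have := TE.context (u := []) (p := p) (r := n - (p + a)) (k := n) h
    (by simp; omega) (k' := 0) (v := v) (by convert hv using 1; omega)
  simpa using this

theorem TE.append_left {n m k : ℕ} {u v v' : Word} (hu : IsTangle n u m) (h : TE m k v v') :
    TE n k (u ++ v) (u ++ v') := by
  have := TE.context (p := 0) (r := 0) (u := u) (v := []) h (by simpa using hu) (k' := k)
    (by simp)
  simpa using this

theorem E.cons {n m : ℕ} {s : Slice} {v v' : Word} (hs : s.pos + s.piece.ins ≤ n)
    (hm : m + s.piece.ins = n + s.piece.outs) (h : E m v v') : E n (s :: v) (s :: v') :=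
  TE.append_left (u := [s]) ((isTangle_cons' hs hm).2 (.nil m)) h

/-- Two slices at different places exchange their heights. -/
theorem E.exchange {n m p q : ℕ} {g h : Piece} {v : Word} (hpq : p ≤ q)
    (hn : q + g.ins + h.ins ≤ n) (hm : m + g.ins + h.ins = n + g.outs + h.outs)
    (hv : IsTangle m v 0) :
    E n (⟨p, g⟩ :: ⟨q + g.outs, h⟩ :: v) (⟨q + g.ins, h⟩ :: ⟨p, g⟩ :: v) := by
  obtain ⟨r, rfl⟩ := Nat.exists_eq_add_of_le hpq
  have hT : TE (g.ins + r + h.ins) (g.outs + r + h.outs) [⟨0, g⟩, ⟨g.outs + r, h⟩]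
      [⟨g.ins + r, h⟩, ⟨0, g⟩] := by
    have := TE.move (m := g.ins + r + h.ins) (n := g.outs + r + h.outs) [] 0 []
      (LocalMove.exchange g h r) ?_ ?_
    · simpa [Word.shift] using this
    · simp [isTangle_cons, Word.shift]; omega
    · simp [isTangle_cons, Word.shift]; omega
  have := hT.front (p := p) (n := n) (m := m) (v := v) (by omega) (by omega) hv
  simp only [Word.shift, List.map_cons, List.map_nil, Slice.shift_mk, List.cons_append,
    List.nil_append, Nat.add_zero] at this
  have e1 : p + (g.outs + r) = p + r + g.outs := by omega
  have e2 : p + (g.ins + r) = p + r + g.ins := by omega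
  rwa [e1, e2] at this

/-- Induction on `d`: the piece passes its slices one by one. As `d` stands to the right of the
piece, its offset depends on whether it lies above or below the piece. -/
theorem E.exchange_word {a' b' : ℕ} {d : Word} (hd : IsTangle a' d b') :
    ∀ {n m p q : ℕ} {g : Piece} {v : Word}, p ≤ q → q + g.ins + a' ≤ n →
    m + g.ins + a' = n + g.outs + b' → IsTangle m v 0 →
    E n (⟨p, g⟩ :: (Word.shift (q + g.outs) d ++ v)) (Word.shift (q + g.ins) d ++ ⟨p, g⟩ :: v) := by
  induction hd with
  | nil => intros; simp [TE.refl]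
  | cons p₀ r h d b' hd ih =>
    intro n m p q g v hpq hn hm hv
    have hT : IsTangle (n + g.outs - g.ins + h.outs - h.ins) (Word.shift (q + g.outs) d ++ v) 0 :=
      (hd.shift' (by omega) (b := m) (by omega)).append hv
    have h1 := E.exchange (n := n) (m := n + g.outs - g.ins + h.outs - h.ins) (g := g) (h := h)
      (p := p) (q := q + p₀) (by omega) (by omega) (by omega) hT
    have h2 := ih (n := n + h.outs - h.ins) (p := p) (q := q) (g := g) (v := v) (m := m) hpq
      (by omega) (by omega) hv
    have h3 := E.cons (n := n) (s := ⟨q + p₀ + g.ins, h⟩) (by simp; omega) (by simp; omega) h2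
    simp only [Word.shift, List.map_cons, List.cons_append, Slice.shift_mk] at *
    have e1 : q + p₀ + g.outs = q + g.outs + p₀ := by omega
    have e2 : q + p₀ + g.ins = q + g.ins + p₀ := by omega
    rw [e1, e2] at h1
    rw [e2] at h3
    exact h1.trans h3

/-- Two tangles side by side exchange their heights. -/
theorem E.interchange {a b a' b' : ℕ} {c d : Word} (hc : IsTangle a c b) (hd : IsTangle a' d b') :
    ∀ {n m p q : ℕ} {v : Word}, p ≤ q → q + a + a' ≤ n → m + a + a' = n + b + b' →
    IsTangle m v 0 →
    E n (Word.shift p c ++ (Word.shift (q + b) d ++ v))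
      (Word.shift (q + a) d ++ (Word.shift p c ++ v)) := by
  induction hc with
  | nil => intros; simp [TE.refl]
  | cons p₀ r g c b hc ih =>
    intro n m p q v hpq hn hm hv
    have h1 := ih (n := n + g.outs - g.ins) (m := m) (p := p) (q := q) (v := v) hpq (by omega)
      (by omega) hv
    have h2 := E.cons (n := n) (s := ⟨p + p₀, g⟩) (by simp; omega) (by simp; omega) h1
    have h3 := E.exchange_word hd (n := n) (p := p + p₀) (q := q + p₀ + r) (g := g)
      (v := Word.shift p c ++ v) (m := n + b' + g.outs - g.ins - a') (by omega) (by omega)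
      (by omega) ((hc.shift' (by omega) (b := m) (by omega)).append hv)
    have e1 : q + p₀ + r + g.outs = q + (p₀ + g.outs + r) := by omega
    have e2 : q + p₀ + r + g.ins = q + (p₀ + g.ins + r) := by omega
    rw [e1, e2] at h3
    simp only [Word.shift, List.map_cons, List.cons_append, Slice.shift_mk] at *
    exact h2.trans h3

/-! ### Detours: a strand moved virtually across a tangle -/

/-- The word with the single virtual crossing `p`. -/
abbrev vx (p : ℕ) : Slice := ⟨p, .cross .virt⟩

/-- The strand at position `p + k` crosses `k` strands virtually to position `p`. -/
def pull (p : ℕ) : ℕ → Word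
  | 0 => []
  | k + 1 => vx (p + k) :: pull p k

@[simp] theorem pull_zero (p : ℕ) : pull p 0 = [] := rfl
theorem pull_succ (p k : ℕ) : pull p (k + 1) = vx (p + k) :: pull p k := rfl

theorem pull_add (p k j : ℕ) : pull p (k + j) = pull (p + k) j ++ pull p k := by
  induction j with
  | zero => simp
  | succ j ih => rw [← Nat.add_assoc, pull_succ, ih, pull_succ]; simp [Nat.add_assoc]

theorem shift_pull (p q k : ℕ) : Word.shift p (pull q k) = pull (p + q) k := by
  induction k with
  | zero => rfl
  | succ k ih => simp only [pull_succ, List.map_cons, Slice.shift_mk, Word.shift] at *; simp [ih, Nat.add_assoc]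

theorem isTangle_pull {p k n : ℕ} (h : p + k + 1 ≤ n ∨ k = 0) : IsTangle n (pull p k) n := by
  induction k with
  | zero => simp
  | succ k ih =>
    rw [pull_succ, isTangle_cons' (k := n)]
    · exact ih (by omega)
    · simp [Piece.ins]; omega
    · simp [Piece.ins, Piece.outs]

theorem TE.move' {m n : ℕ} (u : Word) {l r : Word} (p : ℕ) (v : Word) (h : LocalMove l r)
    {w w' : Word} (hw : w = u ++ Word.shift p l ++ v) (hw' : w' = u ++ Word.shift p r ++ v)
    (h1 : IsTangle m w n) (h2 : IsTangle m w' n) : TE m n w w' := by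
  subst hw hw'; exact TE.move u p v h h1 h2

/-- The generating case of the detour move. A crossing passes the strand by a triangle move in which
that strand has only virtual crossings; a minimum or maximum passes it by a slide and a virtual
second Reidemeister move. -/
theorem TE.natural (g : Piece) : TE (g.ins + 1) (g.outs + 1) (⟨0, g⟩ :: pull 0 g.outs)
    (pull 0 g.ins ++ [⟨1, g⟩]) := by
  cases g with
  | cup =>
    refine TE.trans (w' := [⟨1, .cup⟩, vx 0, vx 0]) ?_ ?_
    · exact TE.move' [] 0 [vx 0] (.slideCup .virt) rfl rfl (by decide) (by decide)
    · exact TE.move' [⟨1, .cup⟩] 0 [] (.bigon .virt) rfl rfl (by decide) (by decide)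
  | cap =>
    refine TE.symm (TE.trans (w' := [vx 1, vx 1, ⟨0, .cap⟩]) ?_ ?_)
    · exact (TE.move' [vx 1] 0 [] (.slideCap .virt) rfl rfl (by decide) (by decide)).symm
    · exact TE.move' [] 1 [⟨0, .cap⟩] (.bigon .virt) rfl rfl (by decide) (by decide)
  | cross t =>
    refine TE.move' [] 0 [] (.triangle t .virt .virt (.virtC t)) rfl rfl ?_ ?_ <;>
    cases t <;> decide

/-- A strand moves virtually across a tangle, from its right side to its left side. -/
theorem E.natural {a b : ℕ} {c : Word} (hc : IsTangle a c b) :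
    ∀ {n m p : ℕ} {v : Word}, p + a + 1 ≤ n → m + a = n + b → IsTangle m v 0 →
    E n (Word.shift p c ++ (pull p b ++ v)) (pull p a ++ (Word.shift (p + 1) c ++ v)) := by
  induction hc with
  | nil => intros; simp [TE.refl]
  | cons p₀ r g c b hc ih =>
    intro n m p v hn hm hv
    set n' := n + g.outs - g.ins with hn'
    have h1 := E.cons (n := n) (s := ⟨p + p₀, g⟩) (m := n') (by simp; omega) (by simp; omega)
      (ih (n := n') (m := m) (p := p) (v := v) (by omega) (by omega) hv)
    have hv' : IsTangle n' (Word.shift (p + 1) c ++ v) 0 :=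
      (hc.shift' (by omega) (b := m) (by omega)).append hv
    set v' := Word.shift (p + 1) c ++ v
    -- The strand crosses the `r` strands to the right of the piece, then the piece itself, then the
    -- `p₀` strands to its left. The outer blocks exchange heights with the piece; only the middle
    -- block needs `TE.natural`.
    have e1 : pull p (p₀ + g.outs + r) ++ v' =
        Word.shift (p + p₀ + g.outs) (pull 0 r) ++ (pull (p + p₀) g.outs ++ (pull p p₀ ++ v')) := by
      rw [pull_add, pull_add, shift_pull]; simp [Nat.add_assoc]
    have e2 : pull p (p₀ + g.ins + r) ++ (⟨p + 1 + p₀, g⟩ :: v') =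
        Word.shift (p + p₀ + g.ins) (pull 0 r) ++ (pull (p + p₀) g.ins ++
          (pull p p₀ ++ ⟨p + 1 + p₀, g⟩ :: v')) := by
      rw [pull_add, pull_add, shift_pull]; simp [Nat.add_assoc]
    have hp0 : IsTangle n' (pull p p₀ ++ v') 0 := (isTangle_pull (by omega)).append hv'
    have hpo : IsTangle n' (pull (p + p₀) g.outs ++ (pull p p₀ ++ v')) 0 :=
      (isTangle_pull (by omega)).append hp0
    have h2 : E n (⟨p + p₀, g⟩ :: (pull p (p₀ + g.outs + r) ++ v'))
        (Word.shift (p + p₀ + g.ins) (pull 0 r) ++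
          ⟨p + p₀, g⟩ :: (pull (p + p₀) g.outs ++ (pull p p₀ ++ v'))) := by
      rw [e1]
      exact E.exchange_word (a' := r + 1) (b' := r + 1) (isTangle_pull (by omega)) (by omega)
        (by omega) (by omega) hpo
    have h3 : E n (⟨p + p₀, g⟩ :: (pull (p + p₀) g.outs ++ (pull p p₀ ++ v')))
        (pull (p + p₀) g.ins ++ (⟨p + p₀ + 1, g⟩ :: (pull p p₀ ++ v'))) := by
      have := (TE.natural g).front (p := p + p₀) (n := n) (m := n') (by omega) (by omega) hp0
      simp only [Word.shift, List.map_cons, List.map_append, List.map_nil, Slice.shift_mk] at this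
      simp only [← Word.shift.eq_1, shift_pull] at this
      simpa using this
    have h4 : E n (⟨p + p₀ + 1, g⟩ :: (pull p p₀ ++ v'))
        (pull p p₀ ++ ⟨p + 1 + p₀, g⟩ :: v') := by
      rcases Nat.eq_zero_or_pos p₀ with rfl | h0
      · simp [TE.refl]
      have hs : IsTangle g.ins [⟨0, g⟩] g.outs := by simp [isTangle_cons]
      have := E.interchange (c := pull 0 p₀) (d := [⟨0, g⟩]) (a := p₀ + 1) (b := p₀ + 1)
        (isTangle_pull (by omega)) hs (n := n) (m := n') (p := p) (q := p) (v := v') le_rfl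
        (by omega) (by omega) hv'
      simp only [shift_pull, Word.shift, List.map_cons, List.map_nil, Slice.shift_mk,
        List.cons_append, List.nil_append, Nat.add_zero] at this
      have e3 : p + (p₀ + 1) = p + p₀ + 1 := by omega
      have e4 : p + p₀ + 1 = p + 1 + p₀ := by omega
      rw [e3] at this
      rw [← e4]
      exact this.symm
    have h34 := TE.append_left (n := n) (m := n) (u := Word.shift (p + p₀ + g.ins) (pull 0 r))
      (by rw [shift_pull]; exact isTangle_pull (by omega))
      (h3.trans (TE.append_left (n := n) (m := n) (isTangle_pull (by omega)) h4))
    have := (h1.trans h2).trans h34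
    rw [← e2] at this
    simpa [Word.shift] using this

section

/-! ### Virtual tangles -/

theorem E.bigon_virt {n p : ℕ} {v : Word} (hp : p + 2 ≤ n) (hv : IsTangle n v 0) :
    E n (vx p :: vx p :: v) v := by
  have : TE 2 2 [vx 0, vx 0] [] := TE.move' [] 0 [] (.bigon .virt) rfl rfl (by decide) (by decide)
  simpa [Word.shift] using this.front hp rfl hv

/-- The crossing lies to the right of all strands involved in the pull, so this is planar isotopy.
-/
theorem E.pull_far {n o k q : ℕ} {v : Word} (hq : k < q) (hn : o + q + 2 ≤ n)
    (hv : IsTangle n v 0) :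
    E n (vx (o + q) :: (pull o k ++ v)) (pull o k ++ vx (o + q) :: v) := by
  have := E.interchange (c := pull 0 k) (a := k + 1) (b := k + 1) (isTangle_pull (by omega))
    (a' := 2) (b' := 2) (d := [vx 0]) (by decide) (n := n) (m := n) (p := o) (q := o + q - k - 1)
    (v := v) (by omega) (by omega) (by omega) hv
  rw [shift_pull] at this
  have e : o + q - k - 1 + (k + 1) = o + q := by omega
  simp only [e, Word.shift, List.map_cons, List.map_nil, Slice.shift_mk, Nat.add_zero,
    List.cons_append, List.nil_append] at this
  exact this.symm

/-- Both strands of the crossing are crossed by the pulled strand, so the crossing passes through it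
and comes out one place further to the right. -/
theorem E.pull_near {n o k q : ℕ} {v : Word} (hq : q + 2 ≤ k) (hn : o + k + 1 ≤ n)
    (hv : IsTangle n v 0) :
    E n (vx (o + q) :: (pull o k ++ v)) (pull o k ++ vx (o + 1 + q) :: v) := by
  have := E.natural (c := [vx q]) (a := k) (b := k)
    (by simp [isTangle_cons, Piece.ins, Piece.outs]; omega) (n := n) (m := n) (p := o) (v := v)
    hn rfl hv
  simpa [Word.shift] using this

/-! ### Virtual joins of labelled end points -/

section

variable {α : Type*}

/-- The labels in `l` are those in `T`, and each of them occurs twice. -/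
def Matches (l T : List α) : Prop := T.Nodup ∧ l.Perm (T ++ T)

theorem Matches.perm {l l' T T' : List α} (h : Matches l T) (hl : l.Perm l') (hT : T.Perm T') :
    Matches l' T' :=
  ⟨hT.nodup_iff.1 h.1, (hl.symm.trans h.2).trans (hT.append hT)⟩

variable [DecidableEq α]

/-- A virtual crossing below a strand pulled to the left from the first place where the label `c`
occurs: it is absorbed, or it reappears above. -/
theorem pull_swap (o : ℕ) {a b c : α} (l₁ l₂ : List α) (hab : a ≠ b)
    (hc : c ∈ l₁ ++ a :: b :: l₂) :
    ((l₁ ++ a :: b :: l₂).erase c = (l₁ ++ b :: a :: l₂).erase c ∧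
      ∀ n v, o + (l₁.length + l₂.length + 2) ≤ n → IsTangle n v 0 →
        E n (vx (o + l₁.length) :: (pull o ((l₁ ++ b :: a :: l₂).idxOf c) ++ v))
          (pull o ((l₁ ++ a :: b :: l₂).idxOf c) ++ v)) ∨
    ∃ l₁' l₂', l₁'.length + l₂'.length + 1 = l₁.length + l₂.length ∧
      (l₁ ++ a :: b :: l₂).erase c = l₁' ++ a :: b :: l₂' ∧
      (l₁ ++ b :: a :: l₂).erase c = l₁' ++ b :: a :: l₂' ∧
      ∀ n v, o + (l₁.length + l₂.length + 2) ≤ n → IsTangle n v 0 →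
        E n (vx (o + l₁.length) :: (pull o ((l₁ ++ b :: a :: l₂).idxOf c) ++ v))
          (pull o ((l₁ ++ a :: b :: l₂).idxOf c) ++ vx (o + 1 + l₁'.length) :: v) := by
  -- If `c` occurs before the pair, the crossing is far from the pull. If it is first found at `a`,
  -- the pull starts with a second copy of the crossing, and the two cancel. If it is first found at
  -- `b`, the crossing is the missing first step of the pull. If it occurs only behind the pair, the
  -- crossing is near.
  by_cases h1 : c ∈ l₁
  · right
    have hlen := List.length_erase_of_mem h1
    have hpos := List.length_pos_of_mem h1
    refine ⟨l₁.erase c, l₂, by omega, ?_, ?_, ?_⟩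
    · rw [List.erase_append_left _ h1]
    · rw [List.erase_append_left _ h1]
    · intro n v hn hv
      have hk := List.idxOf_lt_length_of_mem h1
      rw [List.idxOf_append_of_mem h1, List.idxOf_append_of_mem h1]
      have e : o + 1 + (l₁.erase c).length = o + l₁.length := by omega
      rw [e]
      exact E.pull_far hk (by omega) hv
  by_cases h2 : c = a
  · subst h2
    left
    refine ⟨?_, ?_⟩
    · rw [List.erase_append_right _ h1, List.erase_append_right _ h1]
      simp [hab.symm]
    · intro n v hn hv
      rw [List.idxOf_append_of_notMem h1, List.idxOf_append_of_notMem h1]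
      simp only [List.idxOf_cons_self, List.idxOf_cons_ne _ hab.symm, Nat.add_zero]
      rw [pull_succ]
      exact E.bigon_virt (by omega) ((isTangle_pull (by omega)).append hv)
  by_cases h3 : c = b
  · subst h3
    left
    refine ⟨?_, ?_⟩
    · rw [List.erase_append_right _ h1, List.erase_append_right _ h1]
      simp [hab]
    · intro n v hn hv
      rw [List.idxOf_append_of_notMem h1, List.idxOf_append_of_notMem h1]
      simp only [List.idxOf_cons_self, List.idxOf_cons_ne _ hab, Nat.add_zero]
      rw [pull_succ]
      exact TE.refl _
  · have h4 : c ∈ l₂ := by simpa [h1, h2, h3] using hc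
    right
    have hlen := List.length_erase_of_mem h4
    have hpos := List.length_pos_of_mem h4
    refine ⟨l₁, l₂.erase c, by omega, ?_, ?_, ?_⟩
    · rw [List.erase_append_right _ h1]
      simp [Ne.symm h2, Ne.symm h3]
    · rw [List.erase_append_right _ h1]
      simp [Ne.symm h2, Ne.symm h3]
    · intro n v hn hv
      have hk := List.idxOf_lt_length_of_mem h4
      rw [List.idxOf_append_of_notMem h1, List.idxOf_append_of_notMem h1]
      simp only [List.idxOf_cons_ne _ (Ne.symm h2), List.idxOf_cons_ne _ (Ne.symm h3)]
      exact E.pull_near (by omega) (by omega) hv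

/-- The virtual tangle that joins any two end points with the same label, taken in the order given
by `T`. -/
def joinIn : List α → List α → Word
  | _, [] => []
  | l, c :: T => pull 0 (l.idxOf c) ++ (pull 1 ((l.erase c).idxOf c) ++
      ⟨0, .cap⟩ :: joinIn ((l.erase c).erase c) T)

theorem Matches.erase {l T : List α} {c : α} (h : Matches l (c :: T)) :
    c ∈ l ∧ c ∈ l.erase c ∧ Matches ((l.erase c).erase c) T ∧
      ((l.erase c).erase c).length + 2 = l.length := by
  obtain ⟨h1, h2⟩ := h
  have h3 : (l.erase c).Perm (T ++ c :: T) := by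
    have := h2.erase c; simpa using this
  have h4 : ((l.erase c).erase c).Perm (T ++ T) := by
    have := (h3.trans List.perm_middle).erase c; simpa using this
  refine ⟨h2.mem_iff.2 (by simp), h3.mem_iff.2 (by simp), ⟨(List.nodup_cons.1 h1).2, h4⟩, ?_⟩
  have := h4.length_eq
  have := h2.length_eq
  simp at *
  omega

theorem isTangle_joinIn {l T : List α} (h : Matches l T) : IsTangle l.length (joinIn l T) 0 := by
  induction T generalizing l with
  | nil =>
    have := h.2.length_eq
    simp at this
    simp [joinIn, this]
  | cons c T ih =>
    obtain ⟨h1, h2, h3, h4⟩ := h.erase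
    have hk1 := List.idxOf_lt_length_of_mem h1
    have hk2 := List.idxOf_lt_length_of_mem h2
    rw [List.length_erase_of_mem h1] at hk2
    refine (isTangle_pull (by omega)).append ((isTangle_pull (by omega)).append ?_)
    rw [isTangle_cons' (k := ((l.erase c).erase c).length)]
    · exact ih h3
    · simp [Piece.ins]; omega
    · simp [Piece.ins, Piece.outs]; omega

/-- Induction on `T`: the crossing rises through the two pulls of the first label (`pull_swap` with
offsets 0 and 1). It is absorbed there, or it passes the maximum by planar isotopy and meets the
remaining joins. -/
theorem joinIn_swap {a b : α} (hab : a ≠ b) {T : List α} :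
    ∀ {l₁ l₂ : List α}, Matches (l₁ ++ a :: b :: l₂) T →
    E (l₁.length + l₂.length + 2) (vx l₁.length :: joinIn (l₁ ++ b :: a :: l₂) T)
      (joinIn (l₁ ++ a :: b :: l₂) T) := by
  induction T with
  | nil => intro l₁ l₂ h; have := h.2.length_eq; simp at this
  | cons c T ih =>
    intro l₁ l₂ h
    have h' : Matches (l₁ ++ b :: a :: l₂) (c :: T) :=
      h.perm (List.Perm.append_left _ (List.Perm.swap _ _ _)) (.refl _)
    obtain ⟨h1, h2, h3, h4⟩ := h.erase
    obtain ⟨h1', h2', h3', h4'⟩ := h'.erase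
    set n := l₁.length + l₂.length + 2 with hn
    have hk2 := List.idxOf_lt_length_of_mem h2
    have hk2' := List.idxOf_lt_length_of_mem h2'
    have hk1 := List.idxOf_lt_length_of_mem h1
    rw [List.length_erase_of_mem h1] at hk2
    rw [List.length_erase_of_mem h1'] at hk2'
    have hl : (l₁ ++ a :: b :: l₂).length = n := by simp; omega
    have hl' : (l₁ ++ b :: a :: l₂).length = n := by simp; omega
    rw [hl] at hk2 h4 hk1
    rw [hl'] at hk2' h4'
    have hT' : IsTangle n (⟨0, .cap⟩ :: joinIn (((l₁ ++ b :: a :: l₂).erase c).erase c) T) 0 := by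
      rw [isTangle_cons' (k := (((l₁ ++ b :: a :: l₂).erase c).erase c).length)]
      · exact isTangle_joinIn h3'
      · simp [Piece.ins]; omega
      · simp [Piece.ins, Piece.outs]; omega
    have hT := (isTangle_pull (n := n) (p := 1)
      (k := ((l₁ ++ b :: a :: l₂).erase c).idxOf c) (by omega)).append hT'
    rw [joinIn, joinIn]
    rcases pull_swap 0 l₁ l₂ hab h1 with ⟨e, hE⟩ | ⟨m₁, m₂, hm, e, e', hE⟩
    · have := hE n _ (by omega) hT
      rw [← e] at this ⊢
      simpa using this
    · refine TE.trans (by simpa using hE n _ (by omega) hT)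
        (TE.append_left (m := n) (isTangle_pull (by omega)) ?_)
      rw [e] at h2 h3 h4 hk2 ⊢
      rw [e'] at hT' h3' h4' hk2' ⊢
      rcases pull_swap 1 m₁ m₂ hab h2 with ⟨e2, hE2⟩ | ⟨k₁, k₂, hk, e2, e2', hE2⟩
      · have := hE2 n _ (by omega) hT'
        rw [← e2] at this ⊢
        simpa using this
      · refine TE.trans (by simpa using hE2 n _ (by omega) hT')
          (TE.append_left (m := n) (isTangle_pull (by omega)) ?_)
        rw [e2] at h3 h4 ⊢
        rw [e2'] at hT' h3' h4' ⊢
        have hm3 := isTangle_joinIn h3'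
        have hx := E.exchange (n := n) (m := n - 2) (p := 0) (q := k₁.length) (g := .cap)
          (h := .cross .virt) (v := joinIn (k₁ ++ b :: a :: k₂) T) (by omega)
          (by simp [Piece.ins]; omega) (by simp [Piece.ins, Piece.outs]; omega)
          (by convert hm3 using 1; simp; omega)
        simp only [Piece.ins, Piece.outs, Nat.add_zero] at hx
        rw [show 1 + 1 + k₁.length = k₁.length + 2 by omega]
        refine hx.symm.trans (E.cons (m := k₁.length + k₂.length + 2) (by simp [Piece.ins]; omega)
          (by simp [Piece.ins, Piece.outs]; omega) (ih h3))

/-- The first strand with label `c` is pulled to the left. -/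
theorem joinIn_pull {c : α} {T : List α} {l : List α} (hc : c ∈ l) : ∀ {u : List α},
    Matches (u ++ l) T →
    E (u.length + l.length) (pull u.length (l.idxOf c) ++ joinIn (u ++ c :: l.erase c) T)
      (joinIn (u ++ l) T) := by
  induction l with
  | nil => simp at hc
  | cons x l ih =>
    intro u h
    by_cases hx : x = c
    · subst hx; simp [TE.refl]
    · have hc' : c ∈ l := by simpa [Ne.symm hx] using hc
      have hk := List.idxOf_lt_length_of_mem hc'
      have hle := List.length_erase_of_mem hc'
      rw [List.idxOf_cons_ne _ hx, List.erase_cons_tail (by simpa using hx),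
        Nat.succ_eq_one_add, pull_add]
      have hp : (u ++ x :: l).Perm (u ++ x :: c :: l.erase c) :=
        List.Perm.append_left _ (List.Perm.cons _ (List.perm_cons_erase hc'))
      have h1 := joinIn_swap hx (h.perm hp (.refl _))
      have e : u.length + (l.erase c).length + 2 = u.length + (x :: l).length := by simp; omega
      rw [e] at h1
      have h2 := ih hc' (u := u ++ [x]) (by simpa using h)
      simp only [List.length_append, List.length_cons, List.length_nil, List.append_assoc,
        List.cons_append, List.nil_append] at h2
      have e' : u.length + (0 + 1) + l.length = u.length + (x :: l).length := by simp; omega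
      rw [e', Nat.zero_add] at h2
      refine TE.trans ?_ h2
      simp only [List.append_assoc]
      refine TE.append_left (isTangle_pull (by simp; omega)) ?_
      simpa [pull] using h1

/-- Four virtual crossings that interchange two neighbouring maxima are undone by sliding them over
a maximum. This is the geometric content of the independence of the order in `joinIn_perm`. -/
theorem TE.caps_swap : TE 4 0 (pull 0 2 ++ pull 1 2 ++ [⟨0, .cap⟩, ⟨0, .cap⟩])
    [⟨0, .cap⟩, ⟨0, .cap⟩] := by
  have h1 : TE 4 0 [vx 1, vx 0, vx 2, vx 1, ⟨0, .cap⟩, ⟨0, .cap⟩]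
      [vx 1, vx 2, vx 0, vx 1, ⟨0, .cap⟩, ⟨0, .cap⟩] :=
    TE.move' [vx 1] 0 [vx 1, ⟨0, .cap⟩, ⟨0, .cap⟩] (.exchange (.cross .virt) (.cross .virt) 0)
      rfl rfl (by decide) (by decide)
  have h2 : TE 4 0 [vx 1, vx 2, vx 0, vx 1, ⟨0, .cap⟩, ⟨0, .cap⟩]
      [vx 1, vx 2, vx 0, vx 0, ⟨1, .cap⟩, ⟨0, .cap⟩] :=
    TE.move' [vx 1, vx 2, vx 0] 0 [⟨0, .cap⟩] (.slideCap .virt) rfl rfl (by decide) (by decide)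
  have h3 : TE 4 0 [vx 1, vx 2, vx 0, vx 0, ⟨1, .cap⟩, ⟨0, .cap⟩]
      [vx 1, vx 2, ⟨1, .cap⟩, ⟨0, .cap⟩] :=
    TE.move' [vx 1, vx 2] 0 [⟨1, .cap⟩, ⟨0, .cap⟩] (.bigon .virt) rfl rfl (by decide) (by decide)
  have h4 : TE 4 0 [vx 1, vx 2, ⟨1, .cap⟩, ⟨0, .cap⟩] [vx 1, vx 1, ⟨2, .cap⟩, ⟨0, .cap⟩] :=
    TE.move' [vx 1] 1 [⟨0, .cap⟩] (.slideCap .virt) rfl rfl (by decide) (by decide)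
  have h5 : TE 4 0 [vx 1, vx 1, ⟨2, .cap⟩, ⟨0, .cap⟩] [⟨2, .cap⟩, ⟨0, .cap⟩] :=
    TE.move' [] 1 [⟨2, .cap⟩, ⟨0, .cap⟩] (.bigon .virt) rfl rfl (by decide) (by decide)
  have h6 : TE 4 0 [⟨0, .cap⟩, ⟨0, .cap⟩] [⟨2, .cap⟩, ⟨0, .cap⟩] :=
    TE.move' [] 0 [] (.exchange .cap .cap 0) rfl rfl (by decide) (by decide)
  exact h1.trans (h2.trans (h3.trans (h4.trans (h5.trans h6.symm))))

/-- For a transposition of two labels, their four ends are pulled to the far left in the same way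
for both orders (`gather`); there the two tangles differ by an interchange of maxima. -/
theorem joinIn_perm {T T' : List α} (hT : T.Perm T') : ∀ {l : List α}, Matches l T →
    E l.length (joinIn l T) (joinIn l T') := by
  induction hT with
  | nil => intros; exact TE.refl _
  | cons c hT ih =>
    intro l h
    obtain ⟨h1, h2, h3, h4⟩ := h.erase
    have hk2 := List.idxOf_lt_length_of_mem h2
    have hk1 := List.idxOf_lt_length_of_mem h1
    rw [List.length_erase_of_mem h1] at hk2
    rw [joinIn, joinIn]
    refine TE.append_left (m := l.length) (isTangle_pull (by omega))
      (TE.append_left (m := l.length) (isTangle_pull (by omega)) (E.cons ?_ ?_ (ih h3)))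
    · simp [Piece.ins]; omega
    · simp [Piece.ins, Piece.outs]; omega
  | swap d c T =>
    intro l h
    obtain ⟨h1, h2, h3, h4⟩ := h.erase
    obtain ⟨h5, h6, h7, h8⟩ := h3.erase
    have hk1 := List.idxOf_lt_length_of_mem h1
    have hk2 := List.idxOf_lt_length_of_mem h2
    have hk3 := List.idxOf_lt_length_of_mem h5
    have hk4 := List.idxOf_lt_length_of_mem h6
    have hl1 := List.length_erase_of_mem h1
    have hl2 := List.length_erase_of_mem h2
    have hl3 := List.length_erase_of_mem h5
    have hl4 := List.length_erase_of_mem h6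
    have hp1 := List.perm_cons_erase h1
    have hp2 := hp1.trans ((List.perm_cons_erase h2).cons _)
    have hp3 := hp2.trans (((List.perm_cons_erase h5).cons _).cons _)
    have hp4 := hp3.trans ((((List.perm_cons_erase h6).cons _).cons _).cons _)
    set l1 := l.erase c with e1
    set l2 := l1.erase c
    set l3 := l2.erase d
    set l4 := l3.erase d
    have gather : ∀ T₁, Matches l T₁ → E l.length (joinIn l T₁)
        (pull 0 (l.idxOf c) ++ (pull 1 (l1.idxOf c) ++ (pull 2 (l2.idxOf d) ++
          (pull 3 (l3.idxOf d) ++ joinIn (c :: c :: d :: d :: l4) T₁)))) := by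
      intro T₁ hT₁
      have g1 := joinIn_pull h1 (u := []) (T := T₁) hT₁
      have g2 := joinIn_pull h2 (u := [c]) (T := T₁) (hT₁.perm hp1 (.refl _))
      have g3 := joinIn_pull h5 (u := [c, c]) (T := T₁) (hT₁.perm hp2 (.refl _))
      have g4 := joinIn_pull h6 (u := [c, c, d]) (T := T₁) (hT₁.perm hp3 (.refl _))
      simp only [List.length_cons, List.length_nil, List.nil_append, List.cons_append,
        Nat.zero_add, Nat.reduceAdd] at g1 g2 g3 g4
      rw [show 1 + l1.length = l.length by omega] at g2
      rw [show 2 + l2.length = l.length by omega] at g3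
      rw [show 3 + l3.length = l.length by omega] at g4
      refine g1.symm.trans (TE.append_left (isTangle_pull (by omega)) (g2.symm.trans
        (TE.append_left (isTangle_pull (by omega)) (g3.symm.trans
        (TE.append_left (isTangle_pull (by omega)) g4.symm)))))
    have hcd : c ≠ d := by rintro rfl; simpa using h.1
    refine (gather _ h).trans (TE.trans ?_ (gather _ (h.perm (.refl _) (.swap _ _ _))).symm)
    refine TE.append_left (m := l.length) (isTangle_pull (by omega)) (TE.append_left
      (m := l.length) (isTangle_pull (by omega)) (TE.append_left (m := l.length)
      (isTangle_pull (by omega)) (TE.append_left (m := l.length) (isTangle_pull (by omega)) ?_)))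
    have := TE.caps_swap.front (p := 0) (n := l.length) (m := l4.length) (by omega) (by omega)
      (isTangle_joinIn h7)
    simp only [Word.shift_zero, List.append_assoc, List.cons_append, List.nil_append] at this
    simpa [joinIn, hcd, hcd.symm, List.idxOf_cons_ne] using this.symm
  | trans hT hT' ih ih' =>
    intro l h
    exact (ih h).trans (ih' (h.perm (.refl _) hT))

/-- Each label of the list occurs twice. -/
def Paired (l : List α) : Prop := ∀ c ∈ l, l.count c = 2

theorem Paired.perm {l l' : List α} (h : Paired l) (hl : l.Perm l') : Paired l' := by
  intro c hc
  rw [← hl.count_eq]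
  exact h c (hl.mem_iff.2 hc)

theorem Paired.matches {l : List α} (h : Paired l) : Matches l l.dedup := by
  refine ⟨l.nodup_dedup, List.perm_iff_count.2 fun c => ?_⟩
  rw [List.count_append, List.count_dedup]
  split_ifs with hc
  · exact h c hc
  · exact List.count_eq_zero.2 hc

theorem Matches.paired {l T : List α} (h : Matches l T) : Paired l := by
  intro c hc
  rw [h.2.count_eq, List.count_append, List.count_eq_one_of_mem h.1]
  simpa using h.2.mem_iff.1 hc

/-- The virtual tangle that joins any two end points with the same label. -/
def join (l : List α) : Word := joinIn l l.dedup

theorem isTangle_join {l : List α} (h : Paired l) : IsTangle l.length (join l) 0 :=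
  isTangle_joinIn h.matches

theorem join_eq {l T : List α} (h : Matches l T) : E l.length (join l) (joinIn l T) := by
  refine joinIn_perm ?_ h.paired.matches
  refine (List.perm_ext_iff_of_nodup l.nodup_dedup h.1).2 fun c => ?_
  rw [List.mem_dedup, h.2.mem_iff]; simp

theorem join_swap_ne {a b : α} (hab : a ≠ b) {l₁ l₂ : List α} (h : Paired (l₁ ++ a :: b :: l₂)) :
    E (l₁.length + l₂.length + 2) (vx l₁.length :: join (l₁ ++ b :: a :: l₂))
      (join (l₁ ++ a :: b :: l₂)) := by
  have hp : (l₁ ++ a :: b :: l₂).Perm (l₁ ++ b :: a :: l₂) :=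
    List.Perm.append_left _ (List.Perm.swap _ _ _)
  have h1 := join_eq (h.matches.perm hp (.refl _))
  have h2 := joinIn_swap hab h.matches
  have e : (l₁ ++ b :: a :: l₂).length = l₁.length + l₂.length + 2 := by simp; omega
  rw [e] at h1
  exact (E.cons (by simp [Piece.ins]) (by simp [Piece.ins, Piece.outs]) h1).trans h2

/-- At the far left this is one step of `joinIn`, for a suitable order of the labels. Otherwise the
maximum is slid to the left across the strand `c`, at the expense of two virtual crossings that
`join_swap_ne` absorbs. -/
theorem join_cap {a : α} {l₁ l₂ : List α} (h : Paired (l₁ ++ a :: a :: l₂)) :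
    E (l₁.length + l₂.length + 2) (⟨l₁.length, .cap⟩ :: join (l₁ ++ l₂))
      (join (l₁ ++ a :: a :: l₂)) := by
  induction l₁ using List.reverseRecOn generalizing l₂ with
  | nil =>
    have h0 : a ∉ l₂ := by
      have := h a (by simp)
      simpa [List.count_eq_zero] using this
    have hl : Paired l₂ := by
      intro c hc
      have := h c (by simp [hc])
      have hca : a ≠ c := by rintro rfl; exact h0 hc
      simpa [List.count_cons, hca] using this
    have hM : Matches (a :: a :: l₂) (a :: l₂.dedup) := by
      refine ⟨List.nodup_cons.2 ⟨by simpa using h0, l₂.nodup_dedup⟩, ?_⟩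
      refine (List.Perm.cons a ((List.Perm.cons a hl.matches.2).trans List.perm_middle.symm))
    have := join_eq hM
    simp only [joinIn, List.idxOf_cons_self, List.erase_cons_head, pull_zero,
      List.nil_append] at this
    simpa [Nat.add_assoc, join] using this.symm
  | append_singleton u c ih =>
    have hca : c ≠ a := by
      rintro rfl
      have := h c (by simp)
      simp at this
      omega
    have hP : ∀ l, ((u ++ [c]) ++ a :: a :: l₂).Perm l → Paired l := fun l hl => h.perm hl
    have h2 : Paired (u ++ a :: c :: a :: l₂) := hP _ (by
      rw [List.append_assoc]; exact List.Perm.append_left _ (List.Perm.swap _ _ _))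
    have h3 : Paired (u ++ a :: a :: c :: l₂) := hP _ (by
      rw [List.append_assoc]
      exact List.Perm.append_left _ ((List.Perm.swap _ _ _).trans (.cons _ (.swap _ _ _))))
    have e1 := join_swap_ne hca (l₁ := u) (l₂ := a :: l₂) (by simpa using h)
    have e2 := join_swap_ne hca (l₁ := u ++ [a]) (l₂ := l₂) (by simpa using h2)
    have e3 := ih h3
    simp only [List.length_append, List.length_cons, List.length_nil, List.append_assoc,
      List.cons_append, List.nil_append] at e1 e2 e3 ⊢
    set n := u.length + l₂.length + 3
    rw [show u.length + (l₂.length + 1) + 2 = n by omega] at e1 e3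
    rw [show u.length + (0 + 1) + l₂.length + 2 = n by omega] at e2 ⊢
    simp only [Nat.zero_add] at e2 ⊢
    have hT : IsTangle (u.length + l₂.length + 1) (join (u ++ c :: l₂)) 0 := by
      have hp : Paired (u ++ c :: l₂) := by
        intro d hd
        have := h d (by simp at hd ⊢; tauto)
        have hda : a ≠ d := by
          rintro rfl
          have := h a (by simp)
          simp only [List.count_append, List.count_cons_self] at this
          have h5 : a ∈ u ∨ a ∈ l₂ := by simpa [hca.symm] using hd
          rcases h5 with h5 | h5 <;> have := List.count_pos_iff.2 h5 <;> omega
        simpa [List.count_append, List.count_cons, hda] using this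
      have := isTangle_join hp
      convert this using 1; simp; omega
    have hs : TE 3 1 [vx 0, vx 1, ⟨0, .cap⟩] [⟨1, .cap⟩] := by
      refine (TE.move' [vx 0] 0 [] (.slideCap .virt) rfl rfl (by decide) (by decide)).trans
        (w' := [vx 0, vx 0, ⟨1, .cap⟩]) ?_
      exact TE.move' [] 0 [⟨1, .cap⟩] (.bigon .virt) rfl rfl (by decide) (by decide)
    have hs' := hs.front (p := u.length) (n := n) (m := u.length + l₂.length + 1) (by omega)
      (by omega) hT
    simp only [Word.shift, List.map_cons, List.map_nil, Slice.shift_mk, Nat.add_zero,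
      List.cons_append, List.nil_append] at hs'
    refine hs'.symm.trans (TE.trans ?_ e1)
    refine E.cons (m := n) (by simp [Piece.ins]; omega) (by simp [Piece.ins, Piece.outs]) ?_
    refine TE.trans ?_ e2
    exact E.cons (m := n) (by simp [Piece.ins]; omega) (by simp [Piece.ins, Piece.outs]) e3

theorem Paired.cap {a : α} {l₁ l₂ : List α} (h : Paired (l₁ ++ a :: a :: l₂)) :
    Paired (l₁ ++ l₂) := by
  intro d hd
  have h1 := h d (by simp at hd ⊢; tauto)
  have hda : a ≠ d := by
    rintro rfl
    have := h a (by simp)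
    simp only [List.count_append, List.count_cons_self] at this
    rcases List.mem_append.1 hd with h5 | h5 <;> have := List.count_pos_iff.2 h5 <;> omega
  simpa [List.count_append, List.count_cons, hda] using h1

/-- For equal labels the crossing is a virtual kink below the maximum that joins the two ends. -/
theorem join_swap {a b : α} {l₁ l₂ : List α} (h : Paired (l₁ ++ a :: b :: l₂)) :
    E (l₁.length + l₂.length + 2) (vx l₁.length :: join (l₁ ++ b :: a :: l₂))
      (join (l₁ ++ a :: b :: l₂)) := by
  by_cases hab : a = b
  · subst hab
    have h1 := join_cap h
    have hs : TE 2 0 [vx 0, ⟨0, .cap⟩] [⟨0, .cap⟩] :=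
      TE.move' [] 0 [] (.kinkCap .virt) rfl rfl (by decide) (by decide)
    have hs' := hs.front (p := l₁.length) (n := l₁.length + l₂.length + 2)
      (m := l₁.length + l₂.length) (by omega) (by omega)
      (by simpa using isTangle_join h.cap)
    simp only [Word.shift, List.map_cons, List.map_nil, Slice.shift_mk, Nat.add_zero,
      List.cons_append, List.nil_append] at hs'
    refine (E.cons (m := l₁.length + l₂.length + 2) ?_ ?_ h1.symm).trans (hs'.trans h1)
    · simp [Piece.ins]
    · simp [Piece.ins, Piece.outs]
  · exact join_swap_ne hab h

end

end

section

/-! ### Diagrams given by their crossings and the joins between their ends -/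

/-- A piece of a curve with two labelled ends, or a classical crossing with four labelled ends:
`crossing o u a c d b` is the crossing `slash` with the ends `a` (bottom left), `c` (top left),
`d` (top right) and `b` (bottom right). The Booleans are directions of travel, from the first end to
the second one for a piece of a curve, and upwards on the over-strand and on the under-strand for a
crossing. -/
inductive Box (α : Type*)
  | bivalent (e : Bool) (a b : α)
  | crossing (o u : Bool) (a c d b : α)

variable {α : Type*}

/-- The labels of the ends. -/
def Box.ports : Box α → List α
  | bivalent _ a b => [a, b]
  | crossing _ _ a c d b => [a, c, d, b]

@[simp] theorem Box.ports_bivalent (e : Bool) (a b : α) : (bivalent e a b).ports = [a, b] := rfl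

@[simp] theorem Box.ports_crossing (o u : Bool) (a c d b : α) :
    (crossing o u a c d b).ports = [a, c, d, b] := rfl

/-- The tangle with all ends at the top. -/
def Box.word : Box α → Word
  | bivalent _ _ _ => [⟨0, .cup⟩]
  | crossing _ _ _ _ _ _ => [⟨0, .cup⟩, ⟨2, .cup⟩, ⟨1, .cross .slash⟩]

theorem Box.isTangle_word (b : Box α) : IsTangle 0 b.word b.ports.length := by
  cases b <;> simp [Box.word, Box.ports, isTangle_cons, Piece.ins, Piece.outs]

/-- The labels of the ends of all boxes of a list. -/
def ports (B : List (Box α)) : List α := B.flatMap Box.ports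

@[simp] theorem ports_nil : ports ([] : List (Box α)) = [] := rfl

@[simp] theorem ports_cons (b : Box α) (B : List (Box α)) : ports (b :: B) = b.ports ++ ports B := by
  simp [ports]

@[simp] theorem ports_append (B B' : List (Box α)) : ports (B ++ B') = ports B ++ ports B' := by
  simp [ports]

theorem ports_perm {B B' : List (Box α)} (h : B.Perm B') : (ports B).Perm (ports B') :=
  h.flatMap_right _

variable [DecidableEq α]

/-- The diagram with labelled end points `l` at the bottom that consists of the boxes `B` and of
virtual joins between ends with the same label. -/
def diagram (l : List α) : List (Box α) → Word
  | [] => join l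
  | b :: B => Word.shift l.length b.word ++ diagram (l ++ b.ports) B

theorem isTangle_diagram {B : List (Box α)} : ∀ {l : List α}, Paired (l ++ ports B) →
    IsTangle l.length (diagram l B) 0 := by
  induction B with
  | nil => intro l h; exact isTangle_join (by simpa using h)
  | cons b B ih =>
    intro l h
    have := ih (l := l ++ b.ports) (by simpa using h)
    rw [diagram]
    exact (b.isTangle_word.shift' (by simp) (by simp)).append this

/-- What a tangle `c` does to all joins, it also does to a diagram with boxes: it exchanges heights
with the boxes, which stand to its right, until it is next to the final join. -/
theorem diagram_lift {c : Word} {x y l₁ : List α} (hc : IsTangle x.length c y.length)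
    (h : ∀ l₂, Paired (l₁ ++ (x ++ l₂)) → Paired (l₁ ++ (y ++ l₂)) →
      E (l₁.length + x.length + l₂.length) (Word.shift l₁.length c ++ join (l₁ ++ (y ++ l₂)))
        (join (l₁ ++ (x ++ l₂)))) {B : List (Box α)} :
    ∀ {l₂ : List α} {n : ℕ}, Paired (l₁ ++ (x ++ (l₂ ++ ports B))) →
      Paired (l₁ ++ (y ++ (l₂ ++ ports B))) → n = l₁.length + x.length + l₂.length →
      E n (Word.shift l₁.length c ++ diagram (l₁ ++ (y ++ l₂)) B) (diagram (l₁ ++ (x ++ l₂)) B) := by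
  induction B with
  | nil => intro l₂ n h1 h2 hn; subst hn; exact h l₂ (by simpa using h1) (by simpa using h2)
  | cons b B ih =>
    intro l₂ n h1 h2 hn
    have h3 := ih (l₂ := l₂ ++ b.ports) (by simpa using h1) (by simpa using h2) rfl
    have h4 := E.interchange hc b.isTangle_word (n := n) (m := l₁.length + y.length + l₂.length +
      b.ports.length) (p := l₁.length) (q := l₁.length + l₂.length)
      (v := diagram (l₁ ++ (y ++ (l₂ ++ b.ports))) B) (by omega) (by omega) (by omega)
      (by
        have := isTangle_diagram (B := B) (l := l₁ ++ (y ++ (l₂ ++ b.ports)))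
          (by simpa using h2)
        convert this using 1; simp; omega)
    simp only [diagram, List.append_assoc]
    have e1 : (l₁ ++ (y ++ l₂)).length = l₁.length + l₂.length + y.length := by simp; omega
    have e2 : (l₁ ++ (x ++ l₂)).length = l₁.length + l₂.length + x.length := by simp; omega
    rw [e1, e2]
    refine h4.trans (TE.append_left (m := l₁.length + x.length + (l₂ ++ b.ports).length)
      (b.isTangle_word.shift' (by omega) (by simp; omega)) h3)

theorem diagram_swap {a b : α} {l₁ l₂ : List α} {B : List (Box α)} {n : ℕ}
    (h : Paired (l₁ ++ a :: b :: (l₂ ++ ports B))) (hn : n = l₁.length + l₂.length + 2) :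
    E n (vx l₁.length :: diagram (l₁ ++ b :: a :: l₂) B) (diagram (l₁ ++ a :: b :: l₂) B) := by
  refine diagram_lift (c := [vx 0]) (x := [a, b]) (y := [b, a]) (by simp; decide) ?_ (by simpa using h)
    (h.perm ?_) (by simp; omega)
  · intro l₂ h1 _
    have := join_swap (by simpa using h1)
    rw [show l₁.length + l₂.length + 2 = l₁.length + [a, b].length + l₂.length by simp; omega]
      at this
    exact this
  · simpa using List.Perm.append_left _ (List.Perm.swap _ _ _)

theorem diagram_cap {a : α} {l₁ l₂ : List α} {B : List (Box α)} {n : ℕ}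
    (h : Paired (l₁ ++ a :: a :: (l₂ ++ ports B))) (hn : n = l₁.length + l₂.length + 2) :
    E n (⟨l₁.length, .cap⟩ :: diagram (l₁ ++ l₂) B) (diagram (l₁ ++ a :: a :: l₂) B) := by
  refine diagram_lift (c := [⟨0, .cap⟩]) (x := [a, a]) (y := []) (by simp; decide) ?_
    (by simpa using h) (by simpa using h.cap) (by simp; omega)
  intro l₂ h1 _
  have := join_cap (by simpa using h1)
  rw [show l₁.length + l₂.length + 2 = l₁.length + [a, a].length + l₂.length by simp; omega]
    at this
  exact this

theorem diagram_pull {x : α} {m l₂ : List α} {B : List (Box α)} : ∀ {l₁ : List α} {n : ℕ},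
    Paired (l₁ ++ m ++ x :: l₂ ++ ports B) → n = l₁.length + m.length + l₂.length + 1 →
    E n (pull l₁.length m.length ++ diagram (l₁ ++ x :: (m ++ l₂)) B)
      (diagram (l₁ ++ (m ++ x :: l₂)) B) := by
  induction m with
  | nil => intros; exact TE.refl _
  | cons y m ih =>
    intro l₁ n h hn
    have h1 := ih (l₁ := l₁ ++ [y]) (n := n) (by simpa using h) (by simp at *; omega)
    have h2 := diagram_swap (a := y) (b := x) (l₁ := l₁) (l₂ := m ++ l₂) (B := B) (n := n)
      (h.perm ?_) (by simp at *; omega)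
    · rw [List.length_cons, Nat.add_comm m.length 1, pull_add]
      simp only [List.append_assoc, List.length_append, List.length_cons, List.length_nil,
        List.cons_append, List.nil_append, Nat.zero_add] at h1 h2 ⊢
      refine TE.trans (TE.append_left (m := n) (isTangle_pull (by simp at hn; omega)) ?_) h1
      simpa [pull] using h2
    · simp only [List.append_assoc, List.cons_append]
      exact List.Perm.append_left _ (List.Perm.cons _ List.perm_middle)

theorem diagram_congr {l : List α} {B B' : List (Box α)} {b : Box α}
    (h : E (l ++ b.ports).length (diagram (l ++ b.ports) B) (diagram (l ++ b.ports) B')) :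
    E l.length (diagram l (b :: B)) (diagram l (b :: B')) :=
  TE.append_left (b.isTangle_word.shift' (by simp) (by simp)) h

/-- A box may stand at any place between the end points at the bottom. -/
theorem diagram_box {b : Box α} {l₂ : List α} {B : List (Box α)} : ∀ {l₁ : List α} {n : ℕ},
    Paired (l₁ ++ l₂ ++ b.ports ++ ports B) → n = l₁.length + l₂.length →
    E n (Word.shift l₁.length b.word ++ diagram (l₁ ++ (b.ports ++ l₂)) B)
      (diagram (l₁ ++ l₂) (b :: B)) := by
  induction l₂ with
  | nil => intro l₁ n _ _; rw [diagram]; simp [TE.refl]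
  | cons x l₂ ih =>
    intro l₁ n h hn
    have h1 := ih (l₁ := l₁ ++ [x]) (n := n) (by simpa using h) (by simp at *; omega)
    have hp : Paired (l₁ ++ x :: (b.ports ++ l₂) ++ ports B) := h.perm (by
      simp only [List.append_assoc, List.cons_append]
      refine List.Perm.append_left _ (List.Perm.cons _ ?_)
      simp only [← List.append_assoc]
      exact List.Perm.append_right _ List.perm_append_comm)
    have h2 := diagram_pull (x := x) (m := b.ports) (l₁ := l₁) (l₂ := l₂) (B := B)
      (n := n + b.ports.length) (hp.perm (by
        simp only [List.append_assoc, List.cons_append]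
        exact List.Perm.append_left _ List.perm_middle.symm)) (by simp at *; omega)
    have h3 := E.natural b.isTangle_word (n := n) (m := n + b.ports.length) (p := l₁.length)
      (v := diagram (l₁ ++ x :: (b.ports ++ l₂)) B) (by simp at hn; omega) (by omega) (by
        have := isTangle_diagram hp
        convert this using 1; simp at *; omega)
    simp only [List.append_assoc, List.cons_append, List.nil_append, List.length_append,
      List.length_cons, List.length_nil, Nat.zero_add, pull_zero] at h1 h3 ⊢
    refine TE.trans (TE.append_left (m := n + b.ports.length) ?_ h2.symm) (h3.trans h1)
    exact b.isTangle_word.shift' (by simp at hn; omega) (by omega)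

/-- Two consecutive boxes exchange heights as tangles side by side; then `diagram_box` puts their
ends into the order required by `diagram`. -/
theorem diagram_perm {B B' : List (Box α)} (hB : B.Perm B') : ∀ {l : List α},
    Paired (l ++ ports B) → E l.length (diagram l B) (diagram l B') := by
  induction hB with
  | nil => intros; exact TE.refl _
  | cons b hB ih => intro l h; exact diagram_congr (ih (by simpa using h))
  | swap b b' B =>
    intro l h
    have hp : Paired (l ++ (b.ports ++ b'.ports) ++ ports B) := h.perm (by
      simp only [List.append_assoc, ports_cons]
      refine List.Perm.append_left _ ?_
      simp only [← List.append_assoc]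
      exact List.Perm.append_right _ List.perm_append_comm)
    have h1 := diagram_box (b := b) (l₁ := l) (l₂ := b'.ports) (B := B)
      (by simpa using h) rfl
    have h2 := E.interchange b.isTangle_word b'.isTangle_word (n := l.length)
      (m := l.length + b.ports.length + b'.ports.length) (p := l.length) (q := l.length)
      (v := diagram (l ++ (b.ports ++ b'.ports)) B) le_rfl (by omega) (by omega) (by
        have := isTangle_diagram hp
        convert this using 1; simp; omega)
    have h3 := TE.append_left (u := Word.shift l.length b'.word) (b'.isTangle_word.shift'
      (a := l.length) (b := l.length + b'.ports.length) (by omega) (by omega)) h1.symm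
    simp only [Nat.add_zero] at h2
    conv_lhs => rw [diagram]
    conv_rhs => rw [diagram, diagram]
    simp only [List.length_append, List.append_assoc]
    exact h3.trans h2.symm
  | trans h h' ih ih' =>
    intro l hl
    exact (ih hl).trans (ih' (hl.perm (List.Perm.append_left _ (ports_perm h))))

theorem diagram_cup {a b : α} (e : Bool) {l₁ l₂ : List α} {B : List (Box α)} {n : ℕ}
    (h : Paired (l₁ ++ l₂ ++ [a, b] ++ ports B)) (hn : n = l₁.length + l₂.length) :
    E n (⟨l₁.length, .cup⟩ :: diagram (l₁ ++ a :: b :: l₂) B)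
      (diagram (l₁ ++ l₂) (.bivalent e a b :: B)) :=
  diagram_box (b := .bivalent e a b) h hn

theorem Paired.drop {l l' : List α} (h : Paired l) (r : List α) (hp : l.Perm (l' ++ (r ++ r))) :
    Paired l' := by
  intro c hc
  have h1 := h c (hp.mem_iff.2 (by simp [hc]))
  have h2 := List.count_pos_iff.2 hc
  rw [hp.count_eq, List.count_append, List.count_append] at h1
  omega

/-- A piece of a curve at the bottom may be dropped. -/
theorem diagram_bivalent {a b : α} (e : Bool) {l₁ l₂ : List α} {B : List (Box α)} {n : ℕ}
    (h' : Paired (l₁ ++ a :: l₂ ++ a :: b :: ports B)) (hn : n = l₁.length + l₂.length + 1) :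
    E n (diagram (l₁ ++ b :: l₂) B) (diagram (l₁ ++ a :: l₂) (.bivalent e a b :: B)) := by
  have h : Paired (l₁ ++ b :: l₂ ++ ports B) := h'.drop [a] (List.perm_iff_count.2 fun z => by
    simp only [List.count_append, List.count_cons, List.count_nil]; omega)
  have h1 := diagram_cup e (a := a) (b := b) (l₁ := l₁ ++ [a]) (l₂ := l₂) (B := B) (n := n)
    (by simpa using h') (by simp; omega)
  have h2 := diagram_cap (a := a) (l₁ := l₁) (l₂ := b :: l₂) (B := B) (n := n + 2)
    (h'.perm (by
      simp only [List.append_assoc, List.cons_append]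
      refine List.Perm.append_left _ (List.Perm.cons _ (List.perm_middle.trans (.cons _ ?_)))
      exact List.perm_middle)) (by simp; omega)
  -- Joining the end point `a` to the end `a` of the minimum produces a zigzag, which is
  -- straightened.
  have hz : TE 1 1 [⟨1, .cup⟩, ⟨0, .cap⟩] [] :=
    TE.move' [] 0 [] .zigzagLeft rfl rfl (by decide) (by decide)
  have h3 := hz.front (p := l₁.length) (n := n) (m := n) (v := diagram (l₁ ++ b :: l₂) B)
    (by omega) rfl (by
      have := isTangle_diagram h
      convert this using 1; simp; omega)
  simp only [Word.shift, List.map_cons, List.map_nil, Slice.shift_mk, Nat.add_zero,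
      List.cons_append, List.nil_append, List.append_assoc, List.length_append, List.length_cons,
      List.length_nil, Nat.zero_add] at h1 h3
  refine h3.symm.trans (TE.trans (E.cons ?_ ?_ h2) h1)
  · simp [Piece.ins]; omega
  · simp [Piece.ins, Piece.outs]

end

/-! ### Crossings as boxes, and changes of boxes -/

section

variable {α : Type*} [DecidableEq α]

/-- A crossing slice at the bottom is a box. -/
theorem diagram_slash {a b c d : α} (o u : Bool) {l₁ l₂ : List α} {B : List (Box α)} {n : ℕ}
    (h : Paired (l₁ ++ a :: b :: l₂ ++ [a, c, d, b] ++ ports B))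
    (hn : n = l₁.length + l₂.length + 2) :
    E n (⟨l₁.length, .cross .slash⟩ :: diagram (l₁ ++ c :: d :: l₂) B)
      (diagram (l₁ ++ a :: b :: l₂) (.crossing o u a c d b :: B)) := by
  have h1 := diagram_box (b := .crossing o u a c d b) (l₁ := l₁ ++ [a]) (l₂ := b :: l₂) (B := B)
    (n := n) (h.perm (by simp [Box.ports])) (by simp; omega)
  have h2 := diagram_cap (a := a) (l₁ := l₁) (l₂ := c :: d :: b :: b :: l₂) (B := B) (n := n + 4)
    (h.perm (List.perm_iff_count.2 fun z => by
      simp only [List.count_append, List.count_cons, List.count_nil]; omega)) (by simp; omega)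
  have h3 := diagram_cap (a := b) (l₁ := l₁ ++ [c, d]) (l₂ := l₂) (B := B) (n := n + 2)
    (h.drop [a] (List.perm_iff_count.2 fun z => by
      simp only [List.count_append, List.count_cons, List.count_nil]; omega)) (by simp; omega)
  have h4 : IsTangle n (diagram (l₁ ++ c :: d :: l₂) B) 0 := by
    have := isTangle_diagram (B := B) (l := l₁ ++ c :: d :: l₂)
      (h.drop [a, b] (List.perm_iff_count.2 fun z => by
        simp only [List.count_append, List.count_cons, List.count_nil]; omega))
    convert this using 1; simp; omega
  -- All ends of the box point upwards. The two maxima lead the ends `a` and `b` back to the strands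
  -- from below, and the two resulting zigzags are straightened.
  have hT : TE 2 2 [⟨1, .cup⟩, ⟨3, .cup⟩, ⟨2, .cross .slash⟩, ⟨0, .cap⟩, ⟨2, .cap⟩]
      [⟨0, .cross .slash⟩] :=
    .trans (w' := [⟨1, .cup⟩, ⟨3, .cup⟩, ⟨0, .cap⟩, ⟨0, .cross .slash⟩, ⟨2, .cap⟩])
      (TE.move' [⟨1, .cup⟩, ⟨3, .cup⟩] 0 [⟨2, .cap⟩] (.exchange .cap (.cross .slash) 0)
        rfl rfl (by decide) (by decide)).symm <|
    .trans (w' := [⟨1, .cup⟩, ⟨0, .cap⟩, ⟨1, .cup⟩, ⟨0, .cross .slash⟩, ⟨2, .cap⟩])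
      (TE.move' [⟨1, .cup⟩] 0 [⟨0, .cross .slash⟩, ⟨2, .cap⟩] (.exchange .cap .cup 1)
        rfl rfl (by decide) (by decide)).symm <|
    .trans (w' := [⟨1, .cup⟩, ⟨0, .cross .slash⟩, ⟨2, .cap⟩])
      (TE.move' [] 0 [⟨1, .cup⟩, ⟨0, .cross .slash⟩, ⟨2, .cap⟩] .zigzagLeft
        rfl rfl (by decide) (by decide)) <|
    .trans (w' := [⟨1, .cup⟩, ⟨2, .cap⟩, ⟨0, .cross .slash⟩])
      (TE.move' [⟨1, .cup⟩] 0 [] (.exchange (.cross .slash) .cap 0)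
        rfl rfl (by decide) (by decide))
      (TE.move' [] 1 [⟨0, .cross .slash⟩] .zigzagRight rfl rfl (by decide) (by decide))
  have h5 := hT.front (p := l₁.length) (n := n) (m := n) (by omega) rfl h4
  simp only [Word.shift, List.map_cons, List.map_nil, Slice.shift_mk, Nat.add_zero, Box.word,
    Box.ports, List.cons_append, List.nil_append, List.append_assoc, List.length_append,
    List.length_cons, List.length_nil, Nat.zero_add, Nat.add_assoc, Nat.reduceAdd] at h1 h2 h3 h5
  refine h5.symm.trans (TE.trans ?_ h1)
  refine E.cons (m := n + 2) (by simp [Piece.ins]; omega) (by simp [Piece.ins, Piece.outs]) ?_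
  refine E.cons (m := n + 4) (by simp [Piece.ins]; omega) (by simp [Piece.ins, Piece.outs]) ?_
  refine E.cons (m := n + 4) (by simp [Piece.ins]; omega) (by simp [Piece.ins, Piece.outs]) ?_
  refine TE.trans ?_ h2
  exact E.cons (m := n + 2) (by simp [Piece.ins]; omega) (by simp [Piece.ins, Piece.outs]) h3

/-- A quarter turn takes `backslash` to `slash`, so the same kind of box serves, with its four
labels rotated: its bottom left end is the bottom right end of the slice. The quarter turn is the
use of `slideCap`; the other moves are planar isotopies that remove the zigzags. -/
theorem diagram_backslash {a b c d : α} (o u : Bool) {l₁ l₂ : List α} {B : List (Box α)} {n : ℕ}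
    (h : Paired (l₁ ++ a :: b :: l₂ ++ [b, a, c, d] ++ ports B))
    (hn : n = l₁.length + l₂.length + 2) :
    E n (⟨l₁.length, .cross .backslash⟩ :: diagram (l₁ ++ c :: d :: l₂) B)
      (diagram (l₁ ++ a :: b :: l₂) (.crossing o u b a c d :: B)) := by
  have h1 := diagram_box (b := .crossing o u b a c d) (l₁ := l₁ ++ [a, b]) (l₂ := l₂) (B := B)
    (n := n) (h.perm (by simp [Box.ports])) (by simp; omega)
  have h2 := diagram_cap (a := b) (l₁ := l₁ ++ [a]) (l₂ := a :: c :: d :: l₂) (B := B) (n := n + 4)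
    (h.perm (List.perm_iff_count.2 fun z => by
      simp only [List.count_append, List.count_cons, List.count_nil]; omega)) (by simp; omega)
  have h3 := diagram_cap (a := a) (l₁ := l₁) (l₂ := c :: d :: l₂) (B := B) (n := n + 2)
    (h.drop [b] (List.perm_iff_count.2 fun z => by
      simp only [List.count_append, List.count_cons, List.count_nil]; omega)) (by simp; omega)
  have h4 : IsTangle n (diagram (l₁ ++ c :: d :: l₂) B) 0 := by
    have := isTangle_diagram (B := B) (l := l₁ ++ c :: d :: l₂)
      (h.drop [a, b] (List.perm_iff_count.2 fun z => by
        simp only [List.count_append, List.count_cons, List.count_nil]; omega))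
    convert this using 1; simp; omega
  have hT : TE 2 2 [⟨2, .cup⟩, ⟨4, .cup⟩, ⟨3, .cross .slash⟩, ⟨1, .cap⟩, ⟨0, .cap⟩]
      [⟨0, .cross .backslash⟩] :=
    .trans (w' := [⟨2, .cup⟩, ⟨4, .cup⟩, ⟨1, .cap⟩, ⟨1, .cross .slash⟩, ⟨0, .cap⟩])
      (TE.move' [⟨2, .cup⟩, ⟨4, .cup⟩] 1 [⟨0, .cap⟩] (.exchange .cap (.cross .slash) 0)
        rfl rfl (by decide) (by decide)).symm <|
    .trans (w' := [⟨2, .cup⟩, ⟨1, .cap⟩, ⟨2, .cup⟩, ⟨1, .cross .slash⟩, ⟨0, .cap⟩])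
      (TE.move' [⟨2, .cup⟩] 1 [⟨1, .cross .slash⟩, ⟨0, .cap⟩] (.exchange .cap .cup 1)
        rfl rfl (by decide) (by decide)).symm <|
    .trans (w' := [⟨2, .cup⟩, ⟨1, .cross .slash⟩, ⟨0, .cap⟩])
      (TE.move' [] 1 [⟨2, .cup⟩, ⟨1, .cross .slash⟩, ⟨0, .cap⟩] .zigzagLeft
        rfl rfl (by decide) (by decide)) <|
    .trans (w' := [⟨2, .cup⟩, ⟨0, .cross .backslash⟩, ⟨1, .cap⟩])
      (TE.move' [⟨2, .cup⟩] 0 [] (.slideCap .slash) rfl rfl (by decide) (by decide)) <|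
    .trans (w' := [⟨0, .cross .backslash⟩, ⟨2, .cup⟩, ⟨1, .cap⟩])
      (TE.move' [] 0 [⟨1, .cap⟩] (.exchange (.cross .backslash) .cup 0)
        rfl rfl (by decide) (by decide)).symm
      (TE.move' [⟨0, .cross .backslash⟩] 1 [] .zigzagLeft rfl rfl (by decide) (by decide))
  have h5 := hT.front (p := l₁.length) (n := n) (m := n) (by omega) rfl h4
  simp only [Word.shift, List.map_cons, List.map_nil, Slice.shift_mk, Nat.add_zero, Box.word,
    Box.ports, List.cons_append, List.nil_append, List.append_assoc, List.length_append,
    List.length_cons, List.length_nil, Nat.zero_add, Nat.add_assoc, Nat.reduceAdd] at h1 h2 h3 h5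
  refine h5.symm.trans (TE.trans ?_ h1)
  refine E.cons (m := n + 2) (by simp [Piece.ins]; omega) (by simp [Piece.ins, Piece.outs]) ?_
  refine E.cons (m := n + 4) (by simp [Piece.ins]; omega) (by simp [Piece.ins, Piece.outs]) ?_
  refine E.cons (m := n + 4) (by simp [Piece.ins]; omega) (by simp [Piece.ins, Piece.outs]) ?_
  refine TE.trans ?_ h2
  exact E.cons (m := n + 2) (by simp [Piece.ins]; omega) (by simp [Piece.ins, Piece.outs]) h3

/-- A bivalent box next to another box may be dropped. -/
theorem diagram_merge {l p₁ p₂ : List α} {B : List (Box α)} {a b : α} (e : Bool) {t t' : Box α}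
    (ht : t.ports = p₁ ++ a :: p₂) (ht' : t'.ports = p₁ ++ b :: p₂) (hw : t.word = t'.word)
    (h : Paired (l ++ ports (t :: .bivalent e a b :: B))) :
    E l.length (diagram l (t :: .bivalent e a b :: B)) (diagram l (t' :: B)) := by
  have h1 := diagram_bivalent e (a := a) (b := b) (l₁ := l ++ p₁) (l₂ := p₂) (B := B)
    (h.perm (by simp [ht])) rfl
  rw [diagram, ht]
  conv_rhs => rw [diagram, ht', ← hw]
  have e1 : IsTangle l.length (Word.shift l.length t.word) (l.length + t.ports.length) :=
    t.isTangle_word.shift' (by omega) (by omega)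
  refine TE.append_left e1 ?_
  have e2 : (l ++ p₁).length + p₂.length + 1 = l.length + t.ports.length := by
    rw [ht]; simp; omega
  rw [e2] at h1
  simpa using h1.symm

/-- The ends of a minimum are exchanged by a virtual kink. -/
theorem diagram_bivalent_comm {l : List α} {B : List (Box α)} {a b : α} (e e' : Bool)
    (h : Paired (l ++ ports (.bivalent e a b :: B))) :
    E l.length (diagram l (.bivalent e a b :: B)) (diagram l (.bivalent e' b a :: B)) := by
  have h1 := diagram_swap (l₁ := l) (l₂ := []) (a := a) (b := b) (B := B) (n := l.length + 2)
    (h.perm (by simp [Box.ports])) rfl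
  have h2 := diagram_swap (l₁ := l) (l₂ := []) (a := b) (b := a) (B := B) (n := l.length + 2)
    (h.perm (List.perm_iff_count.2 fun z => by
      simp only [Box.ports_bivalent, ports_cons, List.count_append, List.count_cons, List.count_nil]
      omega)) rfl
  have h3 : TE 0 2 [⟨0, .cup⟩, vx 0] [⟨0, .cup⟩] :=
    TE.move' [] 0 [] (.kinkCup .virt) rfl rfl (by decide) (by decide)
  have h4 := h3.front (p := l.length) (n := l.length) (m := l.length + 2)
    (v := diagram (l ++ [b, a]) B) (by omega) (by omega) (by
      have := isTangle_diagram (B := B) (l := l ++ [b, a])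
        (h.perm (List.perm_iff_count.2 fun z => by
          simp only [Box.ports_bivalent, ports_cons, List.count_append, List.count_cons, List.count_nil]
          omega))
      simpa using this)
  simp only [Word.shift, List.map_cons, List.map_nil, Slice.shift_mk, Nat.add_zero,
    List.cons_append, List.nil_append] at h4
  simp only [diagram, Box.word, Box.ports, Word.shift, List.map_cons, List.map_nil, Slice.shift_mk,
    Nat.add_zero, List.cons_append, List.nil_append]
  refine TE.trans (E.cons (m := l.length + 2) ?_ ?_ h1.symm) h4
  · simp [Piece.ins]
  · simp [Piece.ins, Piece.outs]

theorem diagram_merge_list {B : List (Box α)} {a b : α} (e : Bool) {l p₁ p₂ : List α}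
    {t t' : Box α} {B₁ B₂ : List (Box α)} (hB : B.Perm (.bivalent e a b :: (B₁ ++ t :: B₂)))
    (ht : t.ports = p₁ ++ a :: p₂) (ht' : t'.ports = p₁ ++ b :: p₂) (hw : t.word = t'.word)
    (h : Paired (l ++ ports B)) :
    E l.length (diagram l B) (diagram l (B₁ ++ t' :: B₂)) := by
  have hq : B.Perm (t :: .bivalent e a b :: (B₁ ++ B₂)) :=
    hB.trans ((List.Perm.cons _ List.perm_middle).trans (List.Perm.swap _ _ _))
  have hQ := h.perm (List.Perm.append_left l (ports_perm hq))
  have h1 := diagram_perm hq h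
  have h4 := diagram_merge e ht ht' hw hQ
  have h5 := diagram_perm (B := t' :: (B₁ ++ B₂)) (B' := B₁ ++ t' :: B₂) List.perm_middle.symm
    (l := l) (hQ.drop [a] (List.perm_iff_count.2 fun z => by
      simp only [Box.ports_bivalent, ports_cons, List.count_append, List.count_cons, List.count_nil,
        ht, ht']
      omega))
  exact h1.trans (h4.trans h5)

theorem diagram_merge_list' {B : List (Box α)} {a b : α} (e : Bool) {l p₁ p₂ : List α}
    {t t' : Box α} {B₁ B₂ : List (Box α)} (hB : B.Perm (.bivalent e b a :: (B₁ ++ t :: B₂)))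
    (ht : t.ports = p₁ ++ a :: p₂) (ht' : t'.ports = p₁ ++ b :: p₂) (hw : t.word = t'.word)
    (h : Paired (l ++ ports B)) :
    E l.length (diagram l B) (diagram l (B₁ ++ t' :: B₂)) := by
  have hP := h.perm (List.Perm.append_left l (ports_perm hB))
  refine (diagram_perm hB h).trans ((diagram_bivalent_comm e e hP).trans
    (diagram_merge_list e (.refl _) ht ht' hw (hP.perm ?_)))
  exact List.perm_iff_count.2 fun z => by
    simp only [Box.ports_bivalent, ports_cons, List.count_append, List.count_cons, List.count_nil]
    omega

theorem Paired.add {l l' : List α} (h : Paired l) {r : List α} (hr : r.Nodup)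
    (hd : ∀ c ∈ r, c ∉ l) (hp : l'.Perm (l ++ (r ++ r))) : Paired l' := by
  intro c hc
  rw [hp.mem_iff] at hc
  rw [hp.count_eq, List.count_append, List.count_append]
  by_cases hcr : c ∈ r
  · rw [List.count_eq_one_of_mem hr hcr, List.count_eq_zero.2 (hd c hcr)]
  · rw [List.count_eq_zero.2 hcr, h c (by simpa [hcr] using hc)]

theorem exists_fresh [Infinite α] (l : List α) : ∃ a, a ∉ l := by
  obtain ⟨a, ha⟩ := Infinite.exists_notMem_finset l.toFinset
  exact ⟨a, by simpa using ha⟩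

theorem exists_fresh_list [Infinite α] (l : List α) (n : ℕ) :
    ∃ r : List α, r.length = n ∧ r.Nodup ∧ ∀ c ∈ r, c ∉ l := by
  induction n with
  | zero => exact ⟨[], by simp⟩
  | succ n ih =>
    obtain ⟨r, h1, h2, h3⟩ := ih
    obtain ⟨a, ha⟩ := exists_fresh (r ++ l)
    simp only [List.mem_append, not_or] at ha
    exact ⟨a :: r, by simp [h1], by simp [h2, ha], by simpa [ha] using h3⟩

/-- A minimum slides across the crossing and makes it a `backslash`. Read by `diagram_backslash`,
this is the box of the crossing after a half turn, as needed in `diagram_rotate`. -/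
theorem TE.crossing_rotate : TE 0 4 [⟨0, .cup⟩, ⟨2, .cup⟩, ⟨1, .cross .slash⟩]
    [⟨0, .cup⟩, ⟨1, .cup⟩, ⟨0, .cross .backslash⟩] :=
  .trans (w' := [⟨0, .cup⟩, ⟨0, .cup⟩, ⟨1, .cross .slash⟩])
    (TE.move' [] 0 [⟨1, .cross .slash⟩] (.exchange .cup .cup 0) rfl rfl (by decide) (by decide))
    (TE.move' [⟨0, .cup⟩] 0 [] (.slideCup .slash) rfl rfl (by decide) (by decide))

/-- The box of a crossing may be turned around. -/
theorem diagram_rotate [Infinite α] {a b c d : α} (o u o' u' : Bool) {l : List α}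
    {B : List (Box α)} (h : Paired (l ++ ports (.crossing o u a c d b :: B))) :
    E l.length (diagram l (.crossing o u a c d b :: B))
      (diagram l (.crossing o' u' d b a c :: B)) := by
  -- The fresh labels belong to the bottom ends of the `backslash`, which stand on minima. The
  -- bivalent boxes of these minima are merged into the crossing at the end.
  obtain ⟨a', ha'⟩ := exists_fresh (l ++ ports (.crossing o u a c d b :: B))
  obtain ⟨b', hb'⟩ := exists_fresh (a' :: (l ++ ports (.crossing o u a c d b :: B)))
  have hP : Paired (l ++ ports (.bivalent true a' b :: .bivalent true b' d ::
      .crossing true true b' a' a c :: B)) := by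
    refine h.add (r := [a', b']) ?_ ?_ ?_
    · simp at hb' ⊢; tauto
    · simp at ha' hb' ⊢; tauto
    · exact List.perm_iff_count.2 fun z => by
        simp only [Box.ports_bivalent, Box.ports_crossing, ports_cons, List.count_append,
          List.count_cons, List.count_nil]
        omega
  have h1 := TE.crossing_rotate.front (p := l.length) (n := l.length) (m := l.length + 4)
    (v := diagram (l ++ [a, c, d, b]) B) (by omega) (by omega) (by
      have := isTangle_diagram (B := B) (l := l ++ [a, c, d, b]) (by simpa using h)
      simpa using this)
  have h2 := diagram_backslash true true (a := a') (b := b') (c := a) (d := c) (l₁ := l)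
    (l₂ := [d, b]) (B := B) (n := l.length + 4) (hP.perm (List.perm_iff_count.2 fun z => by
        simp only [Box.ports_bivalent, Box.ports_crossing, ports_cons, List.count_append,
          List.count_cons, List.count_nil]
        omega)) rfl
  have h3 := diagram_cup true (a := b') (b := d) (l₁ := l ++ [a']) (l₂ := [b]) (n := l.length + 2)
    (B := .crossing true true b' a' a c :: B) (hP.perm (List.perm_iff_count.2 fun z => by
        simp only [Box.ports_bivalent, Box.ports_crossing, ports_cons, List.count_append,
          List.count_cons, List.count_nil]
        omega)) (by simp)
  have h4 := diagram_cup true (a := a') (b := b) (l₁ := l) (l₂ := []) (n := l.length)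
    (B := .bivalent true b' d :: .crossing true true b' a' a c :: B)
      (hP.perm (List.perm_iff_count.2 fun z => by
        simp only [Box.ports_bivalent, Box.ports_crossing, ports_cons, List.count_append,
          List.count_cons, List.count_nil]
        omega)) rfl
  have h5 := diagram_merge_list true (B₁ := [.bivalent true b' d]) (p₁ := [b']) (p₂ := [a, c])
    (t := .crossing true true b' a' a c) (t' := .crossing true true b' b a c) (B₂ := B)
    (.refl _) rfl rfl rfl hP
  have h6 := diagram_merge_list true (l := l) (B₁ := []) (p₁ := []) (p₂ := [b, a, c])
    (t := .crossing true true b' b a c) (t' := .crossing o' u' d b a c) (B₂ := B)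
    (.refl _) rfl rfl rfl (hP.drop [a'] (List.perm_iff_count.2 fun z => by
        simp only [Box.ports_bivalent, Box.ports_crossing, ports_cons, List.count_append,
          List.count_cons, List.count_nil, List.nil_append, List.cons_append]
        omega))
  refine TE.trans ?_ (h5.trans h6)
  simp only [Word.shift, List.map_cons, List.map_nil, Slice.shift_mk, Nat.add_zero,
    List.cons_append, List.nil_append, List.append_assoc, List.length_append, List.length_cons,
    List.length_nil, Nat.zero_add, List.append_nil] at h1 h2 h3 h4
  conv_lhs => rw [diagram]
  refine h1.trans (TE.trans ?_ h4)
  refine E.cons (m := l.length + 2) (by simp [Piece.ins]) (by simp [Piece.ins, Piece.outs]) ?_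
  refine TE.trans ?_ h3
  exact E.cons (m := l.length + 4) (by simp [Piece.ins]) (by simp [Piece.ins, Piece.outs]) h2

/-- The central welded move. Call the strands `a`, `y`, `b`, from left to right at the bottom.
Before the move `y` passes under `a` and then over `b`; after it `y` first passes over `b`, and `b`
passes under `a` both before and after passing under `y`. The proof inserts two cancelling crossings
of `a` over `b` and two virtual crossings, moves `b` virtually across the crossing of `a` and `y`
(mixed move), moves `a` over the virtual crossing of `b` and `y` (OCC), and ends with a third
Reidemeister move with `a` on top. -/
theorem TE.push : TE 3 3 [⟨0, .cross .slash⟩, vx 1, ⟨0, .cross .slash⟩]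
    [vx 1, vx 0, ⟨0, .cross .backslash⟩, vx 1, ⟨1, .cross .slash⟩, ⟨0, .cross .slash⟩,
      ⟨1, .cross .slash⟩] :=
  .trans (w' := [⟨0, .cross .slash⟩, vx 1, ⟨1, .cross .backslash⟩, ⟨1, .cross .slash⟩,
      ⟨0, .cross .slash⟩])
    (TE.move' [⟨0, .cross .slash⟩, vx 1] 1 [⟨0, .cross .slash⟩] (.bigon .backslash)
      rfl rfl (by decide) (by decide)).symm <|
  .trans (w' := [⟨0, .cross .slash⟩, vx 1, vx 0, vx 0, ⟨1, .cross .backslash⟩,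
      ⟨1, .cross .slash⟩, ⟨0, .cross .slash⟩])
    (TE.move' [⟨0, .cross .slash⟩, vx 1] 0 [⟨1, .cross .backslash⟩, ⟨1, .cross .slash⟩,
      ⟨0, .cross .slash⟩] (.bigon .virt) rfl rfl (by decide) (by decide)).symm <|
  .trans (w' := [vx 1, vx 0, ⟨1, .cross .slash⟩, vx 0, ⟨1, .cross .backslash⟩,
      ⟨1, .cross .slash⟩, ⟨0, .cross .slash⟩])
    (TE.move' [] 0 [vx 0, ⟨1, .cross .backslash⟩, ⟨1, .cross .slash⟩, ⟨0, .cross .slash⟩]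
      (.triangle _ _ _ (.virtC .slash)) rfl rfl (by decide) (by decide)) <|
  .trans (w' := [vx 1, vx 0, ⟨0, .cross .backslash⟩, vx 1, ⟨0, .cross .slash⟩,
      ⟨1, .cross .slash⟩, ⟨0, .cross .slash⟩])
    (TE.move' [vx 1, vx 0] 0 [⟨1, .cross .slash⟩, ⟨0, .cross .slash⟩]
      (.triangle _ _ _ (.overB .virt)) rfl rfl (by decide) (by decide)).symm <|
  TE.move' [vx 1, vx 0, ⟨0, .cross .backslash⟩, vx 1] 0 [] (.triangle _ _ _ (.overA .slash))
    rfl rfl (by decide) (by decide)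

end

/-! ### Pushing an overcrossing back through an undercrossing, for boxes -/

section

set_option linter.unusedSimpArgs false

variable {α : Type*} [DecidableEq α]

/-- A crossing where a strand `y` passes over a strand `b` is moved back along `y`, through a
crossing where `y` passes under a strand `a`. -/
theorem diagram_push [Infinite α] {a b y a' b' y' y₁ a₂ a₃ b₂ b₃ y₂ : α} {R : List (Box α)}
    (o u o' u' o₁ u₁ o₂ u₂ o₃ u₃ o₄ u₄ : Bool)
    (h : Paired (ports (.crossing o u a y₁ a' y :: .crossing o' u' y₁ b' y' b :: R)))
    (hn : [a₂, a₃, b₂, b₃, y₂].Nodup)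
    (hf : ∀ c ∈ [a₂, a₃, b₂, b₃, y₂],
      c ∉ ports (.crossing o u a y₁ a' y :: .crossing o' u' y₁ b' y' b :: R)) :
    E 0 (diagram [] (.crossing o u a y₁ a' y :: .crossing o' u' y₁ b' y' b :: R))
      (diagram [] (.crossing o₁ u₁ a b a₂ b₂ :: .crossing o₂ u₂ y b₃ y₂ b₂ ::
        .crossing o₃ u₃ a₂ b' a₃ b₃ :: .crossing o₄ u₄ a₃ y' a' y₂ :: R)) := by
  -- Three auxiliary labels for the bottom ends of the strands in `TE.push`. There the strands stand
  -- on minima, so that the whole diagram is closed; the corresponding bivalent boxes are merged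
  -- away on both sides.
  obtain ⟨r, hr1, hr2, hr3⟩ := exists_fresh_list ([a₂, a₃, b₂, b₃, y₂] ++
    ports (.crossing o u a y₁ a' y :: .crossing o' u' y₁ b' y' b :: R)) 3
  obtain ⟨a₁, b₁, y₀, rfl⟩ := List.length_eq_three.1 hr1
  have hn8 : [a₁, b₁, y₀, a₂, a₃, b₂, b₃, y₂].Nodup :=
    (List.nodup_append' (l₁ := [a₁, b₁, y₀])).2 ⟨hr2, hn, fun c hc hc' =>
      hr3 c hc (List.mem_append_left _ hc')⟩
  have hf8 : ∀ c ∈ [a₁, b₁, y₀, a₂, a₃, b₂, b₃, y₂],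
      c ∉ ports (.crossing o u a y₁ a' y :: .crossing o' u' y₁ b' y' b :: R) := by
    intro c hc
    rcases List.mem_append.1 (show c ∈ [a₁, b₁, y₀] ++ [a₂, a₃, b₂, b₃, y₂] from hc) with hc | hc
    · exact fun hc' => hr3 c hc (List.mem_append_right _ hc')
    · exact hf c hc
  have hf3 : ∀ c ∈ [a₁, b₁, y₀],
      c ∉ ports (.crossing o u a y₁ a' y :: .crossing o' u' y₁ b' y' b :: R) :=
    fun c hc => hf8 c (by simp at hc ⊢; tauto)
  -- The common part of both diagrams above the move.
  set D := diagram [b, y, a, b', y', a'] R with hD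
  have hP : Paired ([b, y, a, b', y', a'] ++ ports R) := h.drop [y₁] (List.perm_iff_count.2 fun z => by
    simp only [Box.ports_bivalent, Box.ports_crossing, ports_cons, List.count_append,
      List.count_cons, List.count_nil, List.nil_append, List.cons_append]
    omega)
  have hL : Paired (ports (.bivalent true b b₁ :: .bivalent true y y₀ :: .bivalent true a a₁ ::
      .crossing true true a₁ y₁ a' y₀ :: .crossing true true y₁ b' y' b₁ :: R)) :=
    h.add hr2 hf3 (List.perm_iff_count.2 fun z => by
    simp only [Box.ports_bivalent, Box.ports_crossing, ports_cons, List.count_append,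
      List.count_cons, List.count_nil, List.nil_append, List.cons_append]
    omega)
  have hR : Paired (ports (.bivalent true b b₁ :: .bivalent true y y₀ :: .bivalent true a a₁ ::
      .crossing true true a₁ b₁ a₂ b₂ :: .crossing true true y₀ b₃ y₂ b₂ ::
      .crossing true true a₂ b' a₃ b₃ :: .crossing true true a₃ y' a' y₂ :: R)) :=
    (h.drop (l' := [b, y, a, b', y', a'] ++ ports R) [y₁] (List.perm_iff_count.2 fun z => by
    simp only [Box.ports_bivalent, Box.ports_crossing, ports_cons, List.count_append,
      List.count_cons, List.count_nil, List.nil_append, List.cons_append]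
    omega)).add hn8
      (fun c hc hc' => hf8 c hc (by
        simp only [Box.ports_bivalent, Box.ports_crossing, ports_cons, List.mem_append,
          List.mem_cons, List.not_mem_nil] at hc' ⊢
        tauto)) (List.perm_iff_count.2 fun z => by
    simp only [Box.ports_bivalent, Box.ports_crossing, ports_cons, List.count_append,
      List.count_cons, List.count_nil, List.nil_append, List.cons_append]
    omega)
  -- the left side
  have L1 : E 6 (⟨3, .cross .slash⟩ :: D) (diagram [b, y, a, y₁, b₁, a']
      (.crossing true true y₁ b' y' b₁ :: R)) :=
    diagram_slash true true (l₁ := [b, y, a]) (l₂ := [a']) (hL.drop [a₁, y₀] (List.perm_iff_count.2 fun z => by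
    simp only [Box.ports_bivalent, Box.ports_crossing, ports_cons, List.count_append,
      List.count_cons, List.count_nil, List.nil_append, List.cons_append]
    omega)) rfl
  have L2 : E 6 (vx 4 :: diagram [b, y, a, y₁, b₁, a'] (.crossing true true y₁ b' y' b₁ :: R))
      (diagram [b, y, a, y₁, a', b₁] (.crossing true true y₁ b' y' b₁ :: R)) :=
    diagram_swap (l₁ := [b, y, a, y₁]) (l₂ := []) (hL.drop [a₁, y₀] (List.perm_iff_count.2 fun z => by
    simp only [Box.ports_bivalent, Box.ports_crossing, ports_cons, List.count_append,
      List.count_cons, List.count_nil, List.nil_append, List.cons_append]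
    omega)) rfl
  have L3 : E 6 (⟨3, .cross .slash⟩ :: diagram [b, y, a, y₁, a', b₁]
        (.crossing true true y₁ b' y' b₁ :: R)) (diagram [b, y, a, a₁, y₀, b₁]
      (.crossing true true a₁ y₁ a' y₀ :: .crossing true true y₁ b' y' b₁ :: R)) :=
    diagram_slash true true (l₁ := [b, y, a]) (l₂ := [b₁]) (hL.perm (List.perm_iff_count.2 fun z => by
    simp only [Box.ports_bivalent, Box.ports_crossing, ports_cons, List.count_append,
      List.count_cons, List.count_nil, List.nil_append, List.cons_append]
    omega)) rfl
  have L4 : E 4 (⟨2, .cup⟩ :: diagram [b, y, a, a₁, y₀, b₁]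
      (.crossing true true a₁ y₁ a' y₀ :: .crossing true true y₁ b' y' b₁ :: R))
      (diagram [b, y, y₀, b₁] (.bivalent true a a₁ ::
      .crossing true true a₁ y₁ a' y₀ :: .crossing true true y₁ b' y' b₁ :: R)) :=
    diagram_cup true (l₁ := [b, y]) (l₂ := [y₀, b₁]) (hL.perm (List.perm_iff_count.2 fun z => by
    simp only [Box.ports_bivalent, Box.ports_crossing, ports_cons, List.count_append,
      List.count_cons, List.count_nil, List.nil_append, List.cons_append]
    omega)) rfl
  have L5 : E 2 (⟨1, .cup⟩ :: diagram [b, y, y₀, b₁] (.bivalent true a a₁ ::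
      .crossing true true a₁ y₁ a' y₀ :: .crossing true true y₁ b' y' b₁ :: R))
      (diagram [b, b₁] (.bivalent true y y₀ :: .bivalent true a a₁ ::
      .crossing true true a₁ y₁ a' y₀ :: .crossing true true y₁ b' y' b₁ :: R)) :=
    diagram_cup true (l₁ := [b]) (l₂ := [b₁]) (by simpa using hL) rfl
  have L6 : E 0 (⟨0, .cup⟩ :: diagram [b, b₁] (.bivalent true y y₀ :: .bivalent true a a₁ ::
      .crossing true true a₁ y₁ a' y₀ :: .crossing true true y₁ b' y' b₁ :: R))
      (diagram [] (.bivalent true b b₁ :: .bivalent true y y₀ :: .bivalent true a a₁ ::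
      .crossing true true a₁ y₁ a' y₀ :: .crossing true true y₁ b' y' b₁ :: R)) :=
    diagram_cup true (l₁ := []) (l₂ := []) (by simpa using hL) rfl
  have M1 := diagram_merge_list' true (l := []) (a := b₁) (b := b)
    (B₁ := [.bivalent true y y₀, .bivalent true a a₁, .crossing true true a₁ y₁ a' y₀])
    (t := .crossing true true y₁ b' y' b₁) (t' := .crossing o' u' y₁ b' y' b) (B₂ := R)
    (p₁ := [y₁, b', y']) (p₂ := []) (.refl _) rfl rfl rfl hL
  have M2 := diagram_merge_list' true (l := []) (a := y₀) (b := y)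
    (B₁ := [.bivalent true a a₁])
    (t := .crossing true true a₁ y₁ a' y₀) (t' := .crossing true true a₁ y₁ a' y)
    (B₂ := .crossing o' u' y₁ b' y' b :: R)
    (p₁ := [a₁, y₁, a']) (p₂ := []) (.refl _) rfl rfl rfl (hL.drop [b₁] (List.perm_iff_count.2 fun z => by
    simp only [Box.ports_bivalent, Box.ports_crossing, ports_cons, List.count_append,
      List.count_cons, List.count_nil, List.nil_append, List.cons_append]
    omega))
  have M3 := diagram_merge_list' true (l := []) (a := a₁) (b := a)
    (B₁ := []) (t := .crossing true true a₁ y₁ a' y) (t' := .crossing o u a y₁ a' y)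
    (B₂ := .crossing o' u' y₁ b' y' b :: R)
    (p₁ := []) (p₂ := [y₁, a', y]) (.refl _) rfl rfl rfl (hL.drop [b₁, y₀] (List.perm_iff_count.2 fun z => by
    simp only [Box.ports_bivalent, Box.ports_crossing, ports_cons, List.count_append,
      List.count_cons, List.count_nil, List.nil_append, List.cons_append]
    omega))
  -- the right side
  have R1 : E 6 (⟨4, .cross .slash⟩ :: D) (diagram [b, y, a, b', a₃, y₂]
      (.crossing true true a₃ y' a' y₂ :: R)) :=
    diagram_slash true true (l₁ := [b, y, a, b']) (l₂ := [])
      (hR.drop [a₁, b₁, y₀, a₂, b₂, b₃] (List.perm_iff_count.2 fun z => by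
    simp only [Box.ports_bivalent, Box.ports_crossing, ports_cons, List.count_append,
      List.count_cons, List.count_nil, List.nil_append, List.cons_append]
    omega)) rfl
  have R2 : E 6 (⟨3, .cross .slash⟩ :: diagram [b, y, a, b', a₃, y₂]
      (.crossing true true a₃ y' a' y₂ :: R)) (diagram [b, y, a, a₂, b₃, y₂]
      (.crossing true true a₂ b' a₃ b₃ :: .crossing true true a₃ y' a' y₂ :: R)) :=
    diagram_slash true true (l₁ := [b, y, a]) (l₂ := [y₂]) (hR.drop [a₁, b₁, y₀, b₂] (List.perm_iff_count.2 fun z => by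
    simp only [Box.ports_bivalent, Box.ports_crossing, ports_cons, List.count_append,
      List.count_cons, List.count_nil, List.nil_append, List.cons_append]
    omega)) rfl
  have R3 : E 6 (⟨4, .cross .slash⟩ :: diagram [b, y, a, a₂, b₃, y₂]
      (.crossing true true a₂ b' a₃ b₃ :: .crossing true true a₃ y' a' y₂ :: R))
      (diagram [b, y, a, a₂, y₀, b₂] (.crossing true true y₀ b₃ y₂ b₂ ::
      .crossing true true a₂ b' a₃ b₃ :: .crossing true true a₃ y' a' y₂ :: R)) :=
    diagram_slash true true (l₁ := [b, y, a, a₂]) (l₂ := []) (hR.drop [a₁, b₁] (List.perm_iff_count.2 fun z => by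
    simp only [Box.ports_bivalent, Box.ports_crossing, ports_cons, List.count_append,
      List.count_cons, List.count_nil, List.nil_append, List.cons_append]
    omega)) rfl
  have R4 : E 6 (vx 4 :: diagram [b, y, a, a₂, y₀, b₂] (.crossing true true y₀ b₃ y₂ b₂ ::
      .crossing true true a₂ b' a₃ b₃ :: .crossing true true a₃ y' a' y₂ :: R))
      (diagram [b, y, a, a₂, b₂, y₀] (.crossing true true y₀ b₃ y₂ b₂ ::
      .crossing true true a₂ b' a₃ b₃ :: .crossing true true a₃ y' a' y₂ :: R)) :=
    diagram_swap (l₁ := [b, y, a, a₂]) (l₂ := []) (hR.drop [a₁, b₁] (List.perm_iff_count.2 fun z => by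
    simp only [Box.ports_bivalent, Box.ports_crossing, ports_cons, List.count_append,
      List.count_cons, List.count_nil, List.nil_append, List.cons_append]
    omega)) rfl
  have R5 : E 6 (⟨3, .cross .backslash⟩ :: diagram [b, y, a, a₂, b₂, y₀]
      (.crossing true true y₀ b₃ y₂ b₂ ::
      .crossing true true a₂ b' a₃ b₃ :: .crossing true true a₃ y' a' y₂ :: R))
      (diagram [b, y, a, b₁, a₁, y₀] (.crossing true true a₁ b₁ a₂ b₂ ::
      .crossing true true y₀ b₃ y₂ b₂ ::
      .crossing true true a₂ b' a₃ b₃ :: .crossing true true a₃ y' a' y₂ :: R)) :=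
    diagram_backslash true true (l₁ := [b, y, a]) (l₂ := [y₀]) (hR.perm (List.perm_iff_count.2 fun z => by
    simp only [Box.ports_bivalent, Box.ports_crossing, ports_cons, List.count_append,
      List.count_cons, List.count_nil, List.nil_append, List.cons_append]
    omega)) rfl
  have R6 : E 6 (vx 3 :: diagram [b, y, a, b₁, a₁, y₀] (.crossing true true a₁ b₁ a₂ b₂ ::
      .crossing true true y₀ b₃ y₂ b₂ ::
      .crossing true true a₂ b' a₃ b₃ :: .crossing true true a₃ y' a' y₂ :: R))
      (diagram [b, y, a, a₁, b₁, y₀] (.crossing true true a₁ b₁ a₂ b₂ ::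
      .crossing true true y₀ b₃ y₂ b₂ ::
      .crossing true true a₂ b' a₃ b₃ :: .crossing true true a₃ y' a' y₂ :: R)) :=
    diagram_swap (l₁ := [b, y, a]) (l₂ := [y₀]) (hR.perm (List.perm_iff_count.2 fun z => by
    simp only [Box.ports_bivalent, Box.ports_crossing, ports_cons, List.count_append,
      List.count_cons, List.count_nil, List.nil_append, List.cons_append]
    omega)) rfl
  have R7 : E 6 (vx 4 :: diagram [b, y, a, a₁, b₁, y₀] (.crossing true true a₁ b₁ a₂ b₂ ::
      .crossing true true y₀ b₃ y₂ b₂ ::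
      .crossing true true a₂ b' a₃ b₃ :: .crossing true true a₃ y' a' y₂ :: R))
      (diagram [b, y, a, a₁, y₀, b₁] (.crossing true true a₁ b₁ a₂ b₂ ::
      .crossing true true y₀ b₃ y₂ b₂ ::
      .crossing true true a₂ b' a₃ b₃ :: .crossing true true a₃ y' a' y₂ :: R)) :=
    diagram_swap (l₁ := [b, y, a, a₁]) (l₂ := []) (hR.perm (List.perm_iff_count.2 fun z => by
    simp only [Box.ports_bivalent, Box.ports_crossing, ports_cons, List.count_append,
      List.count_cons, List.count_nil, List.nil_append, List.cons_append]
    omega)) rfl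
  have R8 : E 4 (⟨2, .cup⟩ :: diagram [b, y, a, a₁, y₀, b₁] (.crossing true true a₁ b₁ a₂ b₂ ::
      .crossing true true y₀ b₃ y₂ b₂ ::
      .crossing true true a₂ b' a₃ b₃ :: .crossing true true a₃ y' a' y₂ :: R))
      (diagram [b, y, y₀, b₁] (.bivalent true a a₁ :: .crossing true true a₁ b₁ a₂ b₂ ::
      .crossing true true y₀ b₃ y₂ b₂ ::
      .crossing true true a₂ b' a₃ b₃ :: .crossing true true a₃ y' a' y₂ :: R)) :=
    diagram_cup true (l₁ := [b, y]) (l₂ := [y₀, b₁]) (hR.perm (List.perm_iff_count.2 fun z => by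
    simp only [Box.ports_bivalent, Box.ports_crossing, ports_cons, List.count_append,
      List.count_cons, List.count_nil, List.nil_append, List.cons_append]
    omega)) rfl
  have R9 : E 2 (⟨1, .cup⟩ :: diagram [b, y, y₀, b₁] (.bivalent true a a₁ ::
      .crossing true true a₁ b₁ a₂ b₂ :: .crossing true true y₀ b₃ y₂ b₂ ::
      .crossing true true a₂ b' a₃ b₃ :: .crossing true true a₃ y' a' y₂ :: R))
      (diagram [b, b₁] (.bivalent true y y₀ :: .bivalent true a a₁ ::
      .crossing true true a₁ b₁ a₂ b₂ :: .crossing true true y₀ b₃ y₂ b₂ ::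
      .crossing true true a₂ b' a₃ b₃ :: .crossing true true a₃ y' a' y₂ :: R)) :=
    diagram_cup true (l₁ := [b]) (l₂ := [b₁]) (by simpa using hR) rfl
  have R10 : E 0 (⟨0, .cup⟩ :: diagram [b, b₁] (.bivalent true y y₀ :: .bivalent true a a₁ ::
      .crossing true true a₁ b₁ a₂ b₂ :: .crossing true true y₀ b₃ y₂ b₂ ::
      .crossing true true a₂ b' a₃ b₃ :: .crossing true true a₃ y' a' y₂ :: R))
      (diagram [] (.bivalent true b b₁ :: .bivalent true y y₀ :: .bivalent true a a₁ ::
      .crossing true true a₁ b₁ a₂ b₂ :: .crossing true true y₀ b₃ y₂ b₂ ::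
      .crossing true true a₂ b' a₃ b₃ :: .crossing true true a₃ y' a' y₂ :: R)) :=
    diagram_cup true (l₁ := []) (l₂ := []) (by simpa using hR) rfl
  have N1 := diagram_merge_list' true (l := []) (a := b₁) (b := b)
    (B₁ := [.bivalent true y y₀, .bivalent true a a₁])
    (t := .crossing true true a₁ b₁ a₂ b₂) (t' := .crossing true true a₁ b a₂ b₂)
    (B₂ := .crossing true true y₀ b₃ y₂ b₂ ::
      .crossing true true a₂ b' a₃ b₃ :: .crossing true true a₃ y' a' y₂ :: R)
    (p₁ := [a₁]) (p₂ := [a₂, b₂]) (.refl _) rfl rfl rfl hR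
  have N2 := diagram_merge_list' true (l := []) (a := y₀) (b := y)
    (B₁ := [.bivalent true a a₁, .crossing true true a₁ b a₂ b₂])
    (t := .crossing true true y₀ b₃ y₂ b₂) (t' := .crossing o₂ u₂ y b₃ y₂ b₂)
    (B₂ := .crossing true true a₂ b' a₃ b₃ :: .crossing true true a₃ y' a' y₂ :: R)
    (p₁ := []) (p₂ := [b₃, y₂, b₂]) (.refl _) rfl rfl rfl (hR.drop [b₁] (List.perm_iff_count.2 fun z => by
    simp only [Box.ports_bivalent, Box.ports_crossing, ports_cons, List.count_append,
      List.count_cons, List.count_nil, List.nil_append, List.cons_append]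
    omega))
  have N3 := diagram_merge_list' true (l := []) (a := a₁) (b := a)
    (B₁ := []) (t := .crossing true true a₁ b a₂ b₂) (t' := .crossing o₁ u₁ a b a₂ b₂)
    (B₂ := .crossing o₂ u₂ y b₃ y₂ b₂ :: .crossing true true a₂ b' a₃ b₃ ::
      .crossing true true a₃ y' a' y₂ :: R)
    (p₁ := []) (p₂ := [b, a₂, b₂]) (.refl _) rfl rfl rfl (hR.drop [b₁, y₀] (List.perm_iff_count.2 fun z => by
    simp only [Box.ports_bivalent, Box.ports_crossing, ports_cons, List.count_append,
      List.count_cons, List.count_nil, List.nil_append, List.cons_append]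
    omega))
  have hD6 : IsTangle 6 D 0 := isTangle_diagram hP
  -- Three nested minima create the ends `b`, `y`, `a`, `a₁`, `y₀`, `b₁`, in this order; the move
  -- acts on the last three, whence the position 3.
  have T := TE.push.front (p := 3) (n := 6) (m := 6) (by omega) rfl hD6
  have T' := E.cons (n := 0) (s := ⟨0, .cup⟩) (m := 2) le_rfl rfl
    (E.cons (s := ⟨1, .cup⟩) (m := 4) (by decide) rfl
    (E.cons (s := ⟨2, .cup⟩) (m := 6) (by decide) rfl T))
  have c3 : ∀ {g : Crossing} {p : ℕ} {v v' : Word}, p ≤ 4 → E 6 v v' →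
      E 6 (⟨p, .cross g⟩ :: v) (⟨p, .cross g⟩ :: v') := fun hp hv =>
    E.cons (m := 6) (by simp [Piece.ins]; omega) (by simp [Piece.ins, Piece.outs]) hv
  have cc : ∀ {v v' : Word}, E 6 v v' → E 0 (⟨0, .cup⟩ :: ⟨1, .cup⟩ :: ⟨2, .cup⟩ :: v)
      (⟨0, .cup⟩ :: ⟨1, .cup⟩ :: ⟨2, .cup⟩ :: v') := fun hv =>
    E.cons (n := 0) (s := ⟨0, .cup⟩) (m := 2) le_rfl rfl
    (E.cons (s := ⟨1, .cup⟩) (m := 4) (by decide) rfl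
    (E.cons (s := ⟨2, .cup⟩) (m := 6) (by decide) rfl hv))
  have d3 : ∀ {v v' v'' : Word}, E 4 (⟨2, .cup⟩ :: v) v' → E 2 (⟨1, .cup⟩ :: v') v'' →
      E 0 (⟨0, .cup⟩ :: ⟨1, .cup⟩ :: ⟨2, .cup⟩ :: v) (⟨0, .cup⟩ :: v'') := fun h1 h2 =>
    E.cons (n := 0) (s := ⟨0, .cup⟩) (m := 2) le_rfl rfl
    ((E.cons (s := ⟨1, .cup⟩) (m := 4) (by decide) rfl h1).trans h2)
  have LL := (cc ((c3 (by omega) ((c3 (by omega) L1).trans L2)).trans L3)).trans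
    ((d3 L4 L5).trans L6)
  have RR := (cc ((c3 (by omega) ((c3 (by omega) ((c3 (by omega) ((c3 (by omega) ((c3 (by omega)
    ((c3 (by omega) R1).trans R2)).trans R3)).trans R4)).trans R5)).trans R6)).trans R7)).trans
    ((d3 R8 R9).trans R10)
  exact (LL.trans (M1.trans (M2.trans M3))).symm.trans (T'.trans
    (RR.trans (N1.trans (N2.trans N3))))

end

section

variable {α : Type*}

/-! ### Strands of boxes -/

/-- The pair of `a` and `b`, in the direction given by the Boolean. -/
def dir (e : Bool) (a b : α) : α × α := if e then (a, b) else (b, a)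

@[simp] theorem dir_true (a b : α) : dir true a b = (a, b) := rfl
@[simp] theorem dir_false (a b : α) : dir false a b = (b, a) := rfl

/-- The pieces of the curve in a box, from the label where a traveller enters to the label where he
leaves. For a crossing, the over-strand comes first. -/
def Box.strands : Box α → List (α × α)
  | bivalent e a b => [dir e a b]
  | crossing o u a c d b => [dir o a d, dir u b c]

@[simp] theorem Box.strands_bivalent (e : Bool) (a b : α) :
    (bivalent e a b).strands = [dir e a b] := rfl

@[simp] theorem Box.strands_crossing (o u : Bool) (a c d b : α) :
    (crossing o u a c d b).strands = [dir o a d, dir u b c] := rfl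

/-- The strands of all boxes of a list. -/
def strands (B : List (Box α)) : List (α × α) := B.flatMap Box.strands

@[simp] theorem strands_nil : strands ([] : List (Box α)) = [] := rfl

@[simp] theorem strands_cons (b : Box α) (B : List (Box α)) :
    strands (b :: B) = b.strands ++ strands B := by
  simp [strands]

theorem strands_perm {B B' : List (Box α)} (h : B.Perm B') : (strands B).Perm (strands B') :=
  h.flatMap_right _

theorem mem_strands {B : List (Box α)} {s : α × α} : s ∈ strands B ↔ ∃ b ∈ B, s ∈ b.strands := by
  simp [strands]

/-- The labels where strands begin. -/
abbrev sources (B : List (Box α)) : List α := (strands B).map Prod.fst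

/-- The labels where strands end. -/
abbrev targets (B : List (Box α)) : List α := (strands B).map Prod.snd

/-- A traveller who follows the strands gets from the first label to the second one. -/
def Reach (B : List (Box α)) : α → α → Prop := Relation.ReflTransGen fun a b => (a, b) ∈ strands B

/-- `p e` is the number of heads that a traveller who arrives along `e` has to be freed from, and
`q e` is this number for a traveller who leaves along `e`. -/
def Box.Flow (p q : α → ℕ) : Box α → Prop
  | bivalent e a b => q (dir e a b).2 = p (dir e a b).1
  | crossing o u a c d b => q (dir o a d).2 = p (dir o a d).1 ∧
      q (dir u b c).2 = p (dir u b c).1 + 1 + 2 * p (dir o a d).1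

/-- The boxes `B` form a closed curve. The numbers `p` and `q` are compatible at each box and, except
at at most `n` marked labels, along each label. -/
structure Calibration (n : ℕ) (B : List (Box α)) (p q : α → ℕ) (M : Finset α) : Prop where
  nodup : (sources B).Nodup
  perm : (sources B).Perm (targets B)
  reach : ∀ e ∈ sources B, ∀ f ∈ sources B, Reach B e f
  card : M.card ≤ n
  flow : ∀ b ∈ B, b.Flow p q
  eq : ∀ e, e ∉ M → e ∈ sources B → q e = p e
  zero : ∀ e ∈ M, p e = 0

theorem Calibration.of_perm {n : ℕ} {B B' : List (Box α)} {p q : α → ℕ} {M : Finset α}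
    (h : Calibration n B p q M) (hB : B.Perm B') : Calibration n B' p q M where
  nodup := ((strands_perm hB).map _).nodup_iff.1 h.nodup
  perm := (((strands_perm hB).map _).symm.trans h.perm).trans ((strands_perm hB).map _)
  reach e he f hf := by
    have := h.reach e (((strands_perm hB).map _).mem_iff.2 he) f
      (((strands_perm hB).map _).mem_iff.2 hf)
    exact Relation.ReflTransGen.mono (fun a b hab => (strands_perm hB).mem_iff.1 hab) _ _ this
  card := h.card
  flow b hb := h.flow b (hB.mem_iff.2 hb)
  eq e he he' := h.eq e he (((strands_perm hB).map _).mem_iff.2 he')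
  zero := h.zero

theorem Calibration.of_strands {n : ℕ} {b b' : Box α} {B : List (Box α)} {p q : α → ℕ}
    {M : Finset α} (h : Calibration n (b :: B) p q M) (hs : b.strands = b'.strands)
    (hf : b.Flow p q → b'.Flow p q) : Calibration n (b' :: B) p q M := by
  have e : strands (b :: B) = strands (b' :: B) := by simp [hs]
  obtain ⟨h1, h2, h3, h4, h5, h6, h7⟩ := h
  simp only [sources, targets, Reach, e] at h1 h2 h3 h6
  refine ⟨h1, h2, h3, h4, fun c hc => ?_, h6, h7⟩
  rcases List.mem_cons.1 hc with rfl | hc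
  · exact hf (h5 b (by simp))
  · exact h5 c (by simp [hc])

theorem perm_sources_targets (B : List (Box α)) : (ports B).Perm (sources B ++ targets B) := by
  induction B with
  | nil => simp
  | cons b B ih =>
    have h1 : b.ports.Perm (b.strands.map Prod.fst ++ b.strands.map Prod.snd) := by
      classical
      refine List.perm_iff_count.2 fun z => ?_
      cases b with
      | bivalent e a b => cases e <;> simp [List.count_cons]; omega
      | crossing o u a c d b => cases o <;> cases u <;> simp [List.count_cons] <;> omega
    classical
    have h2 := List.perm_iff_count.1 ih
    have h3 := List.perm_iff_count.1 h1
    refine List.perm_iff_count.2 fun z => ?_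
    have h2 := h2 z
    have h3 := h3 z
    simp only [sources, targets, strands_cons, ports_cons, List.map_append, List.count_append] at *
    omega

theorem Calibration.paired [DecidableEq α] {n : ℕ} {B : List (Box α)} {p q : α → ℕ} {M : Finset α}
    (h : Calibration n B p q M) : Paired (ports B) := by
  have : Matches (sources B ++ targets B) (sources B) := ⟨h.nodup, h.perm.symm.append_left _⟩
  exact this.paired.perm (perm_sources_targets B).symm

theorem Calibration.snd_eq {n : ℕ} {B : List (Box α)} {p q : α → ℕ} {M : Finset α}
    (h : Calibration n B p q M) {f x x' : α} (hx : (f, x) ∈ strands B) (hx' : (f, x') ∈ strands B) :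
    x = x' := by
  have := List.inj_on_of_nodup_map h.nodup hx hx' rfl
  simpa using this

theorem exists_perm_cons {β : Type*} {b : β} {B : List β} (h : b ∈ B) :
    ∃ R, B.Perm (b :: R) := by
  obtain ⟨s, t, rfl⟩ := List.append_of_mem h
  exact ⟨s ++ t, List.perm_middle⟩

/-- If some number on an over-strand is positive, then one of these strands follows a bivalent box or
an under-strand. -/
theorem Calibration.exists_positive {n : ℕ} {B : List (Box α)} {p q : α → ℕ} {M : Finset α}
    (h : Calibration n B p q M) {o u : Bool} {a c d b : α} (ht : .crossing o u a c d b ∈ B)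
    (hp : 0 < p (dir o a d).1) :
    ∃ o u a c d b, .crossing o u a c d b ∈ B ∧ 0 < p (dir o a d).1 ∧
      ((∃ e a' b', .bivalent e a' b' ∈ B ∧ (dir e a' b').2 = (dir o a d).1) ∨
      ∃ o' u' a' c' d' b', .crossing o' u' a' c' d' b' ∈ B ∧ (dir u' b' c').2 = (dir o a d).1) := by
  by_contra hcon
  -- The beginnings of over-strands with a positive number. If the claim fails, the strand before
  -- such a beginning is again an over-strand, with the same positive number, so `Q` is closed under
  -- going backwards.
  let Q : Set α := {e | ∃ o u a c d b, Box.crossing o u a c d b ∈ B ∧ 0 < p (dir o a d).1 ∧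
    (dir o a d).1 = e}
  have hQ : ∀ i e, (i, e) ∈ strands B → e ∈ Q → i ∈ Q := by
    rintro i e hie ⟨o, u, a, c, d, b, hb, hpos, rfl⟩
    obtain ⟨t, htB, hit⟩ := mem_strands.1 hie
    have hM : (dir o a d).1 ∉ M := fun hM => by have := h.zero _ hM; omega
    have hs : (dir o a d).1 ∈ sources B :=
      List.mem_map.2 ⟨dir o a d, mem_strands.2 ⟨_, hb, by simp⟩, rfl⟩
    have heq := h.eq _ hM hs
    cases t with
    | bivalent e' a' b' =>
      simp only [Box.strands_bivalent, List.mem_singleton] at hit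
      exact absurd ⟨o, u, a, c, d, b, hb, hpos, .inl ⟨e', a', b', htB, by rw [← hit]⟩⟩ hcon
    | crossing o' u' a' c' d' b' =>
      simp only [Box.strands_crossing, List.mem_cons, List.not_mem_nil, or_false] at hit
      rcases hit with hit | hit
      · refine ⟨o', u', a', c', d', b', htB, ?_, by rw [← hit]⟩
        have := (h.flow _ htB).1
        rw [← hit] at this ⊢
        simp only at this ⊢
        omega
      · exact absurd ⟨o, u, a, c, d, b, hb, hpos, .inr ⟨o', u', a', c', d', b', htB,
          by rw [← hit]⟩⟩ hcon
  have h1 : dir o a d ∈ strands B := mem_strands.2 ⟨_, ht, by simp⟩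
  have h2 : dir u b c ∈ strands B := mem_strands.2 ⟨_, ht, by simp⟩
  have hr := h.reach (dir u b c).1 (List.mem_map_of_mem h2) (dir o a d).1 (List.mem_map_of_mem h1)
  have hback : ∀ {e f}, Reach B e f → f ∈ Q → e ∈ Q := by
    intro e f hef hf
    induction hef with
    | refl => exact hf
    | tail _ hab ih => exact ih (hQ _ _ hab hf)
  have h3 : (dir u b c).1 ∈ Q := hback hr ⟨o, u, a, c, d, b, ht, hp, rfl⟩
  obtain ⟨o', u', a', c', d', b', hb', -, he⟩ := h3
  have h4 : dir o' a' d' ∈ strands B := mem_strands.2 ⟨_, hb', by simp⟩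
  -- By connectedness `Q` contains the beginning of an under-strand. Only one strand begins there,
  -- so it is an over-strand and an under-strand at once: its number would be both constant and
  -- strictly increasing.
  have h5 := h.snd_eq (f := (dir u b c).1) (x := (dir o' a' d').2) (x' := (dir u b c).2)
    (by rw [← he]; exact h4) h2
  have h6 := (h.flow _ hb').1
  have h7 := (h.flow _ ht).2
  rw [h5, he] at h6
  omega

theorem Reach.lift {B B' : List (Box α)} (g : α → α)
    (hg : ∀ s ∈ strands B, Reach B' (g s.1) (g s.2)) {e f : α} (h : Reach B e f) :
    Reach B' (g e) (g f) := by
  induction h with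
  | refl => exact .refl
  | tail _ hab ih => exact ih.trans (hg _ hab)

/-- A bivalent box before an over-strand is dropped. -/
theorem Calibration.merge {n : ℕ} {R : List (Box α)} {p q : α → ℕ} {M : Finset α} {t t' v : Box α}
    {i e x : α} {s : List (α × α)} (h : Calibration n (v :: t :: R) p q M)
    (hv : v.strands = [(i, e)]) (ht : t.strands = (e, x) :: s) (ht' : t'.strands = (i, x) :: s)
    (hpos : 0 < p e) (hF : v.Flow p q → q e = p i) (hF' : p i = p e → t.Flow p q → t'.Flow p q) :
    Calibration n (t' :: R) p q M := by
  classical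
  have hie := hF (h.flow v (by simp))
  have hM : e ∉ M := fun hM => by have := h.zero _ hM; omega
  have hpe : p i = p e := by rw [← hie]; exact h.eq e hM (List.mem_map.2
    ⟨(e, x), by simp [ht], rfl⟩)
  have hnd := h.nodup
  have hpm := h.perm
  simp only [sources, targets, strands_cons, hv, ht, List.map_append, List.map_cons, List.cons_append,
    List.nil_append] at hnd hpm
  have hnd' := hpm.nodup_iff.1 hnd
  have hrest : (i :: (s.map Prod.fst ++ (strands R).map Prod.fst)).Nodup :=
    (List.nodup_cons.1 ((List.Perm.swap _ _ _).nodup_iff.1 hnd)).2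
  refine ⟨?_, ?_, ?_, h.card, ?_, ?_, h.zero⟩
  · simpa [sources, ht'] using hrest
  · have h2 := List.perm_iff_count.1 hpm
    refine List.perm_iff_count.2 fun z => ?_
    have h2 := h2 z
    simp only [sources, targets, strands_cons, ht', List.map_append, List.map_cons,
      List.cons_append, List.count_append, List.count_cons] at *
    omega
  · have hne : ∀ f ∈ sources (t' :: R), f ≠ e := by
      rintro f hf rfl
      have := (List.nodup_cons.1 ((List.Perm.swap _ _ _).nodup_iff.1 hnd)).1
      simp only [sources, strands_cons, ht', List.map_append, List.map_cons,
        List.cons_append] at hf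
      exact this hf
    have hsub : ∀ f ∈ sources (t' :: R), f ∈ sources (v :: t :: R) := by
      intro f hf
      simp only [sources, strands_cons, hv, ht, ht', List.map_append, List.map_cons,
        List.cons_append, List.nil_append, List.mem_cons, List.mem_append] at hf ⊢
      tauto
    intro f hf f' hf'
    -- Collapsing the dropped label `e` to `i` turns every walk through the old boxes into one
    -- through the new boxes.
    have := Reach.lift (B' := t' :: R) (fun z => if z = e then i else z) ?_
      (h.reach f (hsub f hf) f' (hsub f' hf'))
    · simpa [hne f hf, hne f' hf'] using this
    · intro s₀ hs₀
      rw [List.nodup_cons] at hnd'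
      simp only [strands_cons, hv, ht, List.cons_append, List.nil_append, List.mem_cons,
        List.mem_append] at hs₀
      rcases hs₀ with rfl | rfl | hs₀
      · simp only [ite_true]; split_ifs <;> exact .refl
      · have hxe : x ≠ e := by rintro rfl; exact hnd'.1 (by simp)
        simp only [ite_true, if_neg hxe]
        exact .single (by simp [ht'])
      · have h1 : s₀.1 ≠ e := by
          intro h1
          have := (List.nodup_cons.1 ((List.Perm.swap _ _ _).nodup_iff.1 hnd)).1
          refine this (List.mem_cons_of_mem _ ?_)
          rw [← List.map_append, ← h1]
          exact List.mem_map_of_mem (by simpa using hs₀)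
        have h2 : s₀.2 ≠ e := by
          intro h2
          refine hnd'.1 (List.mem_cons_of_mem _ ?_)
          rw [← List.map_append, ← h2]
          exact List.mem_map_of_mem (by simpa using hs₀)
        simp only [if_neg h1, if_neg h2]
        refine .single ?_
        simp only [strands_cons, ht', List.cons_append, List.mem_cons, List.mem_append]
        exact .inr hs₀
  · intro b hb
    rcases List.mem_cons.1 hb with rfl | hb
    · exact hF' hpe (h.flow t (by simp))
    · exact h.flow b (by simp [hb])
  · intro f hf hf'
    refine h.eq f hf ?_
    simp only [sources, strands_cons, hv, ht, ht', List.map_append, List.map_cons,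
      List.cons_append, List.nil_append, List.mem_cons, List.mem_append] at hf' ⊢
    tauto

theorem Box.Flow.congr {p q p' q' : α → ℕ} {b : Box α} (h : b.Flow p q)
    (hp : ∀ x ∈ b.ports, p' x = p x ∧ q' x = q x) : b.Flow p' q' := by
  cases b with
  | bivalent e a b =>
    simp only [Box.ports_bivalent, List.mem_cons, List.not_mem_nil, or_false, forall_eq_or_imp,
      forall_eq] at hp
    cases e <;> simp_all [Box.Flow]
  | crossing o u a c d b =>
    simp only [Box.ports_crossing, List.mem_cons, List.not_mem_nil, or_false, forall_eq_or_imp,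
      forall_eq] at hp
    cases o <;> cases u <;> simp_all [Box.Flow]

end

/-! ### Invariance of the numbers under a push -/

section

set_option linter.unusedSimpArgs false

variable {α : Type*}

/-- The numbers of the boxes after a crossing has been moved through another one. -/
theorem Calibration.push [DecidableEq α] {n : ℕ} {R : List (Box α)} {p q : α → ℕ} {M : Finset α}
    {o u : Bool} {a b y a' b' y' y₁ a₂ a₃ b₂ b₃ y₂ : α}
    (h : Calibration n (.crossing o true a y₁ a' y :: .crossing true u y₁ b' y' b :: R) p q M)
    (hM : y₁ ∉ M) (hn : [a₂, a₃, b₂, b₃, y₂].Nodup)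
    (hf : ∀ c ∈ [a₂, a₃, b₂, b₃, y₂], c ∉ M ∧
      c ∉ ports (.crossing o true a y₁ a' y :: .crossing true u y₁ b' y' b :: R)) :
    ∃ p' q', Calibration n (.crossing o (!u) a b a₂ b₂ :: .crossing true u y b₃ y₂ b₂ ::
        .crossing o u a₂ b' a₃ b₃ :: .crossing o true a₃ y' a' y₂ :: R) p' q' M ∧
      (∀ c ∈ ports (.crossing o true a y₁ a' y :: .crossing true u y₁ b' y' b :: R),
        p' c = p c ∧ q' c = q c) ∧
      p y₁ = p y + 1 + 2 * p (dir o a a').1 ∧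
      p' a₂ = p (dir o a a').1 ∧ p' a₃ = p (dir o a a').1 := by
  set B := Box.crossing o true a y₁ a' y :: .crossing true u y₁ b' y' b :: R with hB
  obtain ⟨f1, f2, f3, f4, f5⟩ : ((a₂ ∉ M ∧ a₂ ∉ ports B) ∧ (a₃ ∉ M ∧ a₃ ∉ ports B) ∧
      (b₂ ∉ M ∧ b₂ ∉ ports B) ∧ (b₃ ∉ M ∧ b₃ ∉ ports B) ∧ (y₂ ∉ M ∧ y₂ ∉ ports B)) := by
    simpa using hf
  have hflow1 := h.flow (.crossing o true a y₁ a' y) (by simp [hB])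
  have hflow2 := h.flow (.crossing true u y₁ b' y' b) (by simp [hB])
  have hy := h.eq y₁ hM (by simp [hB, sources])
  simp only [Box.Flow, dir_true] at hflow1 hflow2
  set s := p (dir o a a').1 with hs
  set r := p y with hr
  set β := p (dir u b b').1 with hβ
  -- the new numbers
  set w : α → ℕ → ℕ := fun z k => if z = a₂ then s else if z = a₃ then s else if z = y₂ then r else
    if z = b₂ then (if u then β + 1 + 2 * s else β + 1 + 2 * s + (1 + 2 * r)) else
    if z = b₃ then (if u then β + 1 + 2 * s + (1 + 2 * r) else β + 1 + 2 * s) else k with hw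
  simp only [List.nodup_cons, List.mem_cons, List.not_mem_nil, or_false, not_or] at hn
  obtain ⟨⟨n1, n2, n3, n4⟩, ⟨n5, n6, n7⟩, ⟨n8, n9⟩, n10, -⟩ := hn
  have w1 : ∀ k, w a₂ k = s := fun k => by simp [hw]
  have w2 : ∀ k, w a₃ k = s := fun k => by simp [hw]
  have w3 : ∀ k, w y₂ k = r := fun k => by simp [hw, Ne.symm n4, Ne.symm n7]
  have w4 : ∀ k, w b₂ k = if u then β + 1 + 2 * s else β + 1 + 2 * s + (1 + 2 * r) := fun k => by
    simp [hw, Ne.symm n2, Ne.symm n5, n9]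
  have w5 : ∀ k, w b₃ k = if u then β + 1 + 2 * s + (1 + 2 * r) else β + 1 + 2 * s := fun k => by
    simp [hw, Ne.symm n3, Ne.symm n6, n10, Ne.symm n8]
  have w0 : ∀ c ∈ ports B, ∀ k, w c k = k := by
    intro c hc k
    have e1 : c ≠ a₂ := by rintro rfl; exact f1.2 hc
    have e2 : c ≠ a₃ := by rintro rfl; exact f2.2 hc
    have e3 : c ≠ b₂ := by rintro rfl; exact f3.2 hc
    have e4 : c ≠ b₃ := by rintro rfl; exact f4.2 hc
    have e5 : c ≠ y₂ := by rintro rfl; exact f5.2 hc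
    simp [hw, e1, e2, e3, e4, e5]
  have wa := w0 a (by simp [hB])
  have wa' := w0 a' (by simp [hB])
  have wb := w0 b (by simp [hB])
  have wb' := w0 b' (by simp [hB])
  have wy := w0 y (by simp [hB])
  have wy' := w0 y' (by simp [hB])
  set B' := Box.crossing o (!u) a b a₂ b₂ :: .crossing true u y b₃ y₂ b₂ ::
        .crossing o u a₂ b' a₃ b₃ :: .crossing o true a₃ y' a' y₂ :: R with hB'
  have hS : (sources B').Perm ([a₂, a₃, b₂, b₃, y₂] ++ ((dir o a a').1 :: y :: (dir u b b').1 ::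
      sources R)) := by
    refine List.perm_iff_count.2 fun z => ?_
    cases o <;> cases u <;>
    simp only [hB', sources, strands_cons, Box.strands_crossing, dir_true, dir_false, Bool.not_true,
      Bool.not_false, List.map_append, List.map_cons, List.map_nil, List.cons_append,
      List.nil_append, List.count_cons] <;> omega
  have hT : (targets B').Perm ([a₂, a₃, b₂, b₃, y₂] ++ ((dir o a a').2 :: y' :: (dir u b b').2 ::
      targets R)) := by
    refine List.perm_iff_count.2 fun z => ?_
    cases o <;> cases u <;>
    simp only [hB', targets, strands_cons, Box.strands_crossing, dir_true, dir_false, Bool.not_true,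
      Bool.not_false, List.map_append, List.map_cons, List.map_nil, List.cons_append,
      List.nil_append, List.count_cons] <;> omega
  have hS0 : (sources B).Perm (y₁ :: ((dir o a a').1 :: y :: (dir u b b').1 :: sources R)) := by
    refine List.perm_iff_count.2 fun z => ?_
    simp only [hB, sources, strands_cons, Box.strands_crossing, dir_true, List.map_append,
      List.map_cons, List.map_nil, List.cons_append, List.nil_append, List.count_cons]
    omega
  have hT0 : (targets B).Perm (y₁ :: ((dir o a a').2 :: y' :: (dir u b b').2 :: targets R)) := by
    refine List.perm_iff_count.2 fun z => ?_
    simp only [hB, targets, strands_cons, Box.strands_crossing, dir_true, List.map_append,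
      List.map_cons, List.map_nil, List.cons_append, List.nil_append, List.count_cons]
    omega
  have hnd := hS0.nodup_iff.1 h.nodup
  have hports : ∀ c ∈ sources B, c ∈ ports B := fun c hc =>
    (perm_sources_targets B).mem_iff.2 (List.mem_append_left _ hc)
  refine ⟨fun z => w z (p z), fun z => w z (q z), ⟨?_, ?_, ?_, h.card, ?_, ?_, ?_⟩,
    fun c hc => ⟨w0 c hc _, w0 c hc _⟩, by omega, w1 _, w2 _⟩
  · refine hS.nodup_iff.2 (List.nodup_append'.2 ⟨?_, (List.nodup_cons.1 hnd).2, ?_⟩)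
    · simp; tauto
    · intro c hc hc'
      exact (hf c hc).2 (hports c (hS0.mem_iff.2 (List.mem_cons_of_mem _ hc')))
  · refine hS.trans (List.Perm.trans ?_ hT.symm)
    exact List.Perm.append_left _ (hS0.symm.trans (h.perm.trans hT0)).cons_inv
  · -- connectedness
    have A1 : Reach B' (dir o a a').1 a₂ ∧ Reach B' a₂ (dir o a a').2 ∧
        Reach B' (dir o a a').1 a₃ ∧ Reach B' a₃ (dir o a a').2 := by
      cases o
      · have h1 : Reach B' a' a₃ := .single (by simp [hB'])
        have h2 : Reach B' a₃ a₂ := .single (by simp [hB'])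
        have h3 : Reach B' a₂ a := .single (by simp [hB'])
        exact ⟨h1.trans h2, h3, h1, h2.trans h3⟩
      · have h1 : Reach B' a a₂ := .single (by simp [hB'])
        have h2 : Reach B' a₂ a₃ := .single (by simp [hB'])
        have h3 : Reach B' a₃ a' := .single (by simp [hB'])
        exact ⟨h1, h2.trans h3, h1.trans h2, h3⟩
    have A2 : Reach B' (dir u b b').1 b₂ ∧ Reach B' b₂ (dir u b b').2 ∧
        Reach B' (dir u b b').1 b₃ ∧ Reach B' b₃ (dir u b b').2 := by
      cases u
      · have h1 : Reach B' b' b₃ := .single (by simp [hB'])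
        have h2 : Reach B' b₃ b₂ := .single (by simp [hB'])
        have h3 : Reach B' b₂ b := .single (by simp [hB'])
        exact ⟨h1.trans h2, h3, h1, h2.trans h3⟩
      · have h1 : Reach B' b b₂ := .single (by simp [hB'])
        have h2 : Reach B' b₂ b₃ := .single (by simp [hB'])
        have h3 : Reach B' b₃ b' := .single (by simp [hB'])
        exact ⟨h1, h2.trans h3, h1.trans h2, h3⟩
    have A3 : Reach B' y y₂ := .single (by simp [hB'])
    have A4 : Reach B' y₂ y' := .single (by simp [hB'])
    -- The label `y₁` disappears, so old walks are transported with `y'` in its place. The new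
    -- labels are then connected to the old ones along their own strands.
    set g : α → α := fun z => if z = y₁ then y' else z with hg
    have g0 : ∀ z, z ≠ y₁ → g z = z := fun z hz => by simp [hg, hz]
    have hnd' := List.nodup_cons.1 (hT0.nodup_iff.1 (h.perm.nodup_iff.1 h.nodup))
    simp only [List.mem_cons, not_or] at hnd'
    obtain ⟨⟨k1, k2, k3, k4⟩, -⟩ := hnd'
    have hnd2 := (List.nodup_cons.1 hnd).1
    simp only [List.mem_cons, not_or] at hnd2
    obtain ⟨m1, m2, m3, m4⟩ := hnd2
    have G : ∀ {e f}, Reach B e f → Reach B' (g e) (g f) := by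
      refine Reach.lift g ?_
      intro s₀ hs₀
      simp only [hB, strands_cons, Box.strands_crossing, dir_true, List.cons_append,
        List.nil_append, List.mem_cons] at hs₀
      rcases hs₀ with rfl | rfl | rfl | rfl | hs₀
      · rw [g0 _ (Ne.symm m1), g0 _ (Ne.symm k1)]
        exact A1.1.trans A1.2.1
      · rw [g0 _ (Ne.symm m2)]
        simp only [hg, ite_true]
        exact A3.trans A4
      · rw [g0 y' (Ne.symm k2)]
        simp only [hg, ite_true]
        exact .refl
      · rw [g0 _ (Ne.symm m3), g0 _ (Ne.symm k3)]
        exact A2.1.trans A2.2.1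
      · rw [g0, g0]
        · refine .single ?_
          simp only [hB', strands_cons, List.mem_append]
          tauto
        · rintro h1; exact k4 (h1 ▸ List.mem_map_of_mem hs₀)
        · rintro h1; exact m4 (h1 ▸ List.mem_map_of_mem hs₀)
    have in1 : (dir o a a').1 ∈ sources B := hS0.mem_iff.2 (by simp)
    have in2 : (dir o a a').2 ∈ sources B := h.perm.mem_iff.2 (hT0.mem_iff.2 (by simp))
    have in3 : (dir u b b').1 ∈ sources B := hS0.mem_iff.2 (by simp)
    have in4 : (dir u b b').2 ∈ sources B := h.perm.mem_iff.2 (hT0.mem_iff.2 (by simp))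
    have in5 : y ∈ sources B := hS0.mem_iff.2 (by simp)
    have in6 : y' ∈ sources B := h.perm.mem_iff.2 (hT0.mem_iff.2 (by simp))
    have key : ∀ e ∈ sources B', (∃ e' ∈ sources B, Reach B' e (g e')) ∧
        ∃ e' ∈ sources B, Reach B' (g e') e := by
      intro e he
      rcases List.mem_append.1 (hS.mem_iff.1 he) with he | he
      · simp only [List.mem_cons, List.not_mem_nil, or_false] at he
        rcases he with rfl | rfl | rfl | rfl | rfl
        · exact ⟨⟨_, in2, by rw [g0 _ (Ne.symm k1)]; exact A1.2.1⟩,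
            ⟨_, in1, by rw [g0 _ (Ne.symm m1)]; exact A1.1⟩⟩
        · exact ⟨⟨_, in2, by rw [g0 _ (Ne.symm k1)]; exact A1.2.2.2⟩,
            ⟨_, in1, by rw [g0 _ (Ne.symm m1)]; exact A1.2.2.1⟩⟩
        · exact ⟨⟨_, in4, by rw [g0 _ (Ne.symm k3)]; exact A2.2.1⟩,
            ⟨_, in3, by rw [g0 _ (Ne.symm m3)]; exact A2.1⟩⟩
        · exact ⟨⟨_, in4, by rw [g0 _ (Ne.symm k3)]; exact A2.2.2.2⟩,
            ⟨_, in3, by rw [g0 _ (Ne.symm m3)]; exact A2.2.2.1⟩⟩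
        · exact ⟨⟨_, in6, by rw [g0 _ (Ne.symm k2)]; exact A4⟩,
            ⟨_, in5, by rw [g0 _ (Ne.symm m2)]; exact A3⟩⟩
      · have h1 : e ≠ y₁ := by rintro rfl; exact (List.nodup_cons.1 hnd).1 he
        have h2 : e ∈ sources B := hS0.mem_iff.2 (List.mem_cons_of_mem _ he)
        exact ⟨⟨e, h2, by rw [g0 e h1]; exact .refl⟩, ⟨e, h2, by rw [g0 e h1]; exact .refl⟩⟩
    intro e he f hf'
    obtain ⟨⟨e', he', h1⟩, -⟩ := key e he
    obtain ⟨-, f', hf'', h2⟩ := key f hf'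
    exact h1.trans ((G (h.reach e' he' f' hf'')).trans h2)
  · intro t ht
    simp only [hB', List.mem_cons] at ht
    rcases ht with rfl | rfl | rfl | rfl | ht
    · cases o <;> cases u <;>
      simp only [Box.Flow, dir_true, dir_false, Bool.not_true, Bool.not_false, w1, w2, w3, w4, w5,
        wa, wa', wb, wb', wy, wy', if_true, Bool.false_eq_true, if_false, true_and] at hflow1 hflow2 hs hβ ⊢ <;>
      omega
    · cases o <;> cases u <;>
      simp only [Box.Flow, dir_true, dir_false, Bool.not_true, Bool.not_false, w1, w2, w3, w4, w5,
        wa, wa', wb, wb', wy, wy', if_true, Bool.false_eq_true, if_false, true_and] at hflow1 hflow2 hs hβ ⊢ <;>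
      omega
    · cases o <;> cases u <;>
      simp only [Box.Flow, dir_true, dir_false, Bool.not_true, Bool.not_false, w1, w2, w3, w4, w5,
        wa, wa', wb, wb', wy, wy', if_true, Bool.false_eq_true, if_false, true_and] at hflow1 hflow2 hs hβ ⊢ <;>
      omega
    · cases o <;> cases u <;>
      simp only [Box.Flow, dir_true, dir_false, Bool.not_true, Bool.not_false, w1, w2, w3, w4, w5,
        wa, wa', wb, wb', wy, wy', if_true, Bool.false_eq_true, if_false, true_and] at hflow1 hflow2 hs hβ ⊢ <;>
      omega
    · refine (h.flow t (by simp [hB, ht])).congr fun x hx => ?_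
      have : x ∈ ports B := by
        simp only [hB, ports_cons, List.mem_append]
        exact .inr (.inr (List.mem_flatMap.2 ⟨t, ht, hx⟩))
      exact ⟨w0 x this _, w0 x this _⟩
  · intro e he he'
    rcases List.mem_append.1 (hS.mem_iff.1 he') with he' | he'
    · simp only [List.mem_cons, List.not_mem_nil, or_false] at he'
      rcases he' with rfl | rfl | rfl | rfl | rfl <;> simp only [w1, w2, w3, w4, w5]
    · have h2 : e ∈ sources B := hS0.mem_iff.2 (List.mem_cons_of_mem _ he')
      simp only [w0 e (hports e h2)]
      exact h.eq e he h2
  · intro e he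
    have : w e (p e) = p e := by
      have e1 : e ≠ a₂ := by rintro rfl; exact f1.1 he
      have e2 : e ≠ a₃ := by rintro rfl; exact f2.1 he
      have e3 : e ≠ b₂ := by rintro rfl; exact f3.1 he
      have e4 : e ≠ b₃ := by rintro rfl; exact f4.1 he
      have e5 : e ≠ y₂ := by rintro rfl; exact f5.1 he
      simp [hw, e1, e2, e3, e4, e5]
    simp only [this]
    exact h.zero e he

end

/-! ### Half turns of boxes, and sorting by descent -/

section

variable {α : Type*}

/-- The box of a crossing, turned around. -/
def Box.turn : Box α → Box α
  | bivalent e a b => bivalent e a b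
  | crossing o u a c d b => crossing (!o) (!u) d b a c

theorem Box.strands_turn (b : Box α) : b.turn.strands = b.strands := by
  rcases b with _ | ⟨_ | _, _ | _, _⟩ <;> rfl

theorem Box.Flow.turn {p q : α → ℕ} {b : Box α} (h : b.Flow p q) : b.turn.Flow p q := by
  rcases b with _ | ⟨_ | _, _ | _, _⟩ <;> exact h

/-- The number of steps needed to move all crossings back. -/
def Box.weight (p : α → ℕ) : Box α → ℕ
  | bivalent _ _ _ => 1
  | crossing o _ a _ d _ => 4 * p (dir o a d).1

theorem Box.weight_turn (p : α → ℕ) (b : Box α) : b.turn.weight p = b.weight p := by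
  rcases b with _ | ⟨_ | _, _ | _, _⟩ <;> rfl

/-- The sum of the weights of the boxes. -/
def weight (p : α → ℕ) (B : List (Box α)) : ℕ := (B.map (Box.weight p)).sum

@[simp] theorem weight_cons (p : α → ℕ) (b : Box α) (B : List (Box α)) :
    weight p (b :: B) = b.weight p + weight p B := by simp [weight]

theorem weight_perm (p : α → ℕ) {B B' : List (Box α)} (h : B.Perm B') :
    weight p B = weight p B' := (h.map _).sum_eq

theorem weight_congr {p p' : α → ℕ} {B : List (Box α)} (h : ∀ x ∈ ports B, p' x = p x) :
    weight p' B = weight p B := by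
  unfold weight
  congr 1
  refine List.map_congr_left fun b hb => ?_
  have h' : ∀ x ∈ b.ports, p' x = p x := fun x hx => h x (List.mem_flatMap.2 ⟨b, hb, hx⟩)
  rcases b with _ | ⟨_ | _, _ | _, _⟩ <;> simp_all [Box.weight]

variable [DecidableEq α]

theorem diagram_perm_nil {B B' : List (Box α)} (hB : B.Perm B') (h : Paired (ports B)) :
    E 0 (diagram [] B) (diagram [] B') := diagram_perm hB (l := []) h

/-- As the number at `y` is positive, `y` is unmarked, and both sides of the bivalent box have the
same number. Merging therefore loses exactly the weight 1 of this box. -/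
theorem Calibration.step_merge {n : ℕ} {R : List (Box α)} {p q : α → ℕ} {M : Finset α}
    {e u : Bool} {a b y b' y' b'' : α}
    (h : Calibration n (.bivalent e a b :: .crossing true u y b' y' b'' :: R) p q M)
    (hy : (dir e a b).2 = y) (hp : 0 < p y) :
    ∃ B' p' q', Calibration n B' p' q' M ∧
      E 0 (diagram [] (.bivalent e a b :: .crossing true u y b' y' b'' :: R)) (diagram [] B') ∧ B' ≠ [] ∧
      weight p' B' < weight p (.bivalent e a b :: .crossing true u y b' y' b'' :: R) := by
  subst hy
  have h1 : Calibration n (.crossing true u (dir e a b).1 b' y' b'' :: R) p q M := by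
    refine h.merge (v := .bivalent e a b) (t := .crossing true u (dir e a b).2 b' y' b'')
      (i := (dir e a b).1) (e := (dir e a b).2) (x := y') (s := [dir u b'' b']) rfl rfl rfl hp
      (fun hF => hF) ?_
    intro he hF
    simp only [Box.Flow, dir_true] at hF ⊢
    rw [he]; exact hF
  have he : p (dir e a b).1 = p (dir e a b).2 := by
    have hF := h.flow (.bivalent e a b) (by simp)
    rw [Box.Flow] at hF
    rw [← hF]
    refine h.eq _ (fun hM => ?_) ?_
    · have := h.zero _ hM; omega
    · simp [sources]
  refine ⟨_, p, q, h1, ?_, by simp, ?_⟩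
  · cases e with
    | true =>
      exact diagram_merge_list' (l := []) (p₁ := []) (p₂ := [b', y', b'']) (B₁ := []) (B₂ := R)
        (a := b) (b := a) true (t := .crossing true u b b' y' b'')
        (t' := .crossing true u a b' y' b'') (.refl _) rfl rfl rfl h.paired
    | false =>
      exact diagram_merge_list (l := []) (p₁ := []) (p₂ := [b', y', b'']) (B₁ := []) (B₂ := R)
        (a := a) (b := b) false (t := .crossing true u a b' y' b'')
        (t' := .crossing true u b b' y' b'') (.refl _) rfl rfl rfl h.paired
  · simp only [weight_cons, Box.weight, dir_true, he]
    omega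

variable [Infinite α]

theorem diagram_turn {b : Box α} {B : List (Box α)} (h : Paired (ports (b :: B))) :
    E 0 (diagram [] (b :: B)) (diagram [] (b.turn :: B)) := by
  cases b with
  | bivalent => exact TE.refl _
  | crossing o u a c d b => exact diagram_rotate o u _ _ (l := []) h

/-- A box may be turned so that a given strand becomes an upward over-strand or under-strand. -/
theorem Calibration.turn {n : ℕ} {b : Box α} {B : List (Box α)} {p q : α → ℕ} {M : Finset α}
    (h : Calibration n (b :: B) p q M) : Calibration n (b.turn :: B) p q M ∧
      E 0 (diagram [] (b :: B)) (diagram [] (b.turn :: B)) ∧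
      weight p (b.turn :: B) = weight p (b :: B) :=
  ⟨h.of_strands b.strands_turn.symm Box.Flow.turn, diagram_turn h.paired, by
    simp [Box.weight_turn]⟩

theorem Calibration.turn_over {n : ℕ} {o u : Bool} {a c d b : α} {B : List (Box α)} {p q : α → ℕ}
    {M : Finset α} (h : Calibration n (.crossing o u a c d b :: B) p q M) :
    ∃ u' a' c' d' b', Calibration n (.crossing true u' a' c' d' b' :: B) p q M ∧
      E 0 (diagram [] (.crossing o u a c d b :: B))
        (diagram [] (.crossing true u' a' c' d' b' :: B)) ∧
      weight p (.crossing true u' a' c' d' b' :: B) = weight p (.crossing o u a c d b :: B) ∧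
      a' = (dir o a d).1 := by
  cases o with
  | true => exact ⟨u, a, c, d, b, h, TE.refl _, rfl, rfl⟩
  | false => exact ⟨_, _, _, _, _, h.turn.1, h.turn.2.1, h.turn.2.2, rfl⟩

theorem Calibration.turn_under {n : ℕ} {o u : Bool} {a c d b : α} {B : List (Box α)} {p q : α → ℕ}
    {M : Finset α} (h : Calibration n (.crossing o u a c d b :: B) p q M) :
    ∃ o' a' c' d' b', Calibration n (.crossing o' true a' c' d' b' :: B) p q M ∧
      E 0 (diagram [] (.crossing o u a c d b :: B))
        (diagram [] (.crossing o' true a' c' d' b' :: B)) ∧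
      weight p (.crossing o' true a' c' d' b' :: B) = weight p (.crossing o u a c d b :: B) ∧
      c' = (dir u b c).2 := by
  cases u with
  | true => exact ⟨o, a, c, d, b, h, TE.refl _, rfl, rfl⟩
  | false => exact ⟨_, _, _, _, _, h.turn.1, h.turn.2.1, h.turn.2.2, rfl⟩

/-- Let `s` and `r` be the numbers with which the strands of `a` and `y` arrive. The weight of the
two crossings is 4s + 4(r + 1 + 2s); that of the four new ones is 4s + 4r + 4s + 4s, which is
smaller by 4. -/
theorem Calibration.step_push {n : ℕ} {R : List (Box α)} {p q : α → ℕ} {M : Finset α}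
    {o u : Bool} {a b y a' b' y' y₁ : α}
    (h : Calibration n (.crossing o true a y₁ a' y :: .crossing true u y₁ b' y' b :: R) p q M)
    (hM : y₁ ∉ M) :
    ∃ B' p' q', Calibration n B' p' q' M ∧
      E 0 (diagram [] (.crossing o true a y₁ a' y :: .crossing true u y₁ b' y' b :: R))
        (diagram [] B') ∧ B' ≠ [] ∧
      weight p' B' < weight p (.crossing o true a y₁ a' y :: .crossing true u y₁ b' y' b :: R) := by
  obtain ⟨r, hr1, hr2, hr3⟩ := exists_fresh_list (M.toList ++
    ports (.crossing o true a y₁ a' y :: .crossing true u y₁ b' y' b :: R)) 5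
  match r, hr1 with
  | [a₂, a₃, b₂, b₃, y₂], _ =>
  have hr4 : ∀ c ∈ [a₂, a₃, b₂, b₃, y₂], c ∉ M ∧
      c ∉ ports (.crossing o true a y₁ a' y :: .crossing true u y₁ b' y' b :: R) := by
    intro c hc
    have := hr3 c hc
    rw [List.mem_append, not_or, Finset.mem_toList] at this
    exact this
  obtain ⟨p', q', h1, h2, h3, h4, h5⟩ := h.push hM hr2 hr4
  refine ⟨_, p', q', h1, diagram_push _ _ _ _ _ _ _ _ _ _ _ _ h.paired hr2
    fun c hc => (hr4 c hc).2, by simp, ?_⟩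
  have hR : weight p' R = weight p R := weight_congr fun x hx => (h2 x (by simp [hx])).1
  have e1 := (h2 a (by simp)).1
  have e2 := (h2 a' (by simp)).1
  have e3 := (h2 y (by simp)).1
  simp only [weight_cons, Box.weight, hR, dir_true]
  cases o <;> simp only [dir_true, dir_false] at * <;> omega

theorem exists_perm_cons_cons {β : Type*} {b c : β} {B : List β} (hb : b ∈ B) (hc : c ∈ B)
    (h : b ≠ c) : ∃ R, B.Perm (b :: c :: R) := by
  obtain ⟨R, hR⟩ := exists_perm_cons hb
  have : c ∈ R := by simpa [h.symm] using hR.mem_iff.1 hc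
  obtain ⟨R', hR'⟩ := exists_perm_cons this
  exact ⟨R', hR.trans (hR'.cons _)⟩

/-- The over-strand found by `Calibration.exists_positive` follows a bivalent box, which is merged,
or an under-strand, through which it is pushed. Half turns first make the strands in question run
upwards, as these two moves assume. -/
theorem Calibration.step {n : ℕ} {B : List (Box α)} {p q : α → ℕ} {M : Finset α}
    (h : Calibration n B p q M) {o u : Bool} {a c d b : α} (ht : .crossing o u a c d b ∈ B)
    (hp : 0 < p (dir o a d).1) :
    ∃ B' p' q', Calibration n B' p' q' M ∧ E 0 (diagram [] B) (diagram [] B') ∧ B' ≠ [] ∧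
      weight p' B' < weight p B := by
  obtain ⟨o, u, a, c, d, b, ht, hp, hcase⟩ := h.exists_positive ht hp
  have hM : (dir o a d).1 ∉ M := fun hM => by have := h.zero _ hM; omega
  have hs : (dir o a d).1 ∈ sources B :=
    List.mem_map.2 ⟨dir o a d, mem_strands.2 ⟨_, ht, by simp⟩, rfl⟩
  rcases hcase with ⟨e, a', b', hv, he⟩ | ⟨o', u', a', c', d', b', hv, he⟩
  · obtain ⟨R, hR⟩ := exists_perm_cons_cons ht hv (by simp)
    have h1 := h.of_perm hR
    obtain ⟨u₁, a₁, c₁, d₁, b₁, h2, h3, h4, rfl⟩ := h1.turn_over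
    have h5 := h2.of_perm (List.Perm.swap _ _ _)
    obtain ⟨B', p', q', h6, h7, hne, h8⟩ := h5.step_merge he hp
    refine ⟨B', p', q', h6, ?_, hne, ?_⟩
    · exact (diagram_perm_nil hR h.paired).trans (h3.trans
        ((diagram_perm_nil (List.Perm.swap _ _ _) h2.paired).trans h7))
    · rw [weight_perm p hR, ← h4]
      rwa [weight_perm p (List.Perm.swap _ _ _)] at h8
  · have hne : Box.crossing o' u' a' c' d' b' ≠ .crossing o u a c d b := by
      intro hne
      rw [hne] at hv
      injection hne with e1 e2 e3 e4 e5 e6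
      subst e1 e2 e3 e4 e5 e6
      have h1 := (h.flow _ ht).2
      have h2 := h.eq _ hM hs
      rw [he] at h1
      omega
    obtain ⟨R, hR⟩ := exists_perm_cons_cons hv ht hne
    have h1 := h.of_perm hR
    obtain ⟨o₁, a₁, c₁, d₁, b₁, h2, h3, h4, h5⟩ := h1.turn_under
    have h6 := h2.of_perm (List.Perm.swap _ _ _)
    obtain ⟨u₂, a₂, c₂, d₂, b₂, h7, h8, h9, h10⟩ := h6.turn_over
    have h11 := h7.of_perm (List.Perm.swap _ _ _)
    have h12 : a₂ = c₁ := by rw [h10, h5, he]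
    subst h12
    rw [← h10] at hM
    obtain ⟨B', p', q', h13, h14, hne, h15⟩ := h11.step_push hM
    refine ⟨B', p', q', h13, ?_, hne, ?_⟩
    · exact (diagram_perm_nil hR h.paired).trans (h3.trans
        ((diagram_perm_nil (List.Perm.swap _ _ _) h2.paired).trans (h8.trans
        ((diagram_perm_nil (List.Perm.swap _ _ _) h7.paired).trans h14))))
    · rw [weight_perm p hR, ← h4, weight_perm p (List.Perm.swap _ _ _), ← h9]
      rwa [weight_perm p (List.Perm.swap _ _ _)] at h15

/-- All over-strands can be moved back so that they follow a marked label or an over-strand. -/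
theorem Calibration.exists_sorted {n : ℕ} {M : Finset α} {B : List (Box α)} {p q : α → ℕ}
    (h : Calibration n B p q M) (hne : B ≠ []) :
    ∃ B' p' q', Calibration n B' p' q' M ∧ E 0 (diagram [] B) (diagram [] B') ∧ B' ≠ [] ∧
      ∀ o u a c d b, .crossing o u a c d b ∈ B' → p' (dir o a d).1 = 0 := by
  induction hk : weight p B using Nat.strong_induction_on generalizing B p q with
  | _ k ih =>
    by_cases hz : ∀ o u a c d b, .crossing o u a c d b ∈ B → p (dir o a d).1 = 0
    · exact ⟨B, p, q, h, TE.refl _, hne, hz⟩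
    · push Not at hz
      obtain ⟨o, u, a, c, d, b, ht, hp⟩ := hz
      obtain ⟨B₁, p₁, q₁, h1, h2, hne', h3⟩ := h.step ht (Nat.pos_of_ne_zero hp)
      obtain ⟨B₂, p₂, q₂, h4, h5, h6⟩ := ih _ (hk ▸ h3) h1 hne' rfl
      exact ⟨B₂, p₂, q₂, h4, h2.trans h5, h6⟩

end

section

/-! ### Cycles -/

theorem exists_eq_of_connected {β : Type*} {f : β → β} {O : Set β} (hf : ∀ x ∈ O, f x ∈ O)
    (hc : ∀ x ∈ O, ∀ y ∈ O, ∃ n : ℕ, f^[n] x = y) : ∀ x ∈ O, ∃ z ∈ O, f z = x := by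
  intro x hx
  obtain ⟨n, hn⟩ := hc _ (hf x hx) x hx
  refine ⟨f^[n] x, ?_, by rwa [← Function.iterate_succ_apply' f, Function.iterate_succ_apply]⟩
  exact (Set.MapsTo.iterate (fun x hx => hf x hx) n) hx

/-- Some `x` recurs after `n + 1` steps, and `O` is the orbit of `x`, so its first `n + 1` iterates
exhaust `O`. Starting the return from `f x` guarantees a positive period. -/
theorem finite_of_connected {β : Type*} {f : β → β} {O : Set β} (hf : ∀ x ∈ O, f x ∈ O)
    (hc : ∀ x ∈ O, ∀ y ∈ O, ∃ n : ℕ, f^[n] x = y) : O.Finite := by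
  rcases O.eq_empty_or_nonempty with rfl | ⟨x, hx⟩
  · exact Set.finite_empty
  obtain ⟨n, hn⟩ := hc _ (hf x hx) x hx
  rw [← Function.iterate_succ_apply] at hn
  refine ((Finset.range (n + 1)).finite_toSet.image fun i => f^[i] x).subset fun y hy => ?_
  obtain ⟨m, rfl⟩ := hc x hx y hy
  refine ⟨m % (n + 1), by simpa using Nat.le_of_lt_succ (Nat.mod_lt m n.succ_pos), ?_⟩
  exact Function.IsPeriodicPt.iterate_mod_apply hn m

theorem injOn_of_connected {β : Type*} {f : β → β} {O : Set β} (hf : ∀ x ∈ O, f x ∈ O)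
    (hc : ∀ x ∈ O, ∀ y ∈ O, ∃ n : ℕ, f^[n] x = y) : Set.InjOn f O := by
  have hs : Set.SurjOn f O O := exists_eq_of_connected hf hc
  exact (Set.Finite.surjOn_iff_bijOn_of_mapsTo (finite_of_connected hf hc) hf).1 hs |>.injOn

/-- A recursive equation where the value at each point is determined by the values at points of
smaller rank has a solution. -/
theorem exists_fixed {β γ : Type*} [Inhabited γ] (r : β → ℕ) (F : (β → γ) → β → γ)
    (hF : ∀ x f g, (∀ y, r y < r x → f y = g y) → F f x = F g x) : ∃ p, ∀ x, p x = F p x := by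
  -- Iterate `F` from a constant function: the value at `x` no longer changes after `r x + 1` steps.
  let P : ℕ → β → γ := fun i => F^[i] fun _ => default
  have hP : ∀ i, P (i + 1) = F (P i) := fun i => Function.iterate_succ_apply' F i _
  have key : ∀ i y, r y < i → P i y = P (r y + 1) y := by
    intro i
    induction i using Nat.strong_induction_on with
    | _ i ih =>
      intro y hy
      obtain ⟨i, rfl⟩ : ∃ j, i = j + 1 := ⟨i - 1, by omega⟩
      rw [hP, hP]
      rcases (Nat.lt_succ_iff.1 hy).lt_or_eq with h | h
      · refine hF _ _ _ fun z hz => ?_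
        rw [ih i (by omega) z (by omega), ih (r y) (by omega) z hz]
      · rw [h]
  refine ⟨fun x => P (r x + 1) x, fun x => ?_⟩
  change P (r x + 1) x = _
  rw [hP]
  exact hF _ _ _ fun y hy => key _ _ hy

/-! ### The boxes of a slice -/

variable {α : Type*}

/-- The bivalent box of a vertical strand, given by the labels of the lower and the upper end. -/
def vertical (e : α → Bool) (x : α × α) : Box α := .bivalent (e x.1) x.1 x.2

/-- The boxes that stand for a piece with bottom labels `x` and top labels `y`. -/
inductive Piece.Boxes : Piece → List α → List α → List (Box α) → Prop
  | cup (e : Bool) (a b : α) : Boxes .cup [] [a, b] [.bivalent e a b]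
  | cap (e : Bool) (a b : α) : Boxes .cap [a, b] [] [.bivalent e a b]
  | virt (e e' : Bool) (a b c d : α) :
      Boxes (.cross .virt) [a, b] [c, d] [.bivalent e a d, .bivalent e' b c]
  | slash (o u : Bool) (a b c d : α) :
      Boxes (.cross .slash) [a, b] [c, d] [.crossing o u a c d b]
  | backslash (o u : Bool) (a b c d : α) :
      Boxes (.cross .backslash) [a, b] [c, d] [.crossing o u b a c d]

theorem Piece.Boxes.perm {g : Piece} {x y : List α} {C : List (Box α)} (h : g.Boxes x y C) :
    (ports C).Perm (x ++ y) := by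
  classical
  refine List.perm_iff_count.2 fun z => ?_
  cases h <;> simp only [Box.ports_bivalent, Box.ports_crossing, ports_cons, ports_nil,
    List.count_append, List.count_cons, List.count_nil] <;> omega

theorem ports_vertical (e : α → Bool) (v : List (α × α)) :
    (ports (v.map (vertical e))).Perm (v.map Prod.fst ++ v.map Prod.snd) := by
  classical
  refine List.perm_iff_count.2 fun z => ?_
  induction v with
  | nil => simp
  | cons x v ih =>
    simp only [vertical, List.map_cons, Box.ports_bivalent, ports_cons, List.count_append,
      List.count_cons, List.count_nil] at ih ⊢
    omega

variable [DecidableEq α]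

/-- Vertical strands of a slice are recorded as bivalent boxes, which give the lower level labels of
its own. They must be fresh so that every label still occurs twice. -/
theorem diagram_relabel (e : α → Bool) (v : List (α × α)) : ∀ {l₁ l₂ : List α} {B : List (Box α)}
    {n : ℕ}, Paired (l₁ ++ v.map Prod.snd ++ l₂ ++ ports B) → (v.map Prod.fst).Nodup →
    (∀ c ∈ v.map Prod.fst, c ∉ l₁ ++ v.map Prod.snd ++ l₂ ++ ports B) →
    n = l₁.length + v.length + l₂.length →
    E n (diagram (l₁ ++ v.map Prod.snd ++ l₂) B)
      (diagram (l₁ ++ v.map Prod.fst ++ l₂) (v.map (vertical e) ++ B)) := by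
  induction v with
  | nil => intro l₁ l₂ B n _ _ _ _; exact TE.refl _
  | cons x v ih =>
    intro l₁ l₂ B n h hn hd hl
    obtain ⟨a, b⟩ := x
    simp only [List.map_cons] at h hn hd ⊢
    have h1 := ih (l₁ := l₁ ++ [b]) (l₂ := l₂) (B := B) (n := n) (by simpa using h)
      (List.nodup_cons.1 hn).2 (fun c hc => by simpa using hd c (by simp [hc]))
      (by simp at hl ⊢; omega)
    have h2 := diagram_bivalent (e a) (a := a) (b := b) (l₁ := l₁) (l₂ := v.map Prod.fst ++ l₂)
      (B := v.map (vertical e) ++ B) (n := n) (h.add hn hd (List.perm_iff_count.2 fun z => by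
        have := List.perm_iff_count.1 (ports_vertical e v) z
        simp only [ports_append, List.count_append, List.count_cons] at this ⊢
        omega)) (by simp at hl ⊢; omega)
    simpa [vertical] using h1.trans (by simpa using h2)

/-- The step that turns a slice at the bottom into boxes. Each new label in `x` occurs once as an
end point at the bottom and once at a box of `C`. -/
theorem Piece.Boxes.diagram {g : Piece} {x y : List α} {C : List (Box α)} (hC : g.Boxes x y C)
    {l₁ l₂ : List α} {B : List (Box α)} {n : ℕ} (h : Paired (l₁ ++ y ++ l₂ ++ ports B))
    (hx : x.Nodup) (hd : ∀ c ∈ x, c ∉ l₁ ++ y ++ l₂ ++ ports B)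
    (hn : n = l₁.length + x.length + l₂.length) :
    E n (⟨l₁.length, g⟩ :: Welded.diagram (l₁ ++ y ++ l₂) B)
      (Welded.diagram (l₁ ++ x ++ l₂) (C ++ B)) := by
  have h1 : Paired (l₁ ++ x ++ l₂ ++ ports (C ++ B)) := h.add hx hd
    (List.perm_iff_count.2 fun z => by
      have := List.perm_iff_count.1 hC.perm z
      simp only [ports_append, List.count_append] at this ⊢
      omega)
  cases hC with
  | cup e a b =>
    have := diagram_cup e (a := a) (b := b) (l₁ := l₁) (l₂ := l₂) (B := B) (n := n)
      (h.perm (List.perm_iff_count.2 fun z => by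
        simp only [List.count_append]; omega)) (by simpa using hn)
    simpa using this
  | cap e a b =>
    have h2 := diagram_cap (a := b) (l₁ := l₁) (l₂ := l₂) (B := B) (n := n)
      (h.add (r := [b]) (by simp) (fun c hc => hd c (by
          rw [List.mem_singleton.1 hc]; simp)) (List.perm_iff_count.2 fun z => by
        simp only [List.count_append, List.count_cons, List.count_nil]; omega))
      (by simp at hn; omega)
    have h3 := diagram_bivalent e (a := a) (b := b) (l₁ := l₁) (l₂ := b :: l₂) (B := B) (n := n)
      (h1.perm (List.perm_iff_count.2 fun z => by
        simp only [Box.ports_bivalent, ports_cons, ports_nil, ports_append, List.count_append,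
          List.count_cons, List.count_nil]; omega)) (by simp at hn ⊢; omega)
    simpa using TE.trans h2 h3
  | virt e e' a b c d =>
    have h2 := diagram_swap (a := d) (b := c) (l₁ := l₁) (l₂ := l₂) (B := B) (n := n)
      (h.perm (List.perm_iff_count.2 fun z => by
        simp only [List.count_append, List.count_cons, List.count_nil]; omega))
      (by simp at hn; omega)
    have h3 := diagram_bivalent e' (a := b) (b := c) (l₁ := l₁ ++ [d]) (l₂ := l₂) (B := B) (n := n)
      (h.add (r := [b]) (by simp) (fun c hc => hd c (by
          rw [List.mem_singleton.1 hc]; simp))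
        (List.perm_iff_count.2 fun z => by
        simp only [List.count_append, List.count_cons, List.count_nil]; omega))
      (by simp at hn ⊢; omega)
    have h4 := diagram_bivalent e (a := a) (b := d) (l₁ := l₁) (l₂ := b :: l₂)
      (B := .bivalent e' b c :: B) (n := n)
      (h1.perm (List.perm_iff_count.2 fun z => by
        simp only [Box.ports_bivalent, ports_cons, ports_nil, ports_append, List.count_append,
          List.count_cons, List.count_nil]; omega)) (by simp at hn ⊢; omega)
    simp only [List.append_assoc, List.cons_append, List.nil_append] at h3
    simpa using TE.trans h2 (TE.trans h3 h4)
  | slash o u a b c d =>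
    have := diagram_slash o u (a := a) (b := b) (c := c) (d := d) (l₁ := l₁) (l₂ := l₂) (B := B)
      (n := n) (by simpa using h1) (by simp at hn; omega)
    simpa using this
  | backslash o u a b c d =>
    have := diagram_backslash o u (a := a) (b := b) (c := c) (d := d) (l₁ := l₁) (l₂ := l₂) (B := B)
      (n := n) (by simpa using h1) (by simp at hn; omega)
    simpa using this

end

section

/-! ### Directed points and slices -/

/-- The same point with the opposite direction. -/
def DirPoint.rev (x : DirPoint) : DirPoint := ⟨x.level, x.pos, !x.up⟩

@[simp] theorem DirPoint.rev_mk (k j : ℕ) (d : Bool) : DirPoint.rev ⟨k, j, d⟩ = ⟨k, j, !d⟩ := rfl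

@[simp] theorem DirPoint.rev_rev (x : DirPoint) : x.rev.rev = x := by
  simp [DirPoint.rev]

/-- A traveller at `x` enters slice `k`. -/
def DirPoint.Enters (x : DirPoint) (k : ℕ) : Prop :=
  (x.up = true ∧ x.level = k) ∨ (x.up = false ∧ x.level = k + 1)

theorem DirPoint.Enters.unique {x : DirPoint} {k k' : ℕ} (h : x.Enters k) (h' : x.Enters k') :
    k = k' := by
  rcases h with h | h <;> rcases h' with h' | h' <;> simp_all

theorem PassesOver.enters {w : Word} {k : ℕ} {x : DirPoint} (h : PassesOver w k x) :
    x.Enters k := by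
  obtain ⟨p, ⟨-, rfl | rfl⟩ | ⟨-, rfl | rfl⟩⟩ := h <;> simp [DirPoint.Enters]

theorem PassesUnder.enters {w : Word} {k : ℕ} {x : DirPoint} (h : PassesUnder w k x) :
    x.Enters k := by
  obtain ⟨p, ⟨-, rfl | rfl⟩ | ⟨-, rfl | rfl⟩⟩ := h <;> simp [DirPoint.Enters]

theorem travel_up {w : Word} {k : ℕ} {s : Slice} (hs : w[k]? = some s) (j : ℕ) :
    travel w ⟨k, j, true⟩ = leave k (s.fromBelow j) := by
  simp [travel, hs]

theorem travel_down {w : Word} {k : ℕ} {s : Slice} (hs : w[k]? = some s) (j : ℕ) :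
    travel w ⟨k + 1, j, false⟩ = leave k (s.fromAbove j) := by
  simp [travel, hs]

/-- Reversibility of travel, checked piece by piece. It gives injectivity, and it allows a strand to
be read against the direction in which its slice is described. -/
theorem travel_rev_aux {w : Word} {k : ℕ} {s : Slice} (hs : w[k]? = some s) {x : DirPoint}
    (hx : x.Enters k) :
    (travel w x).rev.Enters k ∧ travel w (travel w x).rev = x.rev := by
  obtain ⟨l, j, d⟩ := x
  obtain ⟨p, g⟩ := s
  rcases hx with ⟨h1, h2⟩ | ⟨h1, h2⟩
  · simp only at h1 h2
    subst h1 h2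
    rw [travel_up hs]
    cases g <;> simp only [Slice.fromBelow] <;> split_ifs <;>
      simp [leave, travel_up hs, travel_down hs, Slice.fromBelow, Slice.fromAbove, DirPoint.Enters,
        *] <;> grind
  · simp only at h1 h2
    subst h1 h2
    rw [travel_down hs]
    cases g <;> simp only [Slice.fromAbove] <;> split_ifs <;>
      simp [leave, travel_up hs, travel_down hs, Slice.fromBelow, Slice.fromAbove, DirPoint.Enters,
        *] <;> grind

theorem IsPoint.width {w : Word} {k j n : ℕ} (h : IsPoint w k j) (hn : IsTangle 0 (w.take k) n) :
    j < n := by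
  obtain ⟨m, h1, h2⟩ := h
  rwa [h1.unique hn] at h2

theorem IsPoint.level_lt {w : Word} (hw : IsTangle 0 w 0) {k j : ℕ} (h : IsPoint w k j) :
    k < w.length := by
  by_contra hk
  have := h.width (n := 0) (by rwa [List.take_of_length_le (by simpa using hk)])
  simp at this

theorem IsPoint.enters {w : Word} (hw : IsTangle 0 w 0) {x : DirPoint}
    (h : IsPoint w x.level x.pos) : ∃ k s, w[k]? = some s ∧ x.Enters k := by
  obtain ⟨k, j, d⟩ := x
  have h1 : k < w.length := h.level_lt hw
  have h2 : k ≠ 0 := by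
    rintro rfl
    have := h.width (n := 0) (by simp)
    simp at this
  cases d
  · exact ⟨k - 1, w[k - 1], List.getElem?_eq_getElem _, .inr ⟨rfl, by simp; omega⟩⟩
  · exact ⟨k, w[k], List.getElem?_eq_getElem _, .inl ⟨rfl, rfl⟩⟩

/-! ### The points of an oriented diagram as labels -/

open Classical in
/-- The directed point in `O` at the place of `x`. -/
noncomputable def lab (O : Set DirPoint) (x : DirPoint) : DirPoint := if x ∈ O then x else x.rev

section
variable {w : Word} {O : Set DirPoint}

theorem lab_of_mem {x : DirPoint} (h : x ∈ O) : lab O x = x := by simp [lab, h]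

theorem lab_of_notMem {x : DirPoint} (h : x ∉ O) : lab O x = x.rev := by simp [lab, h]

@[simp] theorem lab_level (x : DirPoint) : (lab O x).level = x.level := by
  unfold lab; split_ifs <;> rfl

@[simp] theorem lab_pos (x : DirPoint) : (lab O x).pos = x.pos := by
  unfold lab; split_ifs <;> rfl

theorem IsOrientation.rev_mem_iff (hO : IsOrientation w O) {x : DirPoint}
    (hx : IsPoint w x.level x.pos) : x.rev ∈ O ↔ x ∉ O := by
  obtain ⟨k, j, d⟩ := x
  obtain ⟨e, he, hu⟩ := hO.existsUnique k j hx
  simp only at he hu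
  constructor
  · intro h1 h2
    have := (hu _ h1).trans (hu _ h2).symm
    cases d <;> simp at this
  · intro h
    have : e = !d := by
      cases e <;> cases d <;> simp_all
    rw [DirPoint.rev_mk, ← this]; exact he

theorem IsOrientation.lab_mem (hO : IsOrientation w O) {x : DirPoint}
    (hx : IsPoint w x.level x.pos) : lab O x ∈ O := by
  by_cases h : x ∈ O
  · rwa [lab_of_mem h]
  · rw [lab_of_notMem h]; exact (hO.rev_mem_iff hx).2 h

theorem IsOrientation.lab_rev (hO : IsOrientation w O) {x : DirPoint}
    (hx : IsPoint w x.level x.pos) : lab O x.rev = lab O x := by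
  by_cases h : x ∈ O
  · rw [lab_of_mem h, lab_of_notMem, DirPoint.rev_rev]
    intro h'; exact (hO.rev_mem_iff hx).1 h' h
  · rw [lab_of_notMem h, lab_of_mem ((hO.rev_mem_iff hx).2 h)]

theorem IsOrientation.exists_travel_eq (hO : IsOrientation w O) :
    ∀ x ∈ O, ∃ z ∈ O, travel w z = x :=
  exists_eq_of_connected hO.travel_mem hO.connected

theorem IsOrientation.finite (hO : IsOrientation w O) : O.Finite :=
  finite_of_connected hO.travel_mem hO.connected

theorem IsOrientation.injOn (hO : IsOrientation w O) : Set.InjOn (travel w) O :=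
  injOn_of_connected hO.travel_mem hO.connected

open Classical in
/-- The strand of a slice that starts or ends at a given point. -/
theorem IsOrientation.strand (hO : IsOrientation w O) (hw : IsTangle 0 w 0) {k : ℕ} {s : Slice}
    (hs : w[k]? = some s) {i t : DirPoint} (hi : i.Enters k) (hp : IsPoint w i.level i.pos)
    (ht : travel w i = t) :
    ∃ x ∈ O, x.Enters k ∧ dir (decide (i ∈ O)) (lab O i) (lab O t) = (x, travel w x) ∧
      (x = i ∨ x = t.rev) := by
  subst ht
  by_cases h : i ∈ O
  · refine ⟨i, h, hi, ?_, .inl rfl⟩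
    simp [h, lab_of_mem h, lab_of_mem (hO.travel_mem _ h)]
  -- Here the orientation runs through the strand backwards: the predecessor in `O` of the reversed
  -- point `i.rev` is the reverse of `travel w i`.
  · have h1 : i.rev ∈ O := (hO.rev_mem_iff hp).2 h
    obtain ⟨z, hz, hzi⟩ := hO.exists_travel_eq _ h1
    obtain ⟨k', s', hs', hk'⟩ := IsPoint.enters hw (hO.isPoint z hz)
    have h2 := travel_rev_aux hs' hk'
    rw [hzi, DirPoint.rev_rev] at h2
    have h3 : (travel w i).rev ∈ O := by rw [h2.2, DirPoint.rev_rev]; exact hz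
    have h4 : travel w i ∉ O := by
      intro h4
      exact (hO.rev_mem_iff (hO.isPoint _ h4)).1 h3 h4
    have h5 := travel_rev_aux hs hi
    refine ⟨_, h3, h5.1, ?_, .inr rfl⟩
    simp [h, lab_of_notMem h, lab_of_notMem h4, h5.2]

/-- A box between points of `O` whose strands pass through slice `k`. -/
def Box.Good (w : Word) (O : Set DirPoint) (k : ℕ) : Box DirPoint → Prop
  | bivalent e a b => ∃ x ∈ O, x.Enters k ∧ dir e a b = (x, travel w x) ∧
      ∀ k', ¬ PassesUnder w k' x
  | crossing o u a c d b => ∃ x ∈ O, ∃ y ∈ O, x.Enters k ∧ y.Enters k ∧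
      dir o a d = (x, travel w x) ∧ dir u b c = (y, travel w y) ∧
      PassesOver w k x ∧ PassesUnder w k y ∧ ∀ k', ¬ PassesUnder w k' x

/-- The labels of the points number `i, …, i + n - 1` of level `k`. -/
noncomputable def row (O : Set DirPoint) (k i n : ℕ) : List DirPoint :=
  (List.range n).map fun j => lab O ⟨k, i + j, true⟩

theorem row_add (k i m n : ℕ) : row O k i (m + n) = row O k i m ++ row O k (i + m) n := by
  simp [row, List.range_add, Nat.add_assoc, Function.comp_def]

@[simp] theorem length_row (k i n : ℕ) : (row O k i n).length = n := by simp [row]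

theorem of_mem_row {k i n : ℕ} {z : DirPoint} (hz : z ∈ row O k i n) :
    z.level = k ∧ i ≤ z.pos ∧ z.pos < i + n := by
  simp only [row, List.mem_map, List.mem_range] at hz
  obtain ⟨j, hj, rfl⟩ := hz
  simp; omega

theorem nodup_row (k i n : ℕ) : (row O k i n).Nodup := by
  refine List.Nodup.map ?_ List.nodup_range
  intro a b hab
  have := congrArg DirPoint.pos hab
  simpa using this

theorem IsOrientation.mem_row (hO : IsOrientation w O) {k n : ℕ} (hn : IsTangle 0 (w.take k) n)
    {z : DirPoint} : z ∈ row O k 0 n ↔ z ∈ O ∧ z.level = k := by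
  constructor
  · intro hz
    have h1 := of_mem_row hz
    simp only [row, List.mem_map, List.mem_range] at hz
    obtain ⟨j, hj, rfl⟩ := hz
    exact ⟨hO.lab_mem ⟨n, hn, by simpa using hj⟩, h1.1⟩
  · rintro ⟨hz, rfl⟩
    have h1 := (hO.isPoint z hz).width hn
    refine List.mem_map.2 ⟨z.pos, List.mem_range.2 h1, ?_⟩
    obtain ⟨k, j, d⟩ := z
    simp only [Nat.zero_add]
    cases d
    · rw [← lab_of_mem hz]
      exact hO.lab_rev (x := ⟨k, j, false⟩) (hO.isPoint _ hz)
    · exact lab_of_mem hz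

/-- The pairs of lower and upper ends of `n` vertical strands. -/
noncomputable def pairs (O : Set DirPoint) (k i i' n : ℕ) : List (DirPoint × DirPoint) :=
  (List.range n).map fun j => (lab O ⟨k, i + j, true⟩, lab O ⟨k + 1, i' + j, true⟩)

@[simp] theorem pairs_fst (k i i' n : ℕ) : (pairs O k i i' n).map Prod.fst = row O k i n := by
  simp [pairs, row, Function.comp_def]

@[simp] theorem pairs_snd (k i i' n : ℕ) :
    (pairs O k i i' n).map Prod.snd = row O (k + 1) i' n := by
  simp [pairs, row, Function.comp_def]

@[simp] theorem length_pairs (k i i' n : ℕ) : (pairs O k i i' n).length = n := by simp [pairs]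

theorem lab_up (k j : ℕ) [Decidable ((⟨k, j, true⟩ : DirPoint) ∈ O)] :
    (lab O ⟨k, j, true⟩).up = decide ((⟨k, j, true⟩ : DirPoint) ∈ O) := by
  by_cases h : (⟨k, j, true⟩ : DirPoint) ∈ O
  · simp [lab_of_mem h, h]
  · simp [lab_of_notMem h, h]

theorem IsOrientation.good_vertical (hO : IsOrientation w O) (hw : IsTangle 0 w 0) {k : ℕ}
    {s : Slice} (hs : w[k]? = some s) {m i i' n : ℕ} (hm : IsTangle 0 (w.take k) m)
    (hi : i + n ≤ m)
    (ht : ∀ j < n, s.fromBelow (i + j) = (i' + j, true) ∧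
      (i + j < s.pos ∨ s.piece.ins + s.pos ≤ i + j) ∧
      (i' + j < s.pos ∨ s.piece.outs + s.pos ≤ i' + j)) :
    ∀ b ∈ (pairs O k i i' n).map (vertical DirPoint.up), b.Good w O k := by
  classical
  intro b hb
  simp only [pairs, List.map_map, List.mem_map, List.mem_range, Function.comp] at hb
  obtain ⟨j, hj, rfl⟩ := hb
  obtain ⟨h1, h2, h3⟩ := ht j hj
  obtain ⟨x, hx, hxk, hd, hxx⟩ := hO.strand hw hs (i := ⟨k, i + j, true⟩) (t := ⟨k + 1, i' + j, true⟩)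
    (.inl ⟨rfl, rfl⟩) ⟨m, hm, by simp; omega⟩ (by rw [travel_up hs, h1]; rfl)
  refine ⟨x, hx, hxk, by rw [← hd, ← lab_up], ?_⟩
  intro k' hu
  obtain rfl := hxk.unique hu.enters
  obtain ⟨p, ⟨hp, h4⟩ | ⟨hp, h4⟩⟩ := hu <;> rw [hs] at hp <;> cases hp <;>
    simp only [Piece.ins, Piece.outs] at h2 h3 <;>
    rcases hxx with rfl | rfl <;> simp at h4 <;> omega

end

end

/-! ### Reading the slices of an oriented diagram as boxes -/

section
variable {w : Word} {O : Set DirPoint}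

theorem IsOrientation.exists_boxes_piece (hO : IsOrientation w O) (hw : IsTangle 0 w 0) {k p : ℕ}
    {g : Piece} (hs : w[k]? = some ⟨p, g⟩) {m m' : ℕ} (hm : IsTangle 0 (w.take k) m)
    (hm' : IsTangle 0 (w.take (k + 1)) m') (h : p + g.ins ≤ m) (h' : p + g.outs ≤ m') :
    ∃ C, g.Boxes (row O k p g.ins) (row O (k + 1) p g.outs) C ∧ ∀ b ∈ C, b.Good w O k := by
  classical
  have hp : ∀ j < m, ∀ d, IsPoint w (DirPoint.mk k j d).level (DirPoint.mk k j d).pos :=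
    fun j hj _ => ⟨m, hm, hj⟩
  have hp' : ∀ j < m', ∀ d, IsPoint w (DirPoint.mk (k + 1) j d).level (DirPoint.mk (k + 1) j d).pos :=
    fun j hj _ => ⟨m', hm', hj⟩
  cases g with
  | cup =>
    simp only [Piece.outs] at h'
    obtain ⟨x, hx, hxk, hd, -⟩ := hO.strand hw hs (i := ⟨k + 1, p, false⟩) (t := ⟨k + 1, p + 1, true⟩)
      (.inr ⟨rfl, rfl⟩) (hp' _ (by omega) _) (by rw [travel_down hs]; simp [Slice.fromAbove, leave])
    have e : row O (k + 1) p 2 = [lab O ⟨k + 1, p, false⟩, lab O ⟨k + 1, p + 1, true⟩] := by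
      rw [← hO.lab_rev (hp' p (by omega) false)]; rfl
    refine ⟨_, by rw [show row O (k + 1) p (Piece.cup).outs = _ from e]; exact .cup (decide ((⟨k + 1, p, false⟩ : DirPoint) ∈ O)) _ _, ?_⟩
    simp only [List.mem_singleton, forall_eq]
    exact ⟨x, hx, hxk, hd, fun k' h => by
      obtain rfl := hxk.unique h.enters
      obtain ⟨p, ⟨hp, h4⟩ | ⟨hp, h4⟩⟩ := h <;> rw [hs] at hp <;> cases hp⟩
  | cap =>
    simp only [Piece.ins] at h
    obtain ⟨x, hx, hxk, hd, -⟩ := hO.strand hw hs (i := ⟨k, p, true⟩) (t := ⟨k, p + 1, false⟩)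
      (.inl ⟨rfl, rfl⟩) (hp _ (by omega) _) (by rw [travel_up hs]; simp [Slice.fromBelow, leave])
    have e : row O k p 2 = [lab O ⟨k, p, true⟩, lab O ⟨k, p + 1, false⟩] := by
      rw [← hO.lab_rev (hp (p + 1) (by omega) false)]; rfl
    refine ⟨_, by rw [show row O k p (Piece.cap).ins = _ from e]; exact .cap (decide ((⟨k, p, true⟩ : DirPoint) ∈ O)) _ _, ?_⟩
    simp only [List.mem_singleton, forall_eq]
    exact ⟨x, hx, hxk, hd, fun k' h => by
      obtain rfl := hxk.unique h.enters
      obtain ⟨p, ⟨hp, h4⟩ | ⟨hp, h4⟩⟩ := h <;> rw [hs] at hp <;> cases hp⟩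
  | cross t =>
    simp only [Piece.ins, Piece.outs] at h h'
    have e : row O k p 2 = [lab O ⟨k, p, true⟩, lab O ⟨k, p + 1, true⟩] := rfl
    have e' : row O (k + 1) p 2 = [lab O ⟨k + 1, p, true⟩, lab O ⟨k + 1, p + 1, true⟩] := rfl
    obtain ⟨x, hx, hxk, hdx, hxx⟩ := hO.strand hw hs (i := ⟨k, p, true⟩)
      (t := ⟨k + 1, p + 1, true⟩) (.inl ⟨rfl, rfl⟩) (hp _ (by omega) _)
      (by rw [travel_up hs]; simp [Slice.fromBelow, leave])
    obtain ⟨y, hy, hyk, hdy, hyy⟩ := hO.strand hw hs (i := ⟨k, p + 1, true⟩)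
      (t := ⟨k + 1, p, true⟩) (.inl ⟨rfl, rfl⟩) (hp _ (by omega) _)
      (by rw [travel_up hs]; simp [Slice.fromBelow, leave])
    cases t with
    | virt =>
      have hu : ∀ x : DirPoint, x.Enters k → ∀ k', ¬ PassesUnder w k' x := fun x hxk k' h => by
        obtain rfl := hxk.unique h.enters
        obtain ⟨p, ⟨hp, h4⟩ | ⟨hp, h4⟩⟩ := h <;> rw [hs] at hp <;> cases hp
      refine ⟨_, .virt (decide ((⟨k, p, true⟩ : DirPoint) ∈ O))
        (decide ((⟨k, p + 1, true⟩ : DirPoint) ∈ O)) _ _ _ _, ?_⟩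
      · simp only [List.mem_cons, List.not_mem_nil, or_false, forall_eq_or_imp, forall_eq]
        exact ⟨⟨x, hx, hxk, hdx, hu x hxk⟩, ⟨y, hy, hyk, hdy, hu y hyk⟩⟩
    | slash =>
      refine ⟨_, .slash (decide ((⟨k, p, true⟩ : DirPoint) ∈ O))
        (decide ((⟨k, p + 1, true⟩ : DirPoint) ∈ O)) _ _ _ _, ?_⟩
      simp only [List.mem_cons, List.not_mem_nil, or_false, forall_eq]
      refine ⟨x, hx, y, hy, hxk, hyk, hdx, hdy, ⟨p, .inl ⟨hs, hxx⟩⟩, ⟨p, .inl ⟨hs, hyy⟩⟩, ?_⟩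
      intro k' hu
      obtain rfl := hxk.unique hu.enters
      obtain ⟨p, ⟨hp, h4⟩ | ⟨hp, h4⟩⟩ := hu <;> rw [hs] at hp
      · cases hp; rcases hxx with rfl | rfl <;> simp at h4
      · cases hp
    | backslash =>
      -- The box of a `backslash` is rotated by a quarter, so its under-strand is listed from the
      -- top right end of the slice to the bottom left end.
      obtain ⟨x, hx, hxk, hdx, hxx⟩ := hO.strand hw hs (i := ⟨k + 1, p + 1, false⟩)
        (t := ⟨k, p, false⟩) (.inr ⟨rfl, rfl⟩) (hp' _ (by omega) _)
        (by rw [travel_down hs]; simp [Slice.fromAbove, leave])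
      have e1 : lab O ⟨k + 1, p + 1, false⟩ = lab O ⟨k + 1, p + 1, true⟩ :=
        (hO.lab_rev (hp' (p + 1) (by omega) true))
      have e2 : lab O ⟨k, p, false⟩ = lab O ⟨k, p, true⟩ := hO.lab_rev (hp p (by omega) true)
      rw [e1, e2] at hdx
      refine ⟨_, .backslash (decide ((⟨k, p + 1, true⟩ : DirPoint) ∈ O))
        (decide ((⟨k + 1, p + 1, false⟩ : DirPoint) ∈ O)) _ _ _ _, ?_⟩
      simp only [List.mem_cons, List.not_mem_nil, or_false, forall_eq]
      refine ⟨y, hy, x, hx, hyk, hxk, hdy, hdx, ⟨p, .inr ⟨hs, hyy⟩⟩, ⟨p, .inr ⟨hs, hxx.symm⟩⟩, ?_⟩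
      intro k' hu
      obtain rfl := hyk.unique hu.enters
      obtain ⟨p, ⟨hp, h4⟩ | ⟨hp, h4⟩⟩ := hu <;> rw [hs] at hp
      · cases hp
      · cases hp; rcases hyy with rfl | rfl <;> simp at h4

/-- The boxes are those of the piece and one bivalent box for each vertical strand. Labels are
points of `O`, and their levels guarantee freshness: everything above the slice has a level greater
than `k`. -/
theorem IsOrientation.exists_boxes_slice (hO : IsOrientation w O) (hw : IsTangle 0 w 0) {k : ℕ}
    {s : Slice} (hs : w[k]? = some s) {m m' : ℕ} (hm : IsTangle 0 (w.take k) m)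
    (hm' : IsTangle 0 (w.take (k + 1)) m') :
    ∃ C, (∀ b ∈ C, b.Good w O k) ∧ (ports C).Perm (row O k 0 m ++ row O (k + 1) 0 m') ∧
      ∀ B, Paired (row O (k + 1) 0 m' ++ ports B) →
        (∀ z ∈ row O (k + 1) 0 m' ++ ports B, k < z.level) →
        E m (s :: diagram (row O (k + 1) 0 m') B) (diagram (row O k 0 m) (C ++ B)) := by
  obtain ⟨p, g⟩ := s
  have hlt : k < w.length := (List.getElem?_eq_some_iff.1 hs).1
  have hwk : w[k] = ⟨p, g⟩ := (List.getElem?_eq_some_iff.1 hs).2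
  obtain ⟨r, rfl, rfl⟩ : ∃ r, m = p + g.ins + r ∧ m' = p + g.outs + r := by
    rw [List.take_succ_eq_append_getElem hlt, isTangle_append] at hm'
    obtain ⟨m₁, h1, h2⟩ := hm'
    obtain rfl := h1.unique hm
    rw [hwk] at h2
    rw [isTangle_cons] at h2
    rw [isTangle_nil] at h2
    simp only at h2
    exact ⟨m₁ - p - g.ins, by omega, by omega⟩
  obtain ⟨C, hC, hgood⟩ := hO.exists_boxes_piece hw hs hm hm' (by omega) (by omega)
  have hV₁ := hO.good_vertical hw hs (i := 0) (i' := 0) (n := p) hm (by omega) (by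
    intro j hj
    refine ⟨by simp [Slice.fromBelow, hj], by simp [hj], by simp [hj]⟩)
  have hV₂ := hO.good_vertical hw hs (i := p + g.ins) (i' := p + g.outs) (n := r) hm (by omega) (by
    intro j hj
    refine ⟨?_, .inr (show g.ins + p ≤ p + g.ins + j by omega),
      .inr (show g.outs + p ≤ p + g.outs + j by omega)⟩
    cases g <;> simp [Slice.fromBelow, Piece.ins, Piece.outs] <;> grind)
  set V₁ := (pairs O k 0 0 p).map (vertical DirPoint.up) with hV₁'
  set V₂ := (pairs O k (p + g.ins) (p + g.outs) r).map (vertical DirPoint.up) with hV₂'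
  have e : row O k 0 (p + g.ins + r) = row O k 0 p ++ row O k p g.ins ++ row O k (p + g.ins) r := by
    rw [row_add, row_add, Nat.zero_add, Nat.zero_add]
  have e' : row O (k + 1) 0 (p + g.outs + r) =
      row O (k + 1) 0 p ++ row O (k + 1) p g.outs ++ row O (k + 1) (p + g.outs) r := by
    rw [row_add, row_add, Nat.zero_add, Nat.zero_add]
  have p1 := ports_vertical DirPoint.up (pairs O k 0 0 p)
  have p2 := ports_vertical DirPoint.up (pairs O k (p + g.ins) (p + g.outs) r)
  rw [pairs_fst, pairs_snd] at p1 p2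
  refine ⟨C ++ (V₁ ++ V₂), ?_, ?_, ?_⟩
  · intro b hb
    rcases List.mem_append.1 hb with hb | hb
    · exact hgood b hb
    · rcases List.mem_append.1 hb with hb | hb
      · exact hV₁ b hb
      · exact hV₂ b hb
  · refine List.perm_iff_count.2 fun z => ?_
    have c1 := List.perm_iff_count.1 p1 z
    have c2 := List.perm_iff_count.1 p2 z
    have c3 := List.perm_iff_count.1 hC.perm z
    simp only [e, e', ports_append, List.count_append, V₁, V₂] at c1 c2 c3 ⊢
    omega
  · intro B hP hlev
    rw [e'] at hP hlev
    have h1 := diagram_relabel DirPoint.up (pairs O k (p + g.ins) (p + g.outs) r)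
      (l₁ := row O (k + 1) 0 p ++ row O (k + 1) p g.outs) (l₂ := []) (B := B)
      (n := p + g.outs + r) (by simpa using hP) (by simpa using nodup_row _ _ _) (by
        intro c hc hc'
        have := hlev c (by simpa using hc')
        have := of_mem_row (by simpa using hc)
        omega) (by simp)
    rw [pairs_fst, pairs_snd, List.append_nil, List.append_nil, ← hV₂'] at h1
    have hP₂ : Paired (row O (k + 1) 0 p ++ (row O (k + 1) p g.outs ++ row O k (p + g.ins) r) ++
        ports (V₂ ++ B)) := hP.add (r := row O k (p + g.ins) r) (nodup_row _ _ _) (by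
        intro c hc hc'
        have := hlev c hc'
        have := of_mem_row hc
        omega) (List.perm_iff_count.2 fun z => by
        have c2 := List.perm_iff_count.1 p2 z
        simp only [ports_append, List.count_append, V₂] at c2 ⊢
        omega)
    have hlev₂ : ∀ z ∈ row O (k + 1) 0 p ++ (row O (k + 1) p g.outs ++ row O k (p + g.ins) r) ++
        ports (V₂ ++ B), k < z.level ∨ (z.level = k ∧ p + g.ins ≤ z.pos) := by
      intro z hz
      simp only [ports_append, List.mem_append, p2.mem_iff, V₂] at hz hlev
      have := fun hz : z ∈ row O k (p + g.ins) r => of_mem_row hz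
      have := hlev z
      grind
    have h2 := diagram_relabel DirPoint.up (pairs O k 0 0 p) (l₁ := [])
      (l₂ := row O (k + 1) p g.outs ++ row O k (p + g.ins) r) (B := V₂ ++ B)
      (n := p + g.outs + r) (by simpa using hP₂) (by simpa using nodup_row _ _ _) (by
        intro c hc hc'
        have h3 := hlev₂ c (by simpa using hc')
        have h4 := of_mem_row (by simpa using hc)
        omega) (by simp; omega)
    rw [pairs_fst, pairs_snd, List.nil_append, List.nil_append, ← hV₁'] at h2
    have hP₁ : Paired (row O k 0 p ++ row O (k + 1) p g.outs ++ row O k (p + g.ins) r ++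
        ports (V₁ ++ (V₂ ++ B))) := hP₂.add (r := row O k 0 p) (nodup_row _ _ _) (by
        intro c hc hc'
        have := hlev₂ c hc'
        have := of_mem_row hc
        omega) (List.perm_iff_count.2 fun z => by
        have c2 := List.perm_iff_count.1 p1 z
        simp only [ports_append, List.count_append, V₁] at c2 ⊢
        omega)
    have h3 := hC.diagram (l₁ := row O k 0 p) (l₂ := row O k (p + g.ins) r) (B := V₁ ++ (V₂ ++ B))
      (n := p + g.ins + r) hP₁ (nodup_row _ _ _) (by
        intro c hc hc'
        have h4 := of_mem_row hc
        simp only [ports_append, List.mem_append, p1.mem_iff, V₁] at hc' hlev₂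
        have h5 := fun hz : c ∈ row O k 0 p => of_mem_row hz
        have h6 := fun hz : c ∈ row O k (p + g.ins) r => of_mem_row hz
        have h7 := hlev₂ c
        grind) (by simp)
    rw [length_row] at h3
    rw [e, e']
    simp only [List.append_assoc] at h1 h2 h3 ⊢
    refine TE.trans (E.cons (m := p + g.outs + r) (by simp) (by simp; omega) (h1.trans h2)) h3

end

/-! ### From a dance configuration to a calibrated box diagram -/

section
variable {w : Word} {O : Set DirPoint}

theorem Box.Good.mem_strands {k : ℕ} {b : Box DirPoint} (hb : b.Good w O k)
    {s : DirPoint × DirPoint} (hs : s ∈ b.strands) :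
    s.1 ∈ O ∧ s.1.Enters k ∧ s.2 = travel w s.1 := by
  cases b with
  | bivalent e a b =>
    obtain ⟨x, hx, hxk, hd, -⟩ := hb
    simp only [Box.strands_bivalent, List.mem_singleton] at hs
    rw [hs, hd]; exact ⟨hx, hxk, rfl⟩
  | crossing o u a c d b =>
    obtain ⟨x, hx, y, hy, hxk, hyk, hd, hd', -⟩ := hb
    simp only [Box.strands_crossing, List.mem_cons, List.not_mem_nil, or_false] at hs
    rcases hs with hs | hs
    · rw [hs, hd]; exact ⟨hx, hxk, rfl⟩
    · rw [hs, hd']; exact ⟨hy, hyk, rfl⟩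

theorem sources_append {α : Type*} (B B' : List (Box α)) :
    sources (B ++ B') = sources B ++ sources B' := by
  simp [sources, strands]

/-- Each oriented point next to the slice is the beginning or the end of a strand in it. An end
leaves the slice, hence it does not enter it, and the points that enter are precisely the
beginnings. -/
theorem IsOrientation.sources_slice (hO : IsOrientation w O) (hw : IsTangle 0 w 0) {k : ℕ}
    {m m' : ℕ} (hm : IsTangle 0 (w.take k) m) (hm' : IsTangle 0 (w.take (k + 1)) m')
    {C : List (Box DirPoint)} (hC : ∀ b ∈ C, b.Good w O k)
    (hp : (ports C).Perm (row O k 0 m ++ row O (k + 1) 0 m')) :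
    (sources C).Nodup ∧ ∀ z, z ∈ sources C ↔ z ∈ O ∧ z.Enters k := by
  have h1 : (sources C ++ targets C).Nodup := by
    refine ((perm_sources_targets C).symm.trans hp).nodup_iff.2 (List.nodup_append.2
      ⟨nodup_row _ _ _, nodup_row _ _ _, ?_⟩)
    rintro a ha b hb rfl
    have := of_mem_row ha
    have := of_mem_row hb
    omega
  have h2 : ∀ s ∈ strands C, s.1 ∈ O ∧ s.1.Enters k ∧ s.2 = travel w s.1 := by
    intro s hs
    obtain ⟨b, hb, hsb⟩ := mem_strands.1 hs
    exact (hC b hb).mem_strands hsb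
  refine ⟨(List.nodup_append.1 h1).1, fun z => ⟨?_, ?_⟩⟩
  · intro hz
    obtain ⟨s, hs, rfl⟩ := List.mem_map.1 hz
    exact ⟨(h2 s hs).1, (h2 s hs).2.1⟩
  · rintro ⟨hz, hzk⟩
    have h3 : z ∈ sources C ++ targets C := by
      rw [← (perm_sources_targets C).mem_iff, hp.mem_iff, List.mem_append, hO.mem_row hm,
        hO.mem_row hm']
      rcases hzk with h | h
      · exact .inl ⟨hz, h.2⟩
      · exact .inr ⟨hz, h.2⟩
    refine (List.mem_append.1 h3).resolve_right fun h4 => ?_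
    obtain ⟨s, hs, rfl⟩ := List.mem_map.1 h4
    obtain ⟨h5, h6, h7⟩ := h2 s hs
    obtain ⟨k', t, ht, hk'⟩ := IsPoint.enters hw (hO.isPoint _ h5)
    obtain rfl := h6.unique hk'
    have h8 := (travel_rev_aux ht h6).1
    rw [← h7] at h8
    rcases h8 with h8 | h8 <;> rcases hzk with h9 | h9 <;> simp_all [DirPoint.rev]

/-- Induction from the top slice downwards, collecting the boxes of each slice. With the oriented
points as labels, the strands of the boxes are the pairs `(x, travel w x)`. -/
theorem IsOrientation.exists_diagram (hO : IsOrientation w O) (hw : IsTangle 0 w 0) :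
    ∃ B, E 0 w (diagram [] B) ∧ (sources B).Nodup ∧ (∀ z, z ∈ sources B ↔ z ∈ O) ∧
      ∀ b ∈ B, ∃ k, b.Good w O k := by
  have key : ∀ i k, k + i = w.length → ∀ m, IsTangle 0 (w.take k) m → ∃ B,
      E m (w.drop k) (diagram (row O k 0 m) B) ∧ Paired (row O k 0 m ++ ports B) ∧
      (∀ z ∈ row O k 0 m ++ ports B, k ≤ z.level) ∧ (sources B).Nodup ∧
      (∀ z, z ∈ sources B ↔ z ∈ O ∧ ∃ k', k ≤ k' ∧ z.Enters k') ∧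
      ∀ b ∈ B, ∃ k, b.Good w O k := by
    intro i
    induction i with
    | zero =>
      intro k hk m hm
      obtain rfl : k = w.length := by omega
      rw [List.take_length] at hm
      obtain rfl := hm.unique hw
      refine ⟨[], ?_, ?_, ?_, ?_, ?_, ?_⟩
      · rw [List.drop_length]; exact TE.refl _
      · rw [row, List.range_zero, List.map_nil, ports_nil]; rintro c ⟨⟩
      · rw [row, List.range_zero, List.map_nil, ports_nil]; rintro c ⟨⟩
      · exact List.nodup_nil
      · intro z
        refine ⟨fun h => (List.not_mem_nil h).elim, ?_⟩
        rintro ⟨hz, k', hk', hzk⟩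
        have := (hO.isPoint z hz).level_lt hw
        rcases hzk with h | h <;> omega
      · simp
    | succ i ih =>
      intro k hk m hm
      have hlt : k < w.length := by omega
      have hs : w[k]? = some w[k] := List.getElem?_eq_getElem hlt
      obtain ⟨m', hm', -⟩ := isTangle_append.1 (by rwa [List.take_append_drop (k + 1) w])
      obtain ⟨B, h1, h2, h3, h4, h5, h6⟩ := ih (k + 1) (by omega) m' hm'
      obtain ⟨C, hC, hp, hE⟩ := hO.exists_boxes_slice hw hs hm hm'
      obtain ⟨h7, h8⟩ := hO.sources_slice hw hm hm' hC hp
      have h9 := hE B h2 (fun z hz => h3 z hz)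
      have h10 : IsTangle m (w[k] :: w.drop (k + 1)) 0 := by
        rw [← List.drop_eq_getElem_cons hlt]
        rw [← List.take_append_drop k w, isTangle_append] at hw
        obtain ⟨m₁, h, h'⟩ := hw
        rwa [h.unique hm] at h'
      refine ⟨C ++ B, ?_, ?_, ?_, ?_, ?_, ?_⟩
      · rw [List.drop_eq_getElem_cons hlt]
        refine TE.trans ?_ h9
        have h11 := isTangle_append.1 ((List.take_succ_eq_append_getElem hlt) ▸ hm')
        obtain ⟨m₁, h12, h13⟩ := h11
        obtain rfl := h12.unique hm
        rw [isTangle_cons, isTangle_nil] at h13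
        exact E.cons (m := m') (by omega) (by omega) h1
      · refine h2.add (r := row O k 0 m) (nodup_row _ _ _) (fun c hc hc' => ?_)
          (List.perm_iff_count.2 fun z => ?_)
        · have := h3 c hc'
          have := of_mem_row hc
          omega
        · have := List.perm_iff_count.1 hp z
          simp only [ports_append, List.count_append] at this ⊢
          omega
      · intro z hz
        simp only [ports_append, List.mem_append, hp.mem_iff] at hz h3
        have a1 := fun h : z ∈ row O k 0 m => of_mem_row h
        have a2 := fun h : z ∈ row O (k + 1) 0 m' => of_mem_row h
        have a3 := h3 z
        grind
      · rw [sources_append]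
        refine List.nodup_append.2 ⟨h7, h4, ?_⟩
        rintro a ha b hb rfl
        obtain ⟨-, k', hk', hk''⟩ := (h5 a).1 hb
        have := ((h8 a).1 ha).2.unique hk''
        omega
      · intro z
        rw [sources_append, List.mem_append, h8, h5]
        constructor
        · rintro (⟨hz, h⟩ | ⟨hz, k', hk', h⟩)
          · exact ⟨hz, k, le_rfl, h⟩
          · exact ⟨hz, k', by omega, h⟩
        · rintro ⟨hz, k', hk', h⟩
          rcases hk'.eq_or_lt with rfl | h'
          · exact .inl ⟨hz, h⟩
          · exact .inr ⟨hz, k', h', h⟩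
      · intro b hb
        rcases List.mem_append.1 hb with hb | hb
        · exact ⟨k, hC b hb⟩
        · exact h6 b hb
  obtain ⟨B, h1, -, -, h4, h5, h6⟩ := key w.length 0 (by simp) 0 (by simp)
  refine ⟨B, by simpa [row] using h1, h4, fun z => ?_, h6⟩
  rw [h5]
  refine ⟨fun h => h.1, fun h => ⟨h, ?_⟩⟩
  obtain ⟨k, -, -, h2⟩ := IsPoint.enters hw (hO.isPoint z h)
  exact ⟨k, Nat.zero_le _, h2⟩

instance : Infinite DirPoint :=
  Infinite.of_injective (fun k : ℕ => (⟨k, 0, true⟩ : DirPoint)) fun a b h => by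
    simpa using congrArg DirPoint.level h

theorem PassesOver.unique (hO : IsOrientation w O) {k k' : ℕ} {x y z : DirPoint} (hx : x ∈ O)
    (hy : y ∈ O) (hxk : PassesOver w k x) (hyk : PassesOver w k' y) (h : PassesUnder w k z)
    (h' : PassesUnder w k' z) : x = y := by
  obtain rfl := h.enters.unique h'.enters
  have key : ∀ {p q : ℕ} {s : Slice}, w[k]? = some s → s.fromBelow p = (q, true) →
      (⟨k, p, true⟩ : DirPoint) ∈ O → (⟨k + 1, q, false⟩ : DirPoint) ∉ O := by
    intro p q s hs hsp h1 h2
    have h3 := hO.travel_mem _ h1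
    rw [travel_up hs, hsp] at h3
    exact (hO.rev_mem_iff (x := ⟨k + 1, q, true⟩) (hO.isPoint _ h3)).1 h2 h3
  obtain ⟨p, ⟨hs, h1⟩ | ⟨hs, h1⟩⟩ := hxk <;> obtain ⟨p', ⟨hs', h2⟩ | ⟨hs', h2⟩⟩ := hyk <;>
    rw [hs] at hs' <;> cases hs'
  · have := key hs (p := p) (q := p + 1) (by simp [Slice.fromBelow])
    rcases h1 with rfl | rfl <;> rcases h2 with rfl | rfl <;> simp_all
  · have := key hs (p := p + 1) (q := p) (by simp [Slice.fromBelow])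
    rcases h1 with rfl | rfl <;> rcases h2 with rfl | rfl <;> simp_all

/-- A dance configuration of an oriented diagram gives a calibration of its boxes. -/
theorem IsDanceConfiguration.exists_calibration (hO : IsOrientation w O) (hw : IsTangle 0 w 0)
    {S : Finset DirPoint} (hS : IsDanceConfiguration w O S) :
    ∃ B p q, E 0 w (diagram [] B) ∧ B ≠ [] ∧ Calibration S.card B p q S := by
  classical
  obtain ⟨B, hE, hnd, hmem, hgood⟩ := hO.exists_diagram hw
  obtain ⟨hSO, τ, hτ, hτ'⟩ := hS
  have hstr : ∀ s ∈ strands B, s.1 ∈ O ∧ s.2 = travel w s.1 := by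
    intro s hs
    obtain ⟨b, hb, hsb⟩ := mem_strands.1 hs
    obtain ⟨k, hk⟩ := hgood b hb
    exact ⟨(hk.mem_strands hsb).1, (hk.mem_strands hsb).2.2⟩
  have htar : ∀ x ∈ O, (x, travel w x) ∈ strands B := by
    intro x hx
    obtain ⟨s, hs, rfl⟩ := List.mem_map.1 ((hmem x).2 hx)
    rw [← (hstr s hs).2]; exact hs
  -- The real times are replaced by ranks, the number of points of `O` that are danced strictly
  -- earlier, so that recursion along time becomes recursion over `ℕ`.
  let r : DirPoint → ℕ := fun x => (hO.finite.toFinset.filter fun y => τ y < τ x).card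
  have hr : ∀ x ∈ O, ∀ y, τ x < τ y → r x < r y := by
    intro x hx y hxy
    refine Finset.card_lt_card ⟨fun z hz => ?_, fun h => ?_⟩
    · simp only [Finset.mem_filter] at hz ⊢
      exact ⟨hz.1, hz.2.trans hxy⟩
    · have h1 : x ∈ hO.finite.toFinset.filter fun z => τ z < τ y := by simp [hx, hxy]
      simpa using h h1
  let ov : DirPoint → DirPoint → Prop := fun z x => x ∈ O ∧ ∃ k,
    PassesOver w k x ∧ PassesUnder w k z
  -- The number behind the strand that begins at `z`: it grows by one plus twice the number of the
  -- strand above if `z` begins an under-passage, and is unchanged otherwise.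
  let G : (DirPoint → ℕ) → DirPoint → ℕ := fun f z =>
    f z + if h : ∃ x, ov z x then 1 + 2 * f h.choose else 0
  -- Initial points restart at 0. Elsewhere the value depends on the preceding point and possibly on
  -- the strand that passes over it; both have smaller rank by the two conditions on a dance.
  let F : (DirPoint → ℕ) → DirPoint → ℕ := fun f e =>
    if h : e ∉ S ∧ ∃ z ∈ O, travel w z = e then G f h.2.choose else 0
  obtain ⟨p, hp⟩ := exists_fixed r F (by
    intro e f g hfg
    simp only [F]
    split_ifs with h
    · obtain ⟨h1, h2⟩ := h.2.choose_spec
      set z := h.2.choose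
      have h3 : τ z < τ e := by
        have := hτ z h1 (by rw [h2]; exact h.1)
        rwa [h2] at this
      simp only [G]
      rw [hfg z (hr z h1 e h3)]
      split_ifs with h4
      · obtain ⟨h5, k, h6, h7⟩ := h4.choose_spec
        rw [hfg _ (hr _ h5 e ((hτ' k _ h5 z h1 h6 h7).trans h3))]
      · rfl
    · rfl)
  -- The same rule as for `p`, but without the restart at initial points.
  let q : DirPoint → ℕ := fun e => if h : ∃ z ∈ O, travel w z = e then G p h.choose else 0
  have hq : ∀ z ∈ O, q (travel w z) = G p z := by
    intro z hz
    have h : ∃ z' ∈ O, travel w z' = travel w z := ⟨z, hz, rfl⟩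
    have h1 := h.choose_spec
    have h2 : h.choose = z := hO.injOn h1.1 hz h1.2
    simp only [q, dif_pos h, h2]
  refine ⟨B, p, q, hE, ?_, hnd, ?_, ?_, le_rfl, ?_, ?_, ?_⟩
  · rintro rfl
    obtain ⟨x, hx⟩ := hO.nonempty
    exact List.not_mem_nil ((hmem x).2 hx)
  · have h1 : targets B = (sources B).map (travel w) := by
      rw [List.map_map]
      exact List.map_congr_left fun s hs => (hstr s hs).2
    rw [h1]
    refine (List.perm_ext_iff_of_nodup hnd (hnd.map_on fun x hx y hy h =>
      hO.injOn ((hmem x).1 hx) ((hmem y).1 hy) h)).2 fun z => ?_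
    rw [hmem, List.mem_map]
    constructor
    · intro hz
      obtain ⟨y, hy, hyz⟩ := hO.exists_travel_eq z hz
      exact ⟨y, (hmem y).2 hy, hyz⟩
    · rintro ⟨y, hy, rfl⟩
      exact hO.travel_mem _ ((hmem y).1 hy)
  · intro e he f hf
    rw [hmem] at he hf
    obtain ⟨n, rfl⟩ := hO.connected e he f hf
    clear hf
    induction n generalizing e with
    | zero => exact .refl
    | succ n ih =>
      exact .head (htar e he) (ih _ (hO.travel_mem e he))
  · intro b hb
    obtain ⟨k, hk⟩ := hgood b hb
    have hG : ∀ x, (∀ k', ¬ PassesUnder w k' x) → G p x = p x := by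
      intro x hx
      simp only [G]
      rw [dif_neg, Nat.add_zero]
      rintro ⟨y, hy, k, h1, h2⟩
      exact hx k h2
    cases b with
    | bivalent e a b =>
      obtain ⟨x, hx, hxk, hd, hu⟩ := hk
      simp only [Box.Flow, hd]
      rw [hq x hx, hG x hu]
    | crossing o u a c d b =>
      obtain ⟨x, hx, y, hy, hxk, hyk, hd, hd', hxo, hyu, hu⟩ := hk
      simp only [Box.Flow, hd, hd']
      rw [hq x hx, hG x hu, hq y hy]
      refine ⟨rfl, ?_⟩
      have h : ∃ x, ov y x := ⟨x, hx, k, hxo, hyu⟩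
      obtain ⟨h1, k', h2, h3⟩ := h.choose_spec
      have h4 := PassesOver.unique hO hx h1 hxo h2 hyu h3
      simp only [G, dif_pos h, ← h4]
      omega
  · intro e he he'
    have h : ∃ z ∈ O, travel w z = e := hO.exists_travel_eq e ((hmem e).1 he')
    rw [hp e]
    simp only [q, F, dif_pos h, dif_pos (And.intro he h)]
  · intro e he
    rw [hp e]
    simp [F, he]

end

section

/-! ### Diagrams with labelled directed points -/

variable {β : Type*}

/-- A passage of a labelled diagram: the directed point where it is entered, whether it is an
over-strand (`some true`) or an under-strand (`some false`) of a classical crossing, and the labels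
at its beginning and its end. -/
abbrev Passage (β : Type*) := DirPoint × Option Bool × β × β

/-- The points of the levels below and above slice number `k` have labels and directions that change
only at local minima and at classical crossings. -/
inductive SliceLabels (k : ℕ) :
    Slice → List (β × Bool) → List (β × Bool) → List (Passage β) → Prop
  | virt (A C : List (β × Bool)) (x y : β × Bool) :
      SliceLabels k ⟨A.length, .cross .virt⟩ (A ++ x :: y :: C) (A ++ y :: x :: C) []
  | cap (A C : List (β × Bool)) (a : β) (d : Bool) :
      SliceLabels k ⟨A.length, .cap⟩ (A ++ (a, d) :: (a, !d) :: C) (A ++ C) []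
  | cup (A C : List (β × Bool)) (e : Bool) (a b : β) :
      SliceLabels k ⟨A.length, .cup⟩ (A ++ C) (A ++ (a, !e) :: (b, e) :: C)
        [(⟨k + 1, if e then A.length else A.length + 1, false⟩, none, dir e a b)]
  | slash (A C : List (β × Bool)) (o u : Bool) (a c d b : β) :
      SliceLabels k ⟨A.length, .cross .slash⟩ (A ++ (a, o) :: (b, u) :: C)
        (A ++ (c, u) :: (d, o) :: C)
        [(if o then ⟨k, A.length, true⟩ else ⟨k + 1, A.length + 1, false⟩, some true, dir o a d),
          (if u then ⟨k, A.length + 1, true⟩ else ⟨k + 1, A.length, false⟩, some false, dir u b c)]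

theorem SliceLabels.length {k : ℕ} {s : Slice} {l l' : List (β × Bool)} {T : List (Passage β)}
    (h : SliceLabels k s l l' T) :
    s.pos + s.piece.ins ≤ l.length ∧ l.length + s.piece.outs = l'.length + s.piece.ins := by
  cases h <;> simp [Piece.ins, Piece.outs] <;> omega

/-- The labels along a word, from the level below slice number `k`. -/
inductive Trace : ℕ → List (β × Bool) → List (Passage β) → List (β × Bool) → Word → Prop
  | nil (k : ℕ) (l : List (β × Bool)) : Trace k l [] l []
  | cons {k : ℕ} {s : Slice} {l l' l'' : List (β × Bool)} {T T' : List (Passage β)} {w : Word}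
      (h : SliceLabels k s l l' T) (h' : Trace (k + 1) l' T' l'' w) : Trace k l (T ++ T') l'' (s :: w)

theorem Trace.append {k : ℕ} {l l' l'' : List (β × Bool)} {T T' : List (Passage β)} {w w' : Word}
    (h : Trace k l T l' w) (h' : Trace (k + w.length) l' T' l'' w') :
    Trace k l (T ++ T') l'' (w ++ w') := by
  induction h with
  | nil => simpa using h'
  | cons h₁ h₂ ih =>
    rw [List.append_assoc]
    refine .cons h₁ (ih ?_)
    rw [List.length_cons] at h'
    rwa [Nat.add_right_comm]

/-- The labels of all levels of a closed diagram. -/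
structure Labelling (w : Word) (L : ℕ → List (β × Bool)) (T : ℕ → List (Passage β)) : Prop where
  bottom : L 0 = []
  top : ∀ k, w.length ≤ k → L k = []
  slice : ∀ k s, w[k]? = some s → SliceLabels k s (L k) (L (k + 1)) (T k)

theorem Trace.exists_levels {k : ℕ} {l l' : List (β × Bool)} {E : List (Passage β)} {w : Word}
    (h : Trace k l E l' w) : ∃ (L : ℕ → List (β × Bool)) (T : ℕ → List (Passage β)),
      L 0 = l ∧ (∀ i, w.length ≤ i → L i = l') ∧
      (∀ i s, w[i]? = some s → SliceLabels (k + i) s (L i) (L (i + 1)) (T i)) ∧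
      ∀ t, t ∈ E ↔ ∃ i < w.length, t ∈ T i := by
  induction h with
  | nil k l => exact ⟨fun _ => l, fun _ => [], by simp⟩
  | @cons k s l l' l'' T₁ T₂ w h h' ih =>
    obtain ⟨L, T, h1, h2, h3, h4⟩ := ih
    refine ⟨fun i => i.casesOn l L, fun i => i.casesOn T₁ T, rfl, ?_, ?_, ?_⟩
    · rintro (_ | i) hi
      · simp at hi
      · exact h2 i (by simpa using hi)
    · rintro (_ | i) s' hs'
      · simp only [List.getElem?_cons_zero, Option.some.injEq] at hs'
        subst hs'
        simpa [h1] using h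
      · have := h3 i s' (by simpa using hs')
        rwa [Nat.add_right_comm] at this
    · intro t
      rw [List.mem_append, h4]
      constructor
      · rintro (h | ⟨i, hi, h⟩)
        · exact ⟨0, by simp, h⟩
        · exact ⟨i + 1, by simpa using hi, h⟩
      · rintro ⟨_ | i, hi, h⟩
        · exact .inl h
        · exact .inr ⟨i, by simpa using hi, h⟩

theorem Trace.exists_labelling {E : List (Passage β)} {w : Word} (h : Trace 0 [] E [] w) :
    ∃ L T, Labelling w L T ∧ ∀ t, t ∈ E ↔ ∃ i < w.length, t ∈ T i := by
  obtain ⟨L, T, h1, h2, h3, h4⟩ := h.exists_levels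
  exact ⟨L, T, ⟨h1, h2, fun k s hs => by simpa using h3 k s hs⟩, h4⟩

/-- The point `x` has the label `e`, and its direction is the given one. -/
def At (L : ℕ → List (β × Bool)) (x : DirPoint) (e : β) : Prop := (L x.level)[x.pos]? = some (e, x.up)

section
variable {w : Word} {L : ℕ → List (β × Bool)} {T : ℕ → List (Passage β)}

theorem Labelling.at_of_mem (h : Labelling w L T) {k : ℕ} (hk : k < w.length) {x : DirPoint}
    {t : Option Bool} {e e' : β} (hx : (x, t, e, e') ∈ T k) : At L x e ∧ At L (travel w x) e' := by
  have hs : w[k]? = some w[k] := List.getElem?_eq_getElem hk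
  have hS := h.slice k _ hs
  generalize w[k] = s at hs hS
  generalize h0 : L k = l at hS
  generalize h1 : L (k + 1) = l' at hS
  generalize T k = Tk at hS hx
  cases hS with
  | virt => simp at hx
  | cap => simp at hx
  | cup A C f a b =>
    simp only [List.mem_singleton, Prod.mk.injEq] at hx
    obtain ⟨rfl, rfl, hx⟩ := hx
    cases f <;> simp at hx <;> obtain ⟨rfl, rfl⟩ := hx <;>
      simp [travel_down hs, Slice.fromAbove, leave, At, h1]
  | slash A C o u a c d b =>
    simp only [List.mem_cons, List.not_mem_nil, or_false, Prod.mk.injEq] at hx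
    rcases hx with ⟨rfl, rfl, hx⟩ | ⟨rfl, rfl, hx⟩
    · cases o <;> simp at hx <;> obtain ⟨rfl, rfl⟩ := hx <;>
        simp [travel_down hs, travel_up hs, Slice.fromAbove, Slice.fromBelow, leave, At, h0, h1]
    · cases u <;> simp at hx <;> obtain ⟨rfl, rfl⟩ := hx <;>
        simp [travel_down hs, travel_up hs, Slice.fromAbove, Slice.fromBelow, leave, At, h0, h1]

theorem Labelling.at_enters (h : Labelling w L T) {x : DirPoint} {e : β} (hx : At L x e) :
    ∃ k s, w[k]? = some s ∧ x.Enters k := by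
  obtain ⟨k, j, d⟩ := x
  unfold At at hx
  have h1 : k < w.length := by
    by_contra hk
    rw [h.top k (by omega)] at hx
    simp at hx
  have h2 : k ≠ 0 := by
    rintro rfl
    simp [h.bottom] at hx
  cases d
  · exact ⟨k - 1, w[k - 1], List.getElem?_eq_getElem _, .inr ⟨rfl, by simp; omega⟩⟩
  · exact ⟨k, w[k], List.getElem?_eq_getElem _, .inl ⟨rfl, rfl⟩⟩

/-- The number of steps that can be made before a passage or the end of the diagram. -/
def remaining (w : Word) (x : DirPoint) : ℕ :=
  -- Upward points get larger values than downward ones, so that turning at a maximum decreases the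
  -- value. Turning at a minimum is a passage and needs no decrease.
  if x.up then 2 * w.length + 1 - x.level else x.level

theorem SliceLabels.left {k : ℕ} {s : Slice} {l l' : List (β × Bool)} {T : List (Passage β)}
    (h : SliceLabels k s l l' T) {j : ℕ} (hj : j < s.pos) : l'[j]? = l[j]? := by
  cases h <;> simp only at hj <;> rw [List.getElem?_append_left hj, List.getElem?_append_left hj]

theorem SliceLabels.right {k : ℕ} {s : Slice} {l l' : List (β × Bool)} {T : List (Passage β)}
    (h : SliceLabels k s l l' T) (i : ℕ) :
    l'[s.pos + s.piece.outs + i]? = l[s.pos + s.piece.ins + i]? := by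
  cases h <;> simp only [Piece.ins, Piece.outs] <;>
    rw [List.getElem?_append_right (by omega), List.getElem?_append_right (by omega)] <;>
    simp [Nat.add_assoc, Nat.add_comm 2 i]

theorem Slice.fromBelow_left {s : Slice} {j : ℕ} (hj : j < s.pos) : s.fromBelow j = (j, true) := by
  simp [Slice.fromBelow, hj]

theorem Slice.fromAbove_left {s : Slice} {j : ℕ} (hj : j < s.pos) : s.fromAbove j = (j, false) := by
  simp [Slice.fromAbove, hj]

theorem Slice.fromBelow_right (s : Slice) (i : ℕ) :
    s.fromBelow (s.pos + s.piece.ins + i) = (s.pos + s.piece.outs + i, true) := by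
  obtain ⟨p, g⟩ := s
  cases g <;> simp [Slice.fromBelow, Piece.ins, Piece.outs] <;> grind

theorem Slice.fromAbove_right (s : Slice) (i : ℕ) :
    s.fromAbove (s.pos + s.piece.outs + i) = (s.pos + s.piece.ins + i, false) := by
  obtain ⟨p, g⟩ := s
  cases g <;> simp [Slice.fromAbove, Piece.ins, Piece.outs] <;> grind

theorem not_passes_up {k j : ℕ} {s : Slice} (hs : w[k]? = some s)
    (hj : j < s.pos ∨ s.pos + s.piece.ins ≤ j) :
    ¬ PassesOver w k ⟨k, j, true⟩ ∧ ¬ PassesUnder w k ⟨k, j, true⟩ := by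
  constructor <;> rintro ⟨p, ⟨h1, h2⟩ | ⟨h1, h2⟩⟩ <;> rw [hs] at h1 <;> cases h1 <;>
    simp [Piece.ins] at hj h2 <;> omega

theorem not_passes_down {k j : ℕ} {s : Slice} (hs : w[k]? = some s)
    (hj : j < s.pos ∨ s.pos + s.piece.outs ≤ j) :
    ¬ PassesOver w k ⟨k + 1, j, false⟩ ∧ ¬ PassesUnder w k ⟨k + 1, j, false⟩ := by
  constructor <;> rintro ⟨p, ⟨h1, h2⟩ | ⟨h1, h2⟩⟩ <;> rw [hs] at h1 <;> cases h1 <;>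
    simp [Piece.outs] at hj h2 <;> omega

theorem not_passes {k : ℕ} {s : Slice} (hs : w[k]? = some s) (h1 : s.piece ≠ .cross .slash)
    (h2 : s.piece ≠ .cross .backslash) (x : DirPoint) :
    ¬ PassesOver w k x ∧ ¬ PassesUnder w k x := by
  constructor <;> rintro ⟨p, ⟨h3, -⟩ | ⟨h3, -⟩⟩ <;> rw [hs] at h3 <;> cases h3 <;> simp at h1 h2

theorem position (j p n : ℕ) : j < p ∨ (∃ i, j = p + n + i) ∨ (p ≤ j ∧ j < p + n) := by
  by_cases h : p + n ≤ j
  · exact .inr (.inl ⟨j - p - n, by omega⟩)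
  · omega

/-- A traveller keeps the label or passes through a passage. -/
theorem Labelling.step (h : Labelling w L T) {x : DirPoint} {e : β} (hx : At L x e) :
    (At L (travel w x) e ∧ remaining w (travel w x) < remaining w x ∧
      ∀ k, ¬ PassesOver w k x ∧ ¬ PassesUnder w k x) ∨
    ∃ k < w.length, ∃ t e', (x, t, e, e') ∈ T k ∧ ((∃ k, PassesOver w k x) ↔ t = some true) ∧
      ((∃ k, PassesUnder w k x) ↔ t = some false) := by
  obtain ⟨k, s, hs, hk⟩ := h.at_enters hx
  have hk' : k < w.length := (List.getElem?_eq_some_iff.1 hs).1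
  have hS := h.slice k _ hs
  have ho : (∃ k, PassesOver w k x) ↔ PassesOver w k x := by
    constructor
    · rintro ⟨k', h⟩
      rwa [hk.unique h.enters]
    · exact fun h => ⟨k, h⟩
  have hu : (∃ k, PassesUnder w k x) ↔ PassesUnder w k x := by
    constructor
    · rintro ⟨k', h⟩
      rwa [hk.unique h.enters]
    · exact fun h => ⟨k, h⟩
  suffices hm : (At L (travel w x) e ∧ remaining w (travel w x) < remaining w x ∧
      ¬ PassesOver w k x ∧ ¬ PassesUnder w k x) ∨
      ∃ t e', (x, t, e, e') ∈ T k ∧ (PassesOver w k x ↔ t = some true) ∧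
        (PassesUnder w k x ↔ t = some false) by
    rcases hm with ⟨h1, h2, h3, h4⟩ | ⟨t, e', h1, h2, h3⟩
    · exact .inl ⟨h1, h2, fun k => ⟨fun h => h3 (ho.1 ⟨k, h⟩), fun h => h4 (hu.1 ⟨k, h⟩)⟩⟩
    · exact .inr ⟨k, hk', t, e', h1, ho.trans h2, hu.trans h3⟩
  clear ho hu
  obtain ⟨l, j, d⟩ := x
  generalize h0 : L k = l₀ at hS
  generalize h1 : L (k + 1) = l₁ at hS
  generalize T k = Tk at hS ⊢
  rcases hk with ⟨h2, h3⟩ | ⟨h2, h3⟩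
  · simp only at h2 h3
    subst h2 h3
    simp only [At, h0] at hx
    rw [travel_up hs]
    obtain hj | ⟨i, rfl⟩ | ⟨hj, hj'⟩ := position j s.pos s.piece.ins
    · rw [Slice.fromBelow_left hj]
      refine .inl ⟨?_, ?_, not_passes_up hs (.inl hj)⟩
      · simpa [leave, At, h1, hS.left hj] using hx
      · simp [leave, remaining]; omega
    · rw [Slice.fromBelow_right]
      refine .inl ⟨?_, ?_, not_passes_up hs (.inr (by omega))⟩
      · simpa [leave, At, h1, hS.right] using hx
      · simp [leave, remaining]; omega
    cases hS with
    | virt A C x y =>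
      obtain rfl | rfl : j = A.length ∨ j = A.length + 1 := by simp [Piece.ins] at hj hj'; omega
      all_goals
        refine .inl ⟨?_, ?_, not_passes hs (by simp) (by simp) _⟩
        · simpa [leave, At, h1, Slice.fromBelow] using hx
        · simp [leave, remaining, Slice.fromBelow]; omega
    | cap A C a d =>
      obtain rfl | rfl : j = A.length ∨ j = A.length + 1 := by simp [Piece.ins] at hj hj'; omega
      all_goals
        refine .inl ⟨?_, ?_, not_passes hs (by simp) (by simp) _⟩
        · simp at hx
          simp [leave, At, h0, Slice.fromBelow, hx]
        · simp [leave, remaining, Slice.fromBelow]; omega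
    | cup A C f a b => simp [Piece.ins] at hj hj'; omega
    | slash A C o u a c d b =>
      right
      obtain rfl | rfl : j = A.length ∨ j = A.length + 1 := by simp [Piece.ins] at hj hj'; omega
      · simp at hx
        obtain ⟨rfl, rfl⟩ := hx
        exact ⟨_, _, by simp; exact .inl ⟨rfl, rfl⟩, by simp [PassesOver, hs],
          by simp [PassesUnder, hs]⟩
      · simp at hx
        obtain ⟨rfl, rfl⟩ := hx
        exact ⟨_, _, by simp; exact .inr ⟨rfl, rfl⟩, by simp [PassesOver, hs],
          by simp [PassesUnder, hs]⟩
  · simp only at h2 h3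
    subst h2 h3
    simp only [At, h1] at hx
    rw [travel_down hs]
    obtain hj | ⟨i, rfl⟩ | ⟨hj, hj'⟩ := position j s.pos s.piece.outs
    · rw [Slice.fromAbove_left hj]
      refine .inl ⟨?_, ?_, not_passes_down hs (.inl hj)⟩
      · simpa [leave, At, h0, ← hS.left hj] using hx
      · simp [leave, remaining]
    · rw [Slice.fromAbove_right]
      refine .inl ⟨?_, ?_, not_passes_down hs (.inr (by omega))⟩
      · simpa [leave, At, h0, ← hS.right] using hx
      · simp [leave, remaining]
    cases hS with
    | virt A C x y =>
      obtain rfl | rfl : j = A.length ∨ j = A.length + 1 := by simp [Piece.outs] at hj hj'; omega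
      all_goals
        refine .inl ⟨?_, ?_, not_passes hs (by simp) (by simp) _⟩
        · simpa [leave, At, h0, Slice.fromAbove] using hx
        · simp [leave, remaining, Slice.fromAbove]
    | cap A C a d => simp [Piece.outs] at hj hj'; omega
    | cup A C f a b =>
      right
      have hn := not_passes hs (by simp) (by simp)
      obtain rfl | rfl : j = A.length ∨ j = A.length + 1 := by simp [Piece.outs] at hj hj'; omega
      · simp at hx
        obtain ⟨rfl, rfl⟩ := hx
        exact ⟨_, _, by simp; exact ⟨rfl, rfl⟩, by simp [hn], by simp [hn]⟩
      · simp at hx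
        obtain ⟨rfl, rfl⟩ := hx
        exact ⟨_, _, by simp; exact ⟨rfl, rfl⟩, by simp [hn], by simp [hn]⟩
    | slash A C o u a c d b =>
      right
      obtain rfl | rfl : j = A.length ∨ j = A.length + 1 := by simp [Piece.outs] at hj hj'; omega
      · simp at hx
        obtain ⟨rfl, rfl⟩ := hx
        exact ⟨_, _, by simp; exact .inr ⟨rfl, rfl⟩, by simp [PassesOver, hs],
          by simp [PassesUnder, hs]⟩
      · simp at hx
        obtain ⟨rfl, rfl⟩ := hx
        exact ⟨_, _, by simp; exact .inl ⟨rfl, rfl⟩, by simp [PassesOver, hs],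
          by simp [PassesUnder, hs]⟩

end

end

/-! ### Orientation and over-bridges of a labelled diagram -/

section
variable {β : Type*} {w : Word} {L : ℕ → List (β × Bool)} {T : ℕ → List (Passage β)}

/-- The directions that a labelling gives. -/
def labelled (L : ℕ → List (β × Bool)) : Set DirPoint := {x | ∃ e, At L x e}

theorem Labelling.isTangle_take (h : Labelling w L T) : ∀ k ≤ w.length,
    IsTangle 0 (w.take k) (L k).length := by
  intro k
  induction k with
  | zero => simp [h.bottom]
  | succ k ih =>
    intro hk
    have hs : w[k]? = some w[k] := List.getElem?_eq_getElem hk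
    have h1 := (h.slice k _ hs).length
    rw [List.take_succ_eq_append_getElem hk]
    refine (ih (by omega)).append ?_
    rw [isTangle_cons, isTangle_nil]
    omega

theorem Labelling.closed (h : Labelling w L T) : IsTangle 0 w 0 := by
  have := h.isTangle_take w.length le_rfl
  rwa [List.take_length, h.top _ le_rfl] at this

theorem Labelling.travel_mem (h : Labelling w L T) :
    ∀ x ∈ labelled L, travel w x ∈ labelled L := by
  rintro x ⟨e, hx⟩
  rcases h.step hx with ⟨h1, -⟩ | ⟨k, hk, t, e', h1, -⟩
  · exact ⟨e, h1⟩
  · exact ⟨e', (h.at_of_mem hk h1).2⟩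

theorem Labelling.iterate_mem (h : Labelling w L T) {x : DirPoint} (hx : x ∈ labelled L) (n : ℕ) :
    (travel w)^[n] x ∈ labelled L :=
  Set.MapsTo.iterate (fun x hx => h.travel_mem x hx) n hx

theorem Labelling.injOn (h : Labelling w L T) : Set.InjOn (travel w) (labelled L) := by
  rintro x ⟨e, hx⟩ y ⟨f, hy⟩ hxy
  obtain ⟨k, s, hs, hk⟩ := h.at_enters hx
  obtain ⟨k', s', hs', hk'⟩ := h.at_enters hy
  have h1 := (travel_rev_aux hs hk).2
  rw [hxy, (travel_rev_aux hs' hk').2] at h1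
  rw [← DirPoint.rev_rev x, ← h1, DirPoint.rev_rev]

theorem Labelling.isPoint (h : Labelling w L T) {x : DirPoint} (hx : x ∈ labelled L) :
    IsPoint w x.level x.pos := by
  obtain ⟨e, hx⟩ := hx
  have h1 : x.level < w.length := by
    by_contra hk
    rw [At, h.top _ (by omega)] at hx
    simp at hx
  exact ⟨_, h.isTangle_take _ h1.le, (List.getElem?_eq_some_iff.1 hx).1⟩

theorem Labelling.finite (h : Labelling w L T) : (labelled L).Finite := by
  refine (((Finset.range w.length).finite_toSet.biUnion fun k _ =>
    ((Finset.range (L k).length ×ˢ (Finset.univ : Finset Bool)).finite_toSet.image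
      fun y => (⟨k, y.1, y.2⟩ : DirPoint)))).subset ?_
  rintro x hx
  have h1 := h.isPoint hx
  have h2 := h1.level_lt h.closed
  have h3 := h1.width (h.isTangle_take _ h2.le)
  simp only [Set.mem_iUnion]
  exact ⟨x.level, by simpa using h2, (x.pos, x.up), by simpa using h3, rfl⟩

/-- A traveller gets to a passage, without a change of the label. -/
theorem Labelling.exists_passage (h : Labelling w L T) {x : DirPoint} {e : β} (hx : At L x e) :
    ∃ n, ∃ k < w.length, ∃ t e', ((travel w)^[n] x, t, e, e') ∈ T k := by
  induction hr : remaining w x using Nat.strong_induction_on generalizing x with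
  | _ r ih =>
    rcases h.step hx with ⟨h1, h2, -⟩ | ⟨k, hk, t, e', h1, -⟩
    · obtain ⟨n, hn⟩ := ih _ (hr ▸ h2) h1 rfl
      exact ⟨n + 1, hn⟩
    · exact ⟨0, k, hk, t, e', h1⟩

/-- Two iterates coincide because the set of points is finite; injectivity cancels their common
initial steps. -/
theorem Labelling.exists_return (h : Labelling w L T) {x : DirPoint} (hx : x ∈ labelled L) :
    ∃ m > 0, (travel w)^[m] x = x := by
  have h1 : ∀ i, (travel w)^[i] x ∈ labelled L := h.iterate_mem hx
  obtain ⟨i, -, j, -, hij, he⟩ := Set.infinite_univ.exists_ne_map_eq_of_mapsTo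
    (f := fun i : ℕ => (travel w)^[i] x) (t := labelled L) (fun i _ => h1 i) h.finite
  wlog hlt : i < j generalizing i j
  · exact this j i hij.symm he.symm (by omega)
  obtain ⟨m, rfl⟩ := Nat.exists_eq_add_of_lt hlt
  refine ⟨m + 1, by omega, ?_⟩
  have h2 : ∀ i, (travel w)^[i] ((travel w)^[m + 1] x) = (travel w)^[i] x →
      (travel w)^[m + 1] x = x := by
    intro i
    induction i with
    | zero => exact id
    | succ i ih =>
      intro h3
      rw [Function.iterate_succ_apply' _ i, Function.iterate_succ_apply' _ i] at h3
      refine ih (h.injOn ?_ (h1 _) h3)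
      rw [← Function.iterate_add_apply]
      exact h1 _
  refine h2 i ?_
  rw [← Function.iterate_add_apply]
  simpa [Nat.add_assoc] using he.symm

/-- All passages of a labelling, where each label is the beginning of one passage at most and can be
reached from each other label. -/
structure Labelling.Connected (w : Word) (T : ℕ → List (Passage β)) (E : List (Passage β)) :
    Prop where
  mem : ∀ t, t ∈ E ↔ ∃ i < w.length, t ∈ T i
  nodup : (E.map fun t => t.2.2.1).Nodup
  reach : ∀ e ∈ E, ∀ f ∈ E,
    Relation.ReflTransGen (fun a b => ∃ x t, (x, t, a, b) ∈ E) e.2.2.1 f.2.2.1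

theorem Labelling.Connected.eq {E : List (Passage β)} (hE : Labelling.Connected w T E)
    {s t : Passage β} (hs : s ∈ E) (ht : t ∈ E) (h : s.2.2.1 = t.2.2.1) : s = t :=
  List.inj_on_of_nodup_map hE.nodup hs ht h

/-- Every traveller reaches a passage, and passages follow each other as prescribed by the labels,
which are connected. This leads from any point to a passage on the way from any other, and
periodicity does the rest. -/
theorem Labelling.isOrientation (h : Labelling w L T) {E : List (Passage β)}
    (hE : Labelling.Connected w T E) (hne : E ≠ []) : IsOrientation w (labelled L) where
  isPoint _ hx := h.isPoint hx
  existsUnique := by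
    rintro k j hkj
    have h1 := hkj.level_lt h.closed
    have h2 := hkj.width (h.isTangle_take _ h1.le)
    refine ⟨(L k)[j].2, ⟨(L k)[j].1, by simp [At, List.getElem?_eq_getElem h2]⟩, ?_⟩
    rintro d ⟨e, he⟩
    simp only [At, List.getElem?_eq_getElem h2, Option.some.injEq] at he
    rw [he]
  travel_mem := h.travel_mem
  nonempty := by
    obtain ⟨⟨x, t, e, e'⟩, hx⟩ := List.exists_mem_of_ne_nil E hne
    obtain ⟨k, hk, hx⟩ := (hE.mem _).1 hx
    exact ⟨x, e, (h.at_of_mem hk hx).1⟩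
  connected := by
    have h1 : ∀ x ∈ labelled L, ∃ n, ∃ t e e', ((travel w)^[n] x, t, e, e') ∈ E := by
      rintro x ⟨e, hx⟩
      obtain ⟨n, k, hk, t, e', hn⟩ := h.exists_passage hx
      exact ⟨n, t, e, e', (hE.mem _).2 ⟨k, hk, hn⟩⟩
    have h2 : ∀ x t e e', (x, t, e, e') ∈ E → ∀ f,
        Relation.ReflTransGen (fun a b => ∃ x t, (x, t, a, b) ∈ E) e f →
        ∀ y t' f', (y, t', f, f') ∈ E → ∃ n, (travel w)^[n] x = y := by
      intro x t e e' hx f hef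
      induction hef using Relation.ReflTransGen.head_induction_on generalizing x t e' with
      | refl =>
        intro y t' f' hy
        have := hE.eq hx hy rfl
        simp only [Prod.mk.injEq] at this
        exact ⟨0, this.1⟩
      | head hac hcb ih =>
        rename_i a c
        intro y t' f' hy
        obtain ⟨x', t'', hx'⟩ := hac
        have := hE.eq hx hx' rfl
        simp only [Prod.mk.injEq] at this
        obtain ⟨rfl, rfl, -, rfl⟩ := this
        obtain ⟨k, hk, hx⟩ := (hE.mem _).1 hx
        obtain ⟨n, k', hk', t₂, e₂, hn⟩ := h.exists_passage (h.at_of_mem hk hx).2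
        obtain ⟨m, hm⟩ := ih _ _ _ ((hE.mem _).2 ⟨k', hk', hn⟩) y t' f' hy
        exact ⟨m + n + 1, by rw [Function.iterate_add_apply, Function.iterate_add_apply]; exact hm⟩
    intro x hx y hy
    obtain ⟨n, t, e, e', hn⟩ := h1 x hx
    obtain ⟨m, t', f, f', hm⟩ := h1 y hy
    obtain ⟨i, hi⟩ := h2 _ _ _ _ hn f (hE.reach _ hn _ hm) _ _ _ hm
    obtain ⟨r, hr, hr'⟩ := h.exists_return hy
    have h3 : ∀ s, (travel w)^[r * s] y = y := by
      intro s
      rw [Function.iterate_mul]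
      exact Function.iterate_fixed hr' s
    -- The walk arrives at the passage that is `m` steps behind `y`. Another `r * m - m` steps
    -- complete `m` full periods of length `r`, hence end at `y`.
    refine ⟨r * m - m + (i + n), ?_⟩
    rw [Function.iterate_add_apply, Function.iterate_add_apply, hi, ← Function.iterate_add_apply,
      Nat.sub_add_cancel (Nat.le_mul_of_pos_left m hr), h3]

/-- A bound for the number of over-bridges: if `inP` holds behind each under-strand, is preserved
except at labels of `M`, and does not hold before over-strands, then there is a label of `M` behind
the beginning of each over-bridge. -/
theorem Labelling.overBridges_le [DecidableEq β] (h : Labelling w L T) {E : List (Passage β)}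
    (hE : ∀ t, t ∈ E ↔ ∃ i < w.length, t ∈ T i) (ht : (E.map fun t => t.2.2.2).Nodup)
    {inP outP : β → Prop} {M : Finset β}
    (h0 : ∀ x a b, (x, none, a, b) ∈ E → inP a → outP b)
    (h1 : ∀ x a b, (x, some true, a, b) ∈ E → ¬ inP a)
    (h2 : ∀ x a b, (x, some false, a, b) ∈ E → outP b)
    (h3 : ∀ x t a b, (x, t, a, b) ∈ E → b ∉ M → outP b → inP b) :
    {x | x ∈ labelled L ∧ StartsOverBridge w x}.ncard ≤ M.card := by
  classical
  -- If no label of `M` were met between the undercrossing and the next one, `inP` would persist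
  -- from the undercrossing up to the first overcrossing of the bridge, where it is excluded.
  have key : ∀ x ∈ labelled L, StartsOverBridge w x → ∃ b ∈ M, ∃ i t a,
      ((travel w)^[i] x, t, a, b) ∈ E ∧
      ∀ j, 0 < j → j ≤ i → ¬ ∃ k, PassesUnder w k ((travel w)^[j] x) := by
    rintro x ⟨e, hx⟩ ⟨hxu, m, hm, hmo, hmu⟩
    by_contra hcon
    push Not at hcon
    have hno : ∀ i < m, ∀ t a b, ((travel w)^[i] x, t, a, b) ∈ E → b ∉ M := by
      intro i hi t a b hb hbM
      obtain ⟨j, hj, hji, hju⟩ := hcon b hbM i t a hb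
      exact hmu j hj (by omega) hju
    have hpos : ∀ i, 0 < i → i ≤ m → ∃ f, At L ((travel w)^[i] x) f ∧ inP f := by
      intro i hi
      induction i, hi using Nat.le_induction with
      | base =>
        intro _
        rcases h.step hx with ⟨-, -, h4⟩ | ⟨k, hk, t, e', h4, -, h5⟩
        · obtain ⟨k, hk⟩ := hxu
          exact absurd hk (h4 k).2
        · obtain rfl := h5.1 hxu
          have h6 := (hE _).2 ⟨k, hk, h4⟩
          exact ⟨e', (h.at_of_mem hk h4).2, h3 _ _ _ _ h6 (hno 0 hm _ _ _ h6) (h2 _ _ _ h6)⟩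
      | succ i hi ih =>
        intro him
        obtain ⟨f, hf, hfp⟩ := ih (by omega)
        rw [Function.iterate_succ_apply']
        rcases h.step hf with ⟨h4, -, -⟩ | ⟨k, hk, t, e', h4, h5, h6⟩
        · exact ⟨f, h4, hfp⟩
        · have h7 := (hE _).2 ⟨k, hk, h4⟩
          refine ⟨e', (h.at_of_mem hk h4).2, h3 _ _ _ _ h7 (hno i (by omega) _ _ _ h7) ?_⟩
          rcases t with _ | _ | _
          · exact h0 _ _ _ h7 hfp
          · exact absurd (h6.2 rfl) (hmu i hi (by omega))
          · exact absurd hfp (h1 _ _ _ h7)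
    obtain ⟨f, hf, hfp⟩ := hpos m hm le_rfl
    rcases h.step hf with ⟨-, -, h4⟩ | ⟨k, hk, t, e', h4, h5, -⟩
    · obtain ⟨k, hk⟩ := hmo
      exact (h4 k).1 hk
    · obtain rfl := h5.1 hmo
      exact h1 _ _ _ ((hE _).2 ⟨k, hk, h4⟩) hfp
  rcases {x | x ∈ labelled L ∧ StartsOverBridge w x}.eq_empty_or_nonempty with he | ⟨x, ⟨e, -⟩, -⟩
  · simp [he]
  have : Nonempty β := ⟨e⟩
  choose! φ hφM hφ using key
  rw [← Set.ncard_coe_finset]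
  refine Set.ncard_le_ncard_of_injOn φ (fun x hx => hφM x hx.1 hx.2) ?_ M.finite_toSet
  rintro x ⟨hx, hxs⟩ y ⟨hy, hys⟩ hxy
  obtain ⟨i, t, a, h4, h5⟩ := hφ x hx hxs
  obtain ⟨j, t', a', h6, h7⟩ := hφ y hy hys
  rw [hxy] at h4
  have h8 := List.inj_on_of_nodup_map ht h4 h6 rfl
  simp only [Prod.mk.injEq] at h8
  have h9 := h8.1
  clear h4 h6 h8 hxy
  wlog hij : i ≤ j generalizing x y i j
  · exact (this hy hys hx hxs j h7 i h5 h9.symm (by omega)).symm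
  -- If two over-bridges had the same label of `M`, one starting point would lie on the way from the
  -- other to this label. Unless they agree, that is an undercrossing in the interior of the arc.
  have h10 : ∀ i j, i ≤ j → (travel w)^[i] x = (travel w)^[j] y → x = (travel w)^[j - i] y := by
    intro i
    induction i with
    | zero => exact fun j _ => id
    | succ i ih =>
      intro j hij h11
      obtain ⟨j, rfl⟩ : ∃ j', j = j' + 1 := ⟨j - 1, by omega⟩
      rw [Function.iterate_succ_apply', Function.iterate_succ_apply'] at h11
      rw [Nat.add_sub_add_right]
      exact ih j (by omega) (h.injOn (h.iterate_mem hx i) (h.iterate_mem hy j) h11)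
  have h11 := h10 i j hij h9
  rcases Nat.eq_zero_or_pos (j - i) with h12 | h12
  · rw [h12] at h11; exact h11
  · exact absurd (h11 ▸ hxs.1) (h7 (j - i) h12 (by omega))

end

/-! ### Labels and directions along the diagram of a list of boxes -/

section
variable {α : Type*}

/-- The directions at the ends of a box, upwards where a strand ends. -/
def Box.signed : Box α → List (α × Bool)
  | bivalent e a b => [(a, !e), (b, e)]
  | crossing o u a c d b => [(a, !o), (c, u), (d, o), (b, !u)]

theorem Box.signed_fst (b : Box α) : b.signed.map Prod.fst = b.ports := by
  cases b <;> rfl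

/-- The strands in the tangle of a box, where the strands of a crossing get further labels between
the crossing and the local minima. -/
def Box.expand : Box α → List (Option Bool × (α ⊕ α) × (α ⊕ α))
  | bivalent e a b => [(none, dir e (.inl a) (.inl b))]
  | crossing o u a c d b =>
    [(none, dir o (.inl a) (.inr (dir o a d).1)), (none, dir (!u) (.inr (dir u b c).1) (.inl b)),
      (some true, dir o (.inr (dir o a d).1) (.inl d)),
      (some false, dir u (.inr (dir u b c).1) (.inl c))]

/-- The strands in the tangles of all boxes of a list. -/
def expand (B : List (Box α)) : List (Option Bool × (α ⊕ α) × (α ⊕ α)) := B.flatMap Box.expand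

/-- A label of a box as a label of the tangle. -/
def lift (x : α × Bool) : (α ⊕ α) × Bool := (.inl x.1, x.2)

/-- Each strand of a crossing box also runs through a minimum, whose inner end carries an `inr`
label named after the beginning of the strand. The second minimum has its inner end on the left,
whence the direction `!u`. -/
theorem Box.trace (b : Box α) (S : List (α × Bool)) (k : ℕ) :
    ∃ E, E.map Prod.snd = b.expand ∧
      Trace k (S.map lift) E ((S ++ b.signed).map lift) (Word.shift S.length b.word) := by
  cases b with
  | bivalent e a b =>
    have h := SliceLabels.cup (k := k) (S.map lift) [] e (.inl a) (.inl b)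
    simp only [List.append_nil, List.length_map] at h
    refine ⟨_, ?_, .cons (T' := []) h ?_⟩
    · rfl
    · simpa [Box.signed, lift] using Trace.nil (k + 1) _
  | crossing o u a c d b =>
    have h1 := SliceLabels.cup (k := k) (S.map lift) [] o (.inl a) (.inr (dir o a d).1)
    have h2 := SliceLabels.cup (k := k + 1) (S.map lift ++ [(.inl a, !o), (.inr (dir o a d).1, o)]) []
      (!u) (.inr (dir u b c).1) (.inl b)
    have h3 := SliceLabels.slash (k := k + 1 + 1) (S.map lift ++ [(.inl a, !o)]) [(.inl b, !u)] o u
      (.inr (dir o a d).1) (.inl c) (.inl d) (.inr (dir u b c).1)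
    simp only [List.append_nil, List.length_map, List.length_append, List.length_cons,
      List.length_nil, List.append_assoc, List.cons_append, List.nil_append, Bool.not_not] at h1 h2 h3
    refine ⟨_, ?_, .cons h1 (.cons h2 (.cons (T' := []) h3 ?_))⟩
    · rfl
    · simpa [Box.signed, lift] using Trace.nil (k + 1 + 1 + 1) _

/-- Each label of `T` occurs once with each direction. -/
def Balanced (S : List (α × Bool)) (T : List α) : Prop :=
  T.Nodup ∧ S.Perm (T.map (·, true) ++ T.map (·, false))

theorem Balanced.matches {S : List (α × Bool)} {T : List α} (h : Balanced S T) :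
    Matches (S.map Prod.fst) T := by
  refine ⟨h.1, (h.2.map _).trans ?_⟩
  simp [Function.comp_def]

variable [DecidableEq α]

theorem exists_trace_pull {c : α} {S : List (α × Bool)} : ∀ {P : List (α × Bool)},
    c ∈ S.map Prod.fst → ∃ d S', S'.map Prod.fst = (S.map Prod.fst).erase c ∧
      S.Perm ((c, d) :: S') ∧
      ∀ k, Trace k ((P ++ S).map lift) [] ((P ++ (c, d) :: S').map lift)
        (pull P.length ((S.map Prod.fst).idxOf c)) := by
  induction S with
  | nil => intro P h; simp at h
  | cons x S ih =>
    intro P h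
    by_cases hx : x.1 = c
    · subst hx
      exact ⟨x.2, S, by simp, .refl _, fun k => by simpa using Trace.nil k _⟩
    · have hc : c ∈ S.map Prod.fst := by
        rw [List.map_cons, List.mem_cons] at h
        exact h.resolve_left (Ne.symm hx)
      obtain ⟨d, S', h1, h2, h3⟩ := ih (P := P ++ [x]) hc
      refine ⟨d, x :: S', ?_, (h2.cons x).trans (.swap _ _ _), fun k => ?_⟩
      · rw [List.map_cons, List.map_cons, List.erase_cons_tail (by simpa using hx), h1]
      · rw [List.map_cons, List.idxOf_cons_ne _ hx, Nat.succ_eq_one_add, pull_add]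
        have h4 := h3 k
        simp only [List.length_append, List.length_cons, List.length_nil, List.append_assoc,
          List.cons_append, List.nil_append, Nat.zero_add] at h4
        refine h4.append (T' := []) ?_
        have h5 := SliceLabels.virt (k := k + (pull (P.length + 1) ((S.map Prod.fst).idxOf c)).length)
          (P.map lift) (S'.map lift) (lift x) (lift (c, d))
        rw [List.length_map] at h5
        have := Trace.cons (T' := []) h5 (Trace.nil _ _)
        simpa [pull, vx] using this

/-- A label occurs once with each direction, so the maximum that joins its two ends is traversed
consistently. Virtual crossings and maxima contribute no passages. -/
theorem trace_joinIn : ∀ (T : List α) (S : List (α × Bool)) (k : ℕ), Balanced S T →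
    Trace k (S.map lift) [] [] (joinIn (S.map Prod.fst) T) := by
  intro T
  induction T with
  | nil =>
    intro S k h
    have : S = [] := by simpa using h.2
    subst this
    exact .nil _ _
  | cons c T ih =>
    intro S k h
    obtain ⟨m1, m2, -⟩ := h.matches.erase
    obtain ⟨d, S₁, h1, h2, h3⟩ := exists_trace_pull (P := []) m1
    rw [← h1] at m2
    obtain ⟨d', S₂, h4, h5, h6⟩ := exists_trace_pull (P := [(c, d)]) m2
    have h7 := (h2.trans (h5.cons _)).symm.trans h.2
    have h8 : d' = !d := by
      have h9 := List.perm_iff_count.1 h7 (c, d)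
      have h10 : (T.map (·, d)).count (c, d) = 0 := by
        rw [List.count_eq_zero]
        simpa using (List.nodup_cons.1 h.1).1
      have h11 : ∀ e, e ≠ d → (T.map (·, e)).count (c, d) = 0 := by
        intro e he
        rw [List.count_eq_zero]
        simp only [List.mem_map, not_exists, Prod.mk.injEq]
        rintro x ⟨-, -, h⟩
        exact he h
      cases d <;> cases d' <;> simp_all
    subst h8
    have h9 : Balanced S₂ T := by
      refine ⟨(List.nodup_cons.1 h.1).2, List.perm_iff_count.2 fun z => ?_⟩
      have := List.perm_iff_count.1 h7 z
      cases d <;> simp only [List.map_cons, List.count_cons, List.count_append, List.cons_append,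
        Bool.not_true, Bool.not_false] at this ⊢ <;> omega
    rw [joinIn, ← h1, ← h4]
    refine (h3 k).append (T := []) ((h6 _).append (T := []) ?_)
    refine .cons (T := []) ?_ (ih S₂ _ h9)
    exact .cap [] (S₂.map lift) (Sum.inl c) d

theorem trace_diagram : ∀ (B : List (Box α)) (S : List (α × Bool)) (T : List α) (k : ℕ),
    Balanced (S ++ B.flatMap Box.signed) T → ∃ E, E.map Prod.snd = expand B ∧
      Trace k (S.map lift) E [] (diagram (S.map Prod.fst) B) := by
  intro B
  induction B with
  | nil =>
    intro S T k h
    rw [List.flatMap_nil, List.append_nil] at h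
    have h1 := h.matches
    refine ⟨[], rfl, trace_joinIn _ _ _ ⟨List.nodup_dedup _, h.2.trans ?_⟩⟩
    have h2 : T.Perm (S.map Prod.fst).dedup := by
      refine (List.perm_ext_iff_of_nodup h1.1 (List.nodup_dedup _)).2 fun c => ?_
      rw [List.mem_dedup, h1.2.mem_iff, List.mem_append, or_self]
    exact (h2.map _).append (h2.map _)
  | cons b B ih =>
    intro S T k h
    obtain ⟨E, h1, h2⟩ := b.trace S k
    obtain ⟨E', h3, h4⟩ := ih (S ++ b.signed) T (k + (Word.shift S.length b.word).length)
      (by simpa using h)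
    rw [List.map_append (f := Prod.fst), Box.signed_fst] at h4
    refine ⟨E ++ E', by rw [List.map_append, h1, h3]; rfl, ?_⟩
    rw [diagram, List.length_map]
    exact h2.append h4

/-- Every label ends one strand, where the direction is upwards, and begins another, where it is
downwards. -/
theorem Calibration.balanced {n : ℕ} {B : List (Box α)} {p q : α → ℕ} {M : Finset α}
    (h : Calibration n B p q M) : Balanced (B.flatMap Box.signed) (sources B) := by
  refine ⟨h.nodup, List.Perm.trans ?_ (List.Perm.append (h.perm.symm.map _) (.refl _))⟩
  clear h
  induction B with
  | nil => exact .refl _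
  | cons b B ih =>
    have h1 : b.signed.Perm ((b.strands.map Prod.snd).map (·, true) ++
        (b.strands.map Prod.fst).map (·, false)) := by
      refine List.perm_iff_count.2 fun z => ?_
      rcases b with ⟨_ | _, _, _⟩ | ⟨_ | _, _ | _, _, _, _, _⟩ <;>
        simp only [Box.signed, Box.strands, dir_true, dir_false, List.map_cons, List.map_nil,
          List.count_append, List.count_cons, List.count_nil, Bool.not_true, Bool.not_false] <;> omega
    have h2 := List.perm_iff_count.1 ih
    have h3 := List.perm_iff_count.1 h1
    refine List.perm_iff_count.2 fun z => ?_
    have h2 := h2 z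
    have h3 := h3 z
    simp only [sources, targets, strands_cons, List.flatMap_cons, List.map_append,
      List.count_append] at *
    omega

end

/-! ### From a sorted calibration to a bound for over-bridges -/

section
variable {α : Type*} {B : List (Box α)}

theorem mem_expand {t : Option Bool × (α ⊕ α) × (α ⊕ α)} :
    t ∈ expand B ↔ ∃ b ∈ B, t ∈ b.expand := by
  simp [expand]

instance [DecidableEq α] : LawfulBEq (α ⊕ α) where
  eq_of_beq {a b} h := by
    cases a <;> cases b
    · exact congrArg _ (eq_of_beq (show (_ == _) = true from h))
    · exact absurd (show false = true from h) (by decide)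
    · exact absurd (show false = true from h) (by decide)
    · exact congrArg _ (eq_of_beq (show (_ == _) = true from h))
  rfl {a} := by
    cases a <;> exact beq_self_eq_true (α := α) _

theorem count_expand_inl [DecidableEq α] (B : List (Box α)) (z : α) :
    ((expand B).map fun t => t.2.1).count (.inl z) = (sources B).count z ∧
      ((expand B).map fun t => t.2.2).count (.inl z) = (targets B).count z ∧
      ((expand B).map fun t => t.2.1).count (.inr z) ≤ (sources B).count z ∧
      ((expand B).map fun t => t.2.2).count (.inr z) ≤ (sources B).count z := by
  induction B with
  | nil => simp [expand, sources, targets]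
  | cons b B ih =>
    simp only [expand, List.flatMap_cons, sources, targets, strands_cons, List.map_append,
      List.count_append] at ih ⊢
    rcases b with ⟨_ | _, _, _⟩ | ⟨_ | _, _ | _, _, _, _, _⟩ <;>
      simp [Box.expand, Box.strands, List.count_cons] at ih ⊢ <;> omega

/-- A traveller gets from the first label to the second one. -/
abbrev Leads (B : List (Box α)) : α ⊕ α → α ⊕ α → Prop :=
  Relation.ReflTransGen fun a b => ∃ t, (t, a, b) ∈ expand B

theorem leads_of_mem {b : Box α} (hb : b ∈ B) {s t : α} (h : (s, t) ∈ b.strands) :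
    Leads B (.inl s) (.inl t) := by
  have h1 : ∀ {x y : α ⊕ α} {t : Option Bool}, (t, x, y) ∈ b.expand → Leads B x y :=
    fun hx => .single ⟨_, mem_expand.2 ⟨b, hb, hx⟩⟩
  cases b with
  | bivalent e a b =>
    cases e <;> simp at h <;> obtain ⟨rfl, rfl⟩ := h <;> exact h1 (t := none) (by simp [Box.expand])
  | crossing o u a c d b =>
    simp only [Box.strands_crossing, List.mem_cons, List.not_mem_nil, or_false] at h
    rcases h with h | h
    · cases o <;> simp at h <;> obtain ⟨rfl, rfl⟩ := h
      · exact (h1 (t := some true) (y := .inr s) (by simp [Box.expand])).trans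
          (h1 (t := none) (by simp [Box.expand]))
      · exact (h1 (t := none) (y := .inr s) (by simp [Box.expand])).trans
          (h1 (t := some true) (by simp [Box.expand]))
    · cases u <;> simp at h <;> obtain ⟨rfl, rfl⟩ := h
      · exact (h1 (t := some false) (y := .inr s) (by simp [Box.expand])).trans
          (h1 (t := none) (by simp [Box.expand]))
      · exact (h1 (t := none) (y := .inr s) (by simp [Box.expand])).trans
          (h1 (t := some false) (by simp [Box.expand]))

theorem exists_leads {t : Option Bool × (α ⊕ α) × (α ⊕ α)} (ht : t ∈ expand B) :
    ∃ s ∈ strands B, Leads B (.inl s.1) t.2.1 ∧ Leads B t.2.1 (.inl s.2) := by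
  obtain ⟨b, hb, ht⟩ := mem_expand.1 ht
  have h1 : ∀ {x y : α ⊕ α} {t : Option Bool}, (t, x, y) ∈ b.expand → Leads B x y :=
    fun hx => .single ⟨_, mem_expand.2 ⟨b, hb, hx⟩⟩
  have h2 : ∀ {s}, s ∈ b.strands → t.2.1 = .inl s.1 →
      ∃ s ∈ strands B, Leads B (.inl s.1) t.2.1 ∧ Leads B t.2.1 (.inl s.2) := by
    intro s hs h
    exact ⟨s, mem_strands.2 ⟨b, hb, hs⟩, by rw [h], by rw [h]; exact leads_of_mem hb hs⟩
  have h3 : ∀ {s t₁ t₂}, s ∈ b.strands → t.2.1 = .inr s.1 → (t₁, Sum.inl s.1, t.2.1) ∈ b.expand →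
      (t₂, t.2.1, Sum.inl s.2) ∈ b.expand →
      ∃ s ∈ strands B, Leads B (.inl s.1) t.2.1 ∧ Leads B t.2.1 (.inl s.2) :=
    fun hs h h' h'' => ⟨_, mem_strands.2 ⟨b, hb, hs⟩, h1 h', h1 h''⟩
  cases b with
  | bivalent e a b =>
    simp only [Box.expand, List.mem_singleton] at ht
    subst ht
    refine h2 (s := dir e a b) (by simp) (by cases e <;> rfl)
  | crossing o u a c d b =>
    have ho : dir o a d ∈ (Box.crossing o u a c d b).strands := by simp
    have hu : dir u b c ∈ (Box.crossing o u a c d b).strands := by simp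
    simp only [Box.expand, List.mem_cons, List.not_mem_nil, or_false] at ht
    rcases ht with rfl | rfl | rfl | rfl
    · cases o
      · exact h3 (t₁ := some true) (t₂ := none) ho rfl (by simp [Box.expand]) (by simp [Box.expand])
      · exact h2 ho rfl
    · cases u
      · exact h3 (t₁ := some false) (t₂ := none) hu rfl (by simp [Box.expand]) (by simp [Box.expand])
      · exact h2 hu rfl
    · cases o
      · exact h2 ho rfl
      · exact h3 (t₁ := none) (t₂ := some true) ho rfl (by simp [Box.expand]) (by simp [Box.expand])
    · cases u
      · exact h2 hu rfl
      · exact h3 (t₁ := none) (t₂ := some false) hu rfl (by simp [Box.expand]) (by simp [Box.expand])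

variable {n : ℕ} {p q : α → ℕ} {M : Finset α}

theorem Calibration.leads (h : Calibration n B p q M) {s t : Option Bool × (α ⊕ α) × (α ⊕ α)}
    (hs : s ∈ expand B) (ht : t ∈ expand B) : Leads B s.2.1 t.2.1 := by
  obtain ⟨x, hx, -, hx'⟩ := exists_leads hs
  obtain ⟨y, hy, hy', -⟩ := exists_leads ht
  have h1 : x.2 ∈ sources B := h.perm.mem_iff.2 (List.mem_map_of_mem hx)
  have h2 := h.reach _ h1 y.1 (List.mem_map_of_mem hy)
  refine hx'.trans (Relation.ReflTransGen.trans ?_ hy')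
  generalize y.1 = z at h2
  clear hx' hy' hy h1
  induction h2 with
  | refl => exact .refl
  | tail _ hbc ih =>
    obtain ⟨b, hb, hbc⟩ := mem_strands.1 hbc
    exact ih.trans (leads_of_mem hb hbc)

/-- Whether heads are left behind a label. -/
def Blocked (B : List (Box α)) (f : α → ℕ) (p : α → ℕ) : α ⊕ α → Prop
  | .inl e => 0 < f e
  | .inr e => 0 < p e ∨ ∃ o a d b, .crossing o false a e d b ∈ B

/-- An intermediate label named after a free over-strand could be blocked only if an under-strand
began at the same label. Then it would be the same strand, whose number would be 0 and positive at
its end. -/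
theorem Calibration.not_blocked (h : Calibration n B p q M)
    (hz : ∀ o u a c d b, .crossing o u a c d b ∈ B → p (dir o a d).1 = 0) {o u : Bool} {a c d b : α}
    (hb : .crossing o u a c d b ∈ B) : ¬ Blocked B p p (.inr (dir o a d).1) := by
  rintro (h1 | ⟨o', a', d', b', h1⟩)
  · have := hz _ _ _ _ _ _ hb; omega
  · have h2 : (dir o a d).2 = b' := by
      refine h.snd_eq (f := (dir o a d).1) (mem_strands.2 ⟨_, hb, by simp⟩)
        (mem_strands.2 ⟨_, h1, by simp⟩)
    have h3 := (h.flow _ hb).1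
    have h4 := (h.flow _ h1).2
    have h5 := hz _ _ _ _ _ _ hb
    simp only [dir_false] at h4
    rw [h2] at h3
    omega

variable [DecidableEq α]

theorem Calibration.nodup_expand (h : Calibration n B p q M) :
    ((expand B).map fun t => t.2.1).Nodup ∧ ((expand B).map fun t => t.2.2).Nodup := by
  have h1 := fun z => List.nodup_iff_count_le_one.1 h.nodup z
  have h2 := fun z => h.perm.count_eq z
  constructor <;> refine List.nodup_iff_count_le_one.2 ?_ <;> rintro (z | z) <;>
    have h3 := count_expand_inl B z <;> have h1 := h1 z <;> have h2 := h2 z <;> omega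

/-- A calibration where all over-strands are free gives a diagram with few over-bridges. -/
theorem Calibration.exists_orientation (h : Calibration n B p q M) (hne : B ≠ [])
    (hz : ∀ o u a c d b, .crossing o u a c d b ∈ B → p (dir o a d).1 = 0) :
    IsTangle 0 (diagram [] B) 0 ∧ ∃ O, IsOrientation (diagram [] B) O ∧
      {x | x ∈ O ∧ StartsOverBridge (diagram [] B) x}.ncard ≤ n := by
  obtain ⟨E, h1, h2⟩ := trace_diagram B [] _ 0 (by simpa using h.balanced)
  obtain ⟨L, T, hL, hE⟩ := Trace.exists_labelling (w := diagram [] B) h2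
  have h3 : ∀ x t a b, (x, t, a, b) ∈ E → (t, a, b) ∈ expand B := by
    intro x t a b hx
    rw [← h1]
    exact List.mem_map_of_mem (f := Prod.snd) hx
  have h4 : ∀ t ∈ expand B, ∃ x, (x, t) ∈ E := by
    intro t ht
    rw [← h1] at ht
    obtain ⟨⟨x, t'⟩, hx, rfl⟩ := List.mem_map.1 ht
    exact ⟨x, hx⟩
  have h5 : Labelling.Connected (diagram [] B) T E := by
    refine ⟨hE, ?_, ?_⟩
    · have := h.nodup_expand.1
      rwa [← h1, List.map_map] at this
    · rintro ⟨x, t, e, e'⟩ he ⟨y, s, f, f'⟩ hf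
      refine Relation.ReflTransGen.mono ?_ _ _ (h.leads (h3 _ _ _ _ he) (h3 _ _ _ _ hf))
      rintro a b ⟨t, ht⟩
      obtain ⟨x, hx⟩ := h4 _ ht
      exact ⟨x, t, hx⟩
  have h6 : E ≠ [] := by
    rintro rfl
    obtain ⟨b, hb⟩ := List.exists_mem_of_ne_nil B hne
    have h7 : expand B = [] := h1.symm
    rw [expand, List.flatMap_eq_nil_iff] at h7
    have := h7 b hb
    cases b <;> simp [Box.expand] at this
  have hu : ∀ {o u : Bool} {a c d b : α}, .crossing o u a c d b ∈ B → 0 < q (dir u b c).2 := by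
    intro o u a c d b hb
    have := (h.flow _ hb).2
    omega
  have ho : ∀ {o u : Bool} {a c d b : α}, .crossing o u a c d b ∈ B → q (dir o a d).2 = 0 := by
    intro o u a c d b hb
    have := (h.flow _ hb).1
    rw [hz _ _ _ _ _ _ hb] at this
    exact this
  refine ⟨hL.closed, labelled L, hL.isOrientation h5 h6, ?_⟩
  -- `Blocked` means that the number is positive or that, inside a box, an under-passage was just
  -- made. Under-passages make it true, free over-strands exclude it, and only at marked labels can
  -- it be lost.
  refine (hL.overBridges_le hE (M := M.map ⟨Sum.inl, Sum.inl_injective⟩) (inP := Blocked B p p)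
    (outP := Blocked B q p) ?_ ?_ ?_ ?_ ?_).trans (by rw [Finset.card_map]; exact h.card)
  · have := h.nodup_expand.2
    rwa [← h1, List.map_map] at this
  · intro x s t hx hs
    obtain ⟨b, hb, hx⟩ := mem_expand.1 (h3 _ _ _ _ hx)
    cases b with
    | bivalent e a b =>
      have hf := h.flow _ hb
      simp only [Box.Flow] at hf
      cases e <;> simp [Box.expand] at hx <;> obtain ⟨rfl, rfl⟩ := hx <;>
        simp only [Blocked, dir_true, dir_false] at hf hs ⊢ <;> omega
    | crossing o u a c d b =>
      simp only [Box.expand, List.mem_cons, List.not_mem_nil, or_false, Prod.mk.injEq, reduceCtorEq,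
        false_and, true_and] at hx
      have hn := h.not_blocked hz hb
      have hq := hu hb
      rcases hx with hx | hx
      · cases o <;> simp at hx <;> obtain ⟨rfl, rfl⟩ := hx
        · exact absurd hs hn
        · exact .inl hs
      · cases u <;> simp at hx <;> obtain ⟨rfl, rfl⟩ := hx
        · exact hq
        · exact .inl hs
  · intro x s t hx hs
    obtain ⟨b, hb, hx⟩ := mem_expand.1 (h3 _ _ _ _ hx)
    cases b with
    | bivalent e a b => simp [Box.expand] at hx
    | crossing o u a c d b =>
      have hn := h.not_blocked hz hb
      have hp := hz _ _ _ _ _ _ hb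
      cases o <;> simp [Box.expand] at hx <;> obtain ⟨rfl, rfl⟩ := hx
      · simp only [Blocked, dir_false] at hs hp; omega
      · exact hn hs
  · intro x s t hx
    obtain ⟨b, hb, hx⟩ := mem_expand.1 (h3 _ _ _ _ hx)
    cases b with
    | bivalent e a b => simp [Box.expand] at hx
    | crossing o u a c d b =>
      have hq := hu hb
      cases u <;> simp [Box.expand] at hx <;> obtain ⟨rfl, rfl⟩ := hx
      · exact .inr ⟨_, _, _, _, hb⟩
      · exact hq
  · intro x t a b hx hM hb
    rcases b with e | e
    · have h7 : e ∉ M := fun he => hM (by simpa using he)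
      have h8 : Sum.inl e ∈ (expand B).map fun t => t.2.2 :=
        List.mem_map.2 ⟨_, h3 _ _ _ _ hx, rfl⟩
      have h9 : e ∈ sources B := by
        rw [h.perm.mem_iff, ← List.count_pos_iff, ← (count_expand_inl B e).2.1]
        exact List.count_pos_iff.2 h8
      have := h.eq e h7 h9
      simp only [Blocked] at hb ⊢
      omega
    · exact hb

end

/-! ### From over-bridges to a dance configuration -/

section
variable {w : Word} {O : Set DirPoint}

theorem PassesOver.not_passesUnder {k k' : ℕ} {x : DirPoint} (h : PassesOver w k x) :
    ¬ PassesUnder w k' x := by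
  intro h'
  obtain rfl := h.enters.unique h'.enters
  obtain ⟨p, ⟨h1, h2⟩ | ⟨h1, h2⟩⟩ := h <;> obtain ⟨p', ⟨h3, h4⟩ | ⟨h3, h4⟩⟩ := h' <;>
    rw [h1] at h3 <;> cases h3 <;> rcases h2 with rfl | rfl <;> simp at h4

theorem PassesUnder.hasClassicalCrossing {k : ℕ} {x : DirPoint} (h : PassesUnder w k x) :
    HasClassicalCrossing w := by
  obtain ⟨p, ⟨h1, -⟩ | ⟨h1, -⟩⟩ := h
  · exact ⟨_, List.mem_of_getElem? h1, .inl rfl⟩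
  · exact ⟨_, List.mem_of_getElem? h1, .inr rfl⟩

theorem IsOrientation.exists_passes (hO : IsOrientation w O) (hw : IsTangle 0 w 0)
    (h : HasClassicalCrossing w) :
    (∃ x ∈ O, ∃ k, PassesOver w k x) ∧ ∃ x ∈ O, ∃ k, PassesUnder w k x := by
  obtain ⟨⟨p, g⟩, hs, hg⟩ := h
  obtain ⟨k, hk, hs⟩ := List.mem_iff_getElem.1 hs
  have hs' : w[k]? = some ⟨p, g⟩ := List.getElem?_eq_some_iff.2 ⟨hk, hs⟩
  have hw' := hw
  rw [← List.take_append_drop k w, isTangle_append, List.drop_eq_getElem_cons hk] at hw'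
  obtain ⟨m, hm, hm'⟩ := hw'
  rw [hs, isTangle_cons] at hm'
  have hp := hm'.1
  rcases hg with rfl | rfl <;> simp only [Piece.ins] at hp
  all_goals
    obtain ⟨x, hx, -, -, hxx⟩ := hO.strand hw hs' (i := ⟨k, p, true⟩) (t := ⟨k + 1, p + 1, true⟩)
      (.inl ⟨rfl, rfl⟩) ⟨m, hm, by simp; omega⟩
      (by rw [travel_up hs']; simp [Slice.fromBelow, leave])
    obtain ⟨y, hy, -, -, hyy⟩ := hO.strand hw hs' (i := ⟨k, p + 1, true⟩) (t := ⟨k + 1, p, true⟩)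
      (.inl ⟨rfl, rfl⟩) ⟨m, hm, by simp; omega⟩
      (by rw [travel_up hs']; simp [Slice.fromBelow, leave])
  · exact ⟨⟨x, hx, k, p, .inl ⟨hs', hxx⟩⟩, ⟨y, hy, k, p, .inl ⟨hs', hyy⟩⟩⟩
  · exact ⟨⟨y, hy, k, p, .inr ⟨hs', hyy⟩⟩, ⟨x, hx, k, p, .inr ⟨hs', hxx⟩⟩⟩

/-- The dance takes place in two phases, where all over-strands are passed in the first phase and all
under-strands in the second phase. -/
theorem IsOrientation.isDanceConfiguration (hO : IsOrientation w O) {S : Finset DirPoint}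
    (hS : ∀ x ∈ S, x ∈ O) (hne : S.Nonempty) (late : DirPoint → Prop)
    (h1 : ∀ x ∈ O, travel w x ∉ S → late x → late (travel w x))
    (h2 : ∀ k, ∀ x ∈ O, PassesOver w k x → ¬ late x)
    (h3 : ∀ k, ∀ x ∈ O, PassesUnder w k x → late x) : IsDanceConfiguration w O S := by
  classical
  refine ⟨hS, ?_⟩
  obtain ⟨s, hs⟩ := hne
  -- The least element of `D x` is the number of steps to the next initial point. It is positive
  -- even at an initial point, and it decreases along each dancer's path.
  let D : DirPoint → Set ℕ := fun x => {i | 0 < i ∧ (travel w)^[i] x ∈ S}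
  have hD : ∀ x ∈ O, sInf (D x) ∈ D x := by
    intro x hx
    refine Nat.sInf_mem ?_
    obtain ⟨n, hn⟩ := hO.connected _ (hO.travel_mem x hx) s (hS s hs)
    exact ⟨n + 1, n.succ_pos, by rw [Function.iterate_succ_apply, hn]; exact hs⟩
  -- The second summand lies between 0 and 1 and grows towards the next initial point. The offset 2
  -- places the whole second phase behind the first.
  refine ⟨fun x => (if late x then 2 else 0) + 1 / ((sInf (D x) : ℕ) : ℝ), ?_, ?_⟩
  · intro x hx hxS
    have h4 := hD x hx
    have h5 := (hD _ (hO.travel_mem x hx)).1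
    have h6 : sInf (D (travel w x)) < sInf (D x) := by
      obtain ⟨i, hi⟩ : ∃ i, sInf (D x) = i + 1 := ⟨sInf (D x) - 1, by have := h4.1; omega⟩
      rw [hi] at h4 ⊢
      rcases Nat.eq_zero_or_pos i with rfl | hi0
      · exact absurd h4.2 hxS
      · exact Nat.lt_succ_of_le (Nat.sInf_le ⟨hi0, by
          have := h4.2; rwa [Function.iterate_succ_apply] at this⟩)
    have h7 : 1 / ((sInf (D x) : ℕ) : ℝ) < 1 / ((sInf (D (travel w x)) : ℕ) : ℝ) :=
      one_div_lt_one_div_of_lt (by exact_mod_cast h5) (by exact_mod_cast h6)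
    have h8 : (if late x then (2 : ℝ) else 0) ≤ if late (travel w x) then 2 else 0 := by
      by_cases h : late x
      · rw [if_pos h, if_pos (h1 x hx hxS h)]
      · rw [if_neg h]; split_ifs <;> norm_num
    exact add_lt_add_of_le_of_lt h8 h7
  · intro k x hx y hy hxo hyu
    have h4 : 1 / ((sInf (D x) : ℕ) : ℝ) ≤ 1 := by
      have : (1 : ℝ) ≤ (sInf (D x) : ℕ) := by exact_mod_cast (hD x hx).1
      rw [div_le_one (by linarith)]
      exact this
    have h5 : 0 ≤ 1 / ((sInf (D y) : ℕ) : ℝ) := by positivity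
    simp only [if_neg (h2 k x hx hxo), if_pos (h3 k y hy hyu)]
    linarith

theorem IsOrientation.exists_isDanceConfiguration (hO : IsOrientation w O) (hw : IsTangle 0 w 0) :
    ∃ S, IsDanceConfiguration w O S ∧ S.card ≤ overBridgeNumber w O := by
  classical
  by_cases hc : HasClassicalCrossing w
  · rw [overBridgeNumber, if_pos hc]
    have hfin : {x | x ∈ O ∧ StartsOverBridge w x}.Finite := hO.finite.subset fun x hx => hx.1
    -- `StartsOverBridge` speaks of the point before the undercrossing; one step further is the
    -- beginning of the bridge itself.
    let S : Finset DirPoint := hfin.toFinset.image (travel w)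
    have hS : ∀ z ∈ O, StartsOverBridge w z → travel w z ∈ S := fun z hz hz' =>
      Finset.mem_image_of_mem _ (by simpa using ⟨hz, hz'⟩)
    -- Between an undercrossing and a later overcrossing there is an initial point: the last
    -- undercrossing before that overcrossing starts an over-bridge.
    have key : ∀ k, ∀ y ∈ O, PassesUnder w k y → ∀ m, (∃ k, PassesOver w k ((travel w)^[m] y)) →
        ∃ i, 0 < i ∧ i ≤ m ∧ (travel w)^[i] y ∈ S := by
      intro k y hy hyu m ⟨k', hm⟩
      let P : ℕ → Prop := fun i => ∃ k, PassesUnder w k ((travel w)^[i] y)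
      let j := Nat.findGreatest P m
      have hj : P j := Nat.findGreatest_spec (m := 0) (Nat.zero_le _) ⟨k, hyu⟩
      have hjm : j ≤ m := Nat.findGreatest_le m
      have hjm' : j ≠ m := by
        intro h
        obtain ⟨k, hk⟩ := hj
        rw [h] at hk
        exact hm.not_passesUnder hk
      refine ⟨j + 1, j.succ_pos, by omega, ?_⟩
      rw [Function.iterate_succ_apply']
      refine hS _ (Set.MapsTo.iterate (fun x hx => hO.travel_mem x hx) j hy) ⟨hj, m - j, by omega,
        ⟨k', ?_⟩, ?_⟩
      · rw [← Function.iterate_add_apply, Nat.sub_add_cancel hjm]; exact hm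
      · intro i hi him
        rw [← Function.iterate_add_apply]
        exact Nat.findGreatest_is_greatest (P := P) (n := m) (show j < i + j by omega) (by omega)
    refine ⟨S, ?_, ?_⟩
    -- A point is late if its dancer passes no further overcrossing before stopping. By `key`, every
    -- undercrossing is late.
    · refine hO.isDanceConfiguration ?_ ?_
        (fun x => ¬ ∃ m, (∃ k, PassesOver w k ((travel w)^[m] x)) ∧
          ∀ i, 0 < i → i ≤ m → (travel w)^[i] x ∉ S) ?_ ?_ ?_
      · intro x hx
        obtain ⟨z, hz, rfl⟩ := Finset.mem_image.1 hx
        exact hO.travel_mem _ ((hfin.mem_toFinset.1 hz).1)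
      · obtain ⟨⟨x, hx, hxo⟩, y, hy, k, hyu⟩ := hO.exists_passes hw hc
        obtain ⟨m, rfl⟩ := hO.connected y hy x hx
        obtain ⟨i, -, -, hi⟩ := key k y hy hyu m hxo
        exact ⟨_, hi⟩
      · rintro x hx hxS hl ⟨m, hm, hmS⟩
        refine hl ⟨m + 1, by rwa [Function.iterate_succ_apply], ?_⟩
        rintro (_ | _ | i) hi him
        · omega
        · exact hxS
        · rw [Function.iterate_succ_apply]
          exact hmS _ (by omega) (by omega)
      · intro k x hx hxo hl
        exact hl ⟨0, ⟨k, hxo⟩, fun i hi him => by omega⟩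
      · rintro k y hy hyu ⟨m, hm, hmS⟩
        obtain ⟨i, hi, him, hiS⟩ := key k y hy hyu m hm
        exact hmS i hi him hiS
    · rw [Set.ncard_eq_toFinset_card _ hfin]
      exact Finset.card_image_le
  · rw [overBridgeNumber, if_neg hc]
    -- Without classical crossings any single initial point works, in agreement with the convention
    -- of one over-bridge.
    obtain ⟨x, hx⟩ := hO.nonempty
    refine ⟨{x}, ?_, by simp⟩
    refine hO.isDanceConfiguration (by simpa using hx) (by simp) (fun _ => False) ?_ ?_ ?_
    · exact fun _ _ _ h => h
    · exact fun _ _ _ _ h => h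
    · exact fun k y _ hyu => hc hyu.hasClassicalCrossing

/-- Without initial points time would increase at every step, which is impossible at a point where
the time is maximal on the finite cycle. -/
theorem IsDanceConfiguration.nonempty (hO : IsOrientation w O) {S : Finset DirPoint}
    (hS : IsDanceConfiguration w O S) : S.Nonempty := by
  rw [Finset.nonempty_iff_ne_empty]
  rintro rfl
  obtain ⟨-, τ, hτ, -⟩ := hS
  obtain ⟨x, hx, hmax⟩ := hO.finite.exists_maximalFor τ _ hO.nonempty
  have h1 := hτ x hx (by simp)
  have h2 := hmax (hO.travel_mem x hx) h1.le
  exact absurd h1 (not_lt.2 h2)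

end

/-- A dance configuration gives a diagram of the same knot with at most as many over-bridges. -/
theorem exists_overBridgeNumber_le (D : KnotDiagram) {O : Set DirPoint}
    (hO : IsOrientation D.word O) {S : Finset DirPoint} (hS : IsDanceConfiguration D.word O S) :
    ∃ (D' : KnotDiagram) (O' : Set DirPoint), Equivalent D.word D'.word ∧
      IsOrientation D'.word O' ∧ overBridgeNumber D'.word O' ≤ S.card := by
  obtain ⟨B, p, q, h1, h2, h3⟩ := hS.exists_calibration hO D.closed
  obtain ⟨B', p', q', h4, h5, h6, h7⟩ := h3.exists_sorted h2
  obtain ⟨h8, O', h9, h10⟩ := h4.exists_orientation h6 h7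
  refine ⟨⟨diagram [] B', h8, O', h9⟩, O', h1.trans h5, h9, ?_⟩
  rw [overBridgeNumber]
  split_ifs
  · exact h10
  -- A sorted diagram without classical crossings counts as one over-bridge, and there is at least
  -- one dancer.
  · exact (hS.nonempty hO).card_pos

end Welded

theorem mainTheorem2 (K : Welded.WeldedKnot) :
    K.unrestrictedIndex = K.overBridgeIndex := by
  obtain ⟨D₀, hD₀⟩ := Quotient.exists_rep K
  obtain ⟨O₀, hO₀⟩ := D₀.isKnot
  apply le_antisymm
  · obtain ⟨D, O, hD, hO, h⟩ := Nat.sInf_mem (s := {n | ∃ (D : Welded.KnotDiagram)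
      (O : Set Welded.DirPoint), Quotient.mk Welded.weldedSetoid D = K ∧
        Welded.IsOrientation D.word O ∧ Welded.overBridgeNumber D.word O = n})
      ⟨_, D₀, O₀, hD₀, hO₀, rfl⟩
    obtain ⟨S, hS, hS'⟩ := hO.exists_isDanceConfiguration D.closed
    calc K.unrestrictedIndex ≤ Welded.unrestrictedNumber D.word O :=
          Nat.sInf_le ⟨D, O, hD, hO, rfl⟩
      _ ≤ S.card := Nat.sInf_le ⟨S, rfl, hS⟩
      _ ≤ Welded.overBridgeNumber D.word O := hS'
      _ = K.overBridgeIndex := h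
  · obtain ⟨D, O, hD, hO, h⟩ := Nat.sInf_mem (s := {n | ∃ (D : Welded.KnotDiagram)
      (O : Set Welded.DirPoint), Quotient.mk Welded.weldedSetoid D = K ∧
        Welded.IsOrientation D.word O ∧ Welded.unrestrictedNumber D.word O = n})
      ⟨_, D₀, O₀, hD₀, hO₀, rfl⟩
    -- Some dance configuration exists, so the infimum below is attained and is not the default
    -- value 0 of an empty set.
    obtain ⟨S₀, hS₀, -⟩ := hO.exists_isDanceConfiguration D.closed
    obtain ⟨S, hS, hS'⟩ := Nat.sInf_mem (s := {n | ∃ S : Finset Welded.DirPoint, S.card = n ∧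
      Welded.IsDanceConfiguration D.word O S}) ⟨_, S₀, rfl, hS₀⟩
    obtain ⟨D', O', hD', hO', h'⟩ := Welded.exists_overBridgeNumber_le D hO hS'
    calc K.overBridgeIndex ≤ Welded.overBridgeNumber D'.word O' :=
          Nat.sInf_le ⟨D', O', (Quotient.sound (s := Welded.weldedSetoid)
            (Relation.EqvGen.symm _ _ hD')).trans hD, hO', rfl⟩
      _ ≤ S.card := h'
      _ = Welded.unrestrictedNumber D.word O := hS
      _ = K.unrestrictedIndex := h
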